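/- Let $n\ge 1$, $0<\alpha<1$ and $r>0$. Write $\Delta$ for the open unit disc of $\mathbb C$ and $D^{n-1}(\rho)$ for the open Euclidean ball of radius $\rho$ about $0$ in $\mathbb R^{n-1}$, and index $\mathbf t\in\mathbb R^{n-1}$ as $\mathbf t=(t_2,\dots,t_n)$. Let $$\mathbf S^n=\{z\in\mathbb C^n:\ \|z\|=1,\ \operatorname{Im}z_2=\dots=\operatorname{Im}z_n=0\},\qquad K=\{z\in\mathbb C^n:\operatorname{dist}(z,\mathbf S^n)<r\}.$$ Let $C^3(K;\mathbb C^n)$ be the space of (real) $C^3$ maps $K\to\mathbb C^n$ with bounded derivatives of order $\le 3$, with the usual norm. For $\phi\in C^3(K;\mathbb C^n)$ put $\mathbf S^n_\phi=\{z\in K: z+\phi(z)\in\mathbf S^n\}$; thus, if $\mathrm{id}+\phi$ is the inverse on $K$ of a diffeomorphism $\Psi$ carrying $\mathbf S^n$ into $K$, then $\mathbf S^n_\phi=\Psi(\mathbf S^n)$. Let $A^{1,\alpha}(\partial\Delta;\mathbb C^n)$ be the space of $f\in C^{1,\alpha}(\partial\Delta;\mathbb C^n)$ that extend to a map, again denoted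 $f$, that is holomorphic on $\Delta$ and of class $C^{1,\alpha}$ on $\overline\Delta$, with the norm of $C^{1,\alpha}(\partial\Delta;\mathbb C^n)$. Call $(\widetilde\Omega,F)$ a *disc family* if $\widetilde\Omega$ is an open neighbourhood of $D^{n-1}(1)\times\{0\}$ in $D^{n-1}(1)\times C^3(K;\mathbb C^n)$ and $F:\widetilde\Omega\to A^{1,\alpha}(\partial\Delta;\mathbb C^n)$ is a $C^1$ map such that $F(\mathbf t,0)(\xi)=(\sqrt{1-\|\mathbf t\|^2}\,\xi,\mathbf t)$ and, for every $(\mathbf t,\phi)\in\widetilde\Omega$, the disc $f=F(\mathbf t,\phi)$ satisfies $f(\partial\Delta)\subset\mathbf S^n_\phi$, $f_1(0)=0$ and $f_1'(0)>0$. **Theorem.** A disc family exists, and it can be chosen so that moreover $\operatorname{Re}F(\mathbf t,\phi)_j(0)=t_j$ for $j=2,\dots,n$ and all $(\mathbf t,\phi)\in\widetilde\Omega$. Let $(\widetilde\Omega,F)$ be any disc family. Then for each $t\in(0,1)$ there is an open neighbourhood $N_t$ of $0$ in $C^3(K;\mathbb C^n)$ such that $\overline{D^{n-1}(t)}\times N_t\subset\widetilde\Omega$,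 and such that for each $\phi\in N_t$ the map $$\mathcal F_\phi:\overline\Delta\times D^{n-1}(t)\to\mathbb C^n,\qquad \mathcal F_\phi(\xi,\mathbf t)=F(\mathbf t,\phi)(\xi),$$ is a $C^1$ embedding (up to the boundary $\partial\Delta\times D^{n-1}(t)$): it is of class $C^1$, an immersion, and a homeomorphism onto its image. The image $M_{\mathrm{TR}}=\mathcal F_\phi(\overline\Delta\times D^{n-1}(t))$ is the union of the pairwise disjoint analytic discs $\mathcal F_\phi(\overline\Delta\times\{\mathbf t\})$, $\mathbf t\in D^{n-1}(t)$; each map $\xi\mapsto\mathcal F_\phi(\xi,\mathbf t)$ is continuous on $\overline\Delta$, holomorphic on $\Delta$, and maps $\partial\Delta$ into $\mathbf S^n_\phi$. Further, $\phi\mapsto\mathcal F_\phi$ is a continuous map from $N_t$ into $C^1(\overline\Delta\times D^{n-1}(t);\mathbb C^n)$, the space of $C^1$ maps that are bounded together with their first derivatives, with the usual $C^1$ norm. -/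

import Mathlib

open Set Metric Topology
open scoped NNReal

noncomputable section

/-! ### The Banach spaces `C^k(X; F)` -/

section CkSpace

variable {E F : Type*} [NormedAddCommGroup E] [NormedSpace ℝ E]
  [NormedAddCommGroup F] [NormedSpace ℝ F]

/-- The functions of class `C^k` on `X` all of whose derivatives of order at most `k` are bounded
on `X`. Functions on `X` are encoded as functions on the ambient space that vanish off `X`;
derivatives are taken within `X`, which is assumed to determine them uniquely. -/
def ckSubmodule (k : ℕ) (X : Set E) (F : Type*) [NormedAddCommGroup F] [NormedSpace ℝ F]
    [hX : Fact (UniqueDiffOn ℝ X)] : Submodule ℝ (E → F) where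
  carrier := {f | (∀ x, x ∉ X → f x = 0) ∧ ContDiffOn ℝ k f X ∧
    ∀ j ≤ k, BddAbove (range fun x : X => ‖iteratedFDerivWithin ℝ j f X x‖)}
  zero_mem' := by
    refine ⟨fun _ _ => rfl, contDiffOn_const, fun j _ => ⟨0, ?_⟩⟩
    rintro _ ⟨x, rfl⟩
    have : iteratedFDerivWithin ℝ j (0 : E → F) X = 0 := iteratedFDerivWithin_fun_zero
    simp [this]
  add_mem' := by
    rintro f g ⟨hf0, hf, hfb⟩ ⟨hg0, hg, hgb⟩
    refine ⟨fun x hx => by simp [hf0 x hx, hg0 x hx], hf.add hg, fun j hj => ?_⟩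
    obtain ⟨a, ha⟩ := hfb j hj
    obtain ⟨b, hb⟩ := hgb j hj
    refine ⟨a + b, ?_⟩
    rintro _ ⟨x, rfl⟩
    have hj' : (j : WithTop ℕ∞) ≤ k := by exact_mod_cast hj
    simp only
    rw [iteratedFDerivWithin_add_apply ((hf x x.2).of_le hj') ((hg x x.2).of_le hj') hX.out x.2]
    exact (norm_add_le _ _).trans (add_le_add (ha ⟨x, rfl⟩) (hb ⟨x, rfl⟩))
  smul_mem' := by
    rintro c f ⟨hf0, hf, hfb⟩
    refine ⟨fun x hx => by simp [hf0 x hx], contDiffOn_const.smul hf, fun j hj => ?_⟩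
    obtain ⟨a, ha⟩ := hfb j hj
    refine ⟨‖c‖ * a, ?_⟩
    rintro _ ⟨x, rfl⟩
    have hj' : (j : WithTop ℕ∞) ≤ k := by exact_mod_cast hj
    simp only
    rw [iteratedFDerivWithin_const_smul_apply ((hf x x.2).of_le hj') hX.out x.2, norm_smul]
    exact mul_le_mul_of_nonneg_left (ha ⟨x, rfl⟩) (norm_nonneg c)

/-- The space `C^k(X; F)`. -/
def CkSpace (k : ℕ) (X : Set E) (F : Type*) [NormedAddCommGroup F] [NormedSpace ℝ F]
    [Fact (UniqueDiffOn ℝ X)] : Type _ :=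
  ↥(ckSubmodule k X F)

namespace CkSpace

variable {k : ℕ} {X : Set E} [hX : Fact (UniqueDiffOn ℝ X)]

instance : AddCommGroup (CkSpace k X F) :=
  inferInstanceAs (AddCommGroup ↥(ckSubmodule k X F))

instance : Module ℝ (CkSpace k X F) :=
  inferInstanceAs (Module ℝ ↥(ckSubmodule k X F))

instance : CoeFun (CkSpace k X F) (fun _ => E → F) := ⟨fun f => f.1⟩

/-- The supremum over `X` of the norm of the `j`-th derivative of `f`. -/
def supDeriv (j : ℕ) (f : CkSpace k X F) : ℝ :=
  ⨆ x : X, ‖iteratedFDerivWithin ℝ j f X x‖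

/-- The `C^k` norm: the sum over `j ≤ k` of the suprema of the `j`-th derivatives. -/
instance : Norm (CkSpace k X F) :=
  ⟨fun f => ∑ j ∈ Finset.range (k + 1), supDeriv j f⟩

theorem norm_def (f : CkSpace k X F) :
    ‖f‖ = ∑ j ∈ Finset.range (k + 1), supDeriv j f := rfl

theorem supDeriv_nonneg (j : ℕ) (f : CkSpace k X F) : 0 ≤ supDeriv j f :=
  Real.iSup_nonneg fun _ => norm_nonneg _

theorem le_supDeriv {j : ℕ} (hj : j ≤ k) (f : CkSpace k X F) (x : X) :
    ‖iteratedFDerivWithin ℝ j f X x‖ ≤ supDeriv j f :=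
  le_ciSup (f.2.2.2 j hj) x

theorem supDeriv_add_le {j : ℕ} (hj : j ≤ k) (f g : CkSpace k X F) :
    supDeriv j (f + g) ≤ supDeriv j f + supDeriv j g := by
  refine Real.iSup_le (fun x => ?_) (add_nonneg (supDeriv_nonneg j f) (supDeriv_nonneg j g))
  have hj' : (j : WithTop ℕ∞) ≤ k := by exact_mod_cast hj
  have h : iteratedFDerivWithin ℝ j (f + g : CkSpace k X F).1 X x =
      iteratedFDerivWithin ℝ j f.1 X x + iteratedFDerivWithin ℝ j g.1 X x :=
    iteratedFDerivWithin_add_apply ((f.2.2.1 x x.2).of_le hj') ((g.2.2.1 x x.2).of_le hj')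
      hX.out x.2
  rw [h]
  exact (norm_add_le _ _).trans (add_le_add (le_supDeriv hj f x) (le_supDeriv hj g x))

theorem supDeriv_smul {j : ℕ} (hj : j ≤ k) (c : ℝ) (f : CkSpace k X F) :
    supDeriv j (c • f) = ‖c‖ * supDeriv j f := by
  have hj' : (j : WithTop ℕ∞) ≤ k := by exact_mod_cast hj
  unfold supDeriv
  rw [Real.mul_iSup_of_nonneg (norm_nonneg c)]
  congr 1
  funext x
  have h : iteratedFDerivWithin ℝ j (c • f : CkSpace k X F).1 X x =
      c • iteratedFDerivWithin ℝ j f.1 X x :=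
    iteratedFDerivWithin_const_smul_apply ((f.2.2.1 x x.2).of_le hj') hX.out x.2
  rw [h, norm_smul]

theorem normCore : NormedSpace.Core ℝ (CkSpace k X F) where
  norm_nonneg f := Finset.sum_nonneg fun j _ => supDeriv_nonneg j f
  norm_smul c f := by
    rw [norm_def, norm_def, Finset.mul_sum]
    exact Finset.sum_congr rfl fun j hj =>
      supDeriv_smul (Nat.lt_succ_iff.1 (Finset.mem_range.1 hj)) c f
  norm_triangle f g := by
    rw [norm_def, norm_def, norm_def, ← Finset.sum_add_distrib]
    exact Finset.sum_le_sum fun j hj =>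
      supDeriv_add_le (Nat.lt_succ_iff.1 (Finset.mem_range.1 hj)) f g
  norm_eq_zero_iff f := by
    constructor
    · intro h
      rw [norm_def, Finset.sum_eq_zero_iff_of_nonneg fun j _ => supDeriv_nonneg j f] at h
      have h0 := h 0 (by simp)
      apply Subtype.ext
      funext x
      by_cases hx : x ∈ X
      · have h1 := le_supDeriv (Nat.zero_le k) f ⟨x, hx⟩
        rw [h0, norm_iteratedFDerivWithin_zero] at h1
        exact norm_le_zero_iff.1 h1
      · exact f.2.1 x hx
    · rintro rfl
      rw [norm_def]
      refine Finset.sum_eq_zero fun j hj => ?_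
      have h := supDeriv_smul (Nat.lt_succ_iff.1 (Finset.mem_range.1 hj)) 0
        (0 : CkSpace k X F)
      simpa using h

instance : NormedAddCommGroup (CkSpace k X F) := NormedAddCommGroup.ofCore normCore

instance : NormedSpace ℝ (CkSpace k X F) := NormedSpace.ofCore normCore

end CkSpace

end CkSpace

/-! ### The sphere and its perturbations -/

/-- `ℂⁿ` with `n = m + 1`. The coordinate `0` is the distinguished first coordinate `z₁`, and the
coordinates `j.succ` are `z₂, …, zₙ`. -/
abbrev Cn (m : ℕ) : Type := EuclideanSpace ℂ (Fin (m + 1))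

/-- The parameter space `ℝⁿ⁻¹ = ℝᵐ`. -/
abbrev Rm (m : ℕ) : Type := EuclideanSpace ℝ (Fin m)

/-- The unit sphere of `ℂ × ℝⁿ⁻¹`, as a subset of `ℂⁿ`. -/
def realSphere (m : ℕ) : Set (Cn m) :=
  {z | ‖z‖ = 1 ∧ ∀ j : Fin m, (z j.succ).im = 0}

/-- The open tube `K` of radius `r` about the sphere. -/
def tube (m : ℕ) (r : ℝ) : Set (Cn m) := {z | infDist z (realSphere m) < r}

theorem isOpen_tube (m : ℕ) (r : ℝ) : IsOpen (tube m r) :=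
  isOpen_lt (continuous_infDist_pt _) continuous_const

instance (m : ℕ) (r : ℝ) : Fact (UniqueDiffOn ℝ (tube m r)) := ⟨(isOpen_tube m r).uniqueDiffOn⟩

/-- The space `C³(K; ℂⁿ)`. -/
abbrev Perturbation (m : ℕ) (r : ℝ) : Type := CkSpace 3 (tube m r) (Cn m)

/-- The perturbed sphere: the points of `K` that `id + φ` maps into the sphere. When `id + φ` is
the inverse on `K` of a diffeomorphism `Ψ` carrying the sphere into `K`, this is the image of the
sphere under `Ψ`. -/
def perturbedSphere {m : ℕ} {r : ℝ} (φ : Perturbation m r) : Set (Cn m) :=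
  {z | z ∈ tube m r ∧ z + φ z ∈ realSphere m}

/-! ### Hölder spaces on the circle and boundary values of holomorphic maps -/

/-- The angular derivative of a function on the unit circle. -/
def circleDeriv {m : ℕ} (f : Circle → Cn m) (z : Circle) : Cn m :=
  deriv (fun θ : ℝ => f (z * Circle.exp θ)) 0

/-- `f ∈ C^{1,α}(∂Δ; ℂⁿ)`. -/
structure IsC1HolderCircle {m : ℕ} (α : ℝ≥0) (f : Circle → Cn m) : Prop where
  contDiff : ContDiff ℝ 1 fun θ : ℝ => f (Circle.exp θ)
  holder : MemHolder α f
  holder_deriv : MemHolder α (circleDeriv f)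

/-- The closed unit disc. -/
abbrev cDisc : Set ℂ := closedBall (0 : ℂ) 1

/-- `h` is holomorphic on the open unit disc and of class `C^{1,α}` on the closed disc. -/
structure IsC1HolderHol {m : ℕ} (α : ℝ≥0) (h : ℂ → Cn m) : Prop where
  holo : DifferentiableOn ℂ h (ball 0 1)
  contDiffOn : ContDiffOn ℝ 1 h cDisc
  holder : MemHolder α (cDisc.domRestrict h)
  holder_deriv : MemHolder α (cDisc.domRestrict (fderivWithin ℝ h cDisc))

theorem uniqueDiffOn_cDisc : UniqueDiffOn ℝ cDisc :=
  uniqueDiffOn_convex (convex_closedBall _ _) (by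
    rw [interior_closedBall _ one_ne_zero]
    exact ⟨0, mem_ball_self one_pos⟩)

section Disc

variable {m : ℕ} {α : ℝ≥0}

theorem IsC1HolderCircle.differentiableAt {f : Circle → Cn m} (hf : IsC1HolderCircle α f)
    (z : Circle) : DifferentiableAt ℝ (fun θ : ℝ => f (z * Circle.exp θ)) 0 := by
  have h : (fun θ : ℝ => f (z * Circle.exp θ)) =
      (fun θ : ℝ => f (Circle.exp θ)) ∘ fun θ : ℝ => Complex.arg z + θ := by
    funext θ
    simp [Circle.exp_add]
  rw [h]
  exact ((hf.contDiff.differentiable one_ne_zero) _).comp _ (by fun_prop)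

theorem circleDeriv_add {f g : Circle → Cn m} (hf : IsC1HolderCircle α f)
    (hg : IsC1HolderCircle α g) : circleDeriv (f + g) = circleDeriv f + circleDeriv g := by
  funext z
  exact deriv_add (hf.differentiableAt z) (hg.differentiableAt z)

theorem circleDeriv_smul (c : ℝ) {f : Circle → Cn m} (hf : IsC1HolderCircle α f) :
    circleDeriv (c • f) = c • circleDeriv f := by
  funext z
  exact deriv_const_smul c (hf.differentiableAt z)

theorem IsC1HolderCircle.zero : IsC1HolderCircle α (0 : Circle → Cn m) := by
  have h : circleDeriv (0 : Circle → Cn m) = 0 := by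
    funext z
    exact deriv_const 0 (0 : Cn m)
  refine ⟨contDiff_const, memHolder_zero, ?_⟩
  rw [h]
  exact memHolder_zero

theorem IsC1HolderCircle.add {f g : Circle → Cn m} (hf : IsC1HolderCircle α f)
    (hg : IsC1HolderCircle α g) : IsC1HolderCircle α (f + g) := by
  refine ⟨hf.contDiff.add hg.contDiff, hf.holder.add hg.holder, ?_⟩
  rw [circleDeriv_add hf hg]
  exact hf.holder_deriv.add hg.holder_deriv

theorem IsC1HolderCircle.smul (c : ℝ) {f : Circle → Cn m} (hf : IsC1HolderCircle α f) :
    IsC1HolderCircle α (c • f) := by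
  refine ⟨contDiff_const.smul hf.contDiff, hf.holder.smul, ?_⟩
  rw [circleDeriv_smul c hf]
  exact hf.holder_deriv.smul

theorem IsC1HolderHol.zero : IsC1HolderHol α (0 : ℂ → Cn m) := by
  refine ⟨differentiableOn_const _, contDiffOn_const, memHolder_zero, ?_⟩
  have h : fderivWithin ℝ (0 : ℂ → Cn m) cDisc = 0 := fderivWithin_zero
  rw [h]
  exact memHolder_zero

theorem IsC1HolderHol.add {f g : ℂ → Cn m} (hf : IsC1HolderHol α f)
    (hg : IsC1HolderHol α g) : IsC1HolderHol α (f + g) := by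
  refine ⟨hf.holo.add hg.holo, hf.contDiffOn.add hg.contDiffOn, hf.holder.add hg.holder, ?_⟩
  have h : cDisc.domRestrict (fderivWithin ℝ (f + g) cDisc) =
      cDisc.domRestrict (fderivWithin ℝ f cDisc) + cDisc.domRestrict (fderivWithin ℝ g cDisc) := by
    funext x
    exact fderivWithin_add (uniqueDiffOn_cDisc x x.2)
      (hf.contDiffOn.differentiableOn one_ne_zero x x.2)
      (hg.contDiffOn.differentiableOn one_ne_zero x x.2)
  rw [h]
  exact hf.holder_deriv.add hg.holder_deriv

theorem IsC1HolderHol.smul (c : ℝ) {f : ℂ → Cn m} (hf : IsC1HolderHol α f) :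
    IsC1HolderHol α (c • f) := by
  refine ⟨hf.holo.const_smul c, contDiffOn_const.smul hf.contDiffOn, hf.holder.smul, ?_⟩
  have h : cDisc.domRestrict (fderivWithin ℝ (c • f) cDisc) =
      c • cDisc.domRestrict (fderivWithin ℝ f cDisc) := by
    funext x
    exact fderivWithin_const_smul (uniqueDiffOn_cDisc x x.2)
      (hf.contDiffOn.differentiableOn one_ne_zero x x.2) c
  rw [h]
  exact hf.holder_deriv.smul

end Disc

/-- The functions in `C^{1,α}(∂Δ; ℂⁿ)` that are the boundary values of a map that is holomorphic on
the open disc and of class `C^{1,α}` on the closed disc. -/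
def holDiscSubmodule (m : ℕ) (α : ℝ≥0) : Submodule ℝ (Circle → Cn m) where
  carrier := {f | IsC1HolderCircle α f ∧
    ∃ h : ℂ → Cn m, IsC1HolderHol α h ∧ ∀ z : Circle, h z = f z}
  zero_mem' := ⟨.zero, 0, .zero, fun _ => rfl⟩
  add_mem' := by
    rintro f g ⟨hf, f', hf', hff'⟩ ⟨hg, g', hg', hgg'⟩
    exact ⟨hf.add hg, f' + g', hf'.add hg', fun z => by simp [hff', hgg']⟩
  smul_mem' := by
    rintro c f ⟨hf, f', hf', hff'⟩
    exact ⟨hf.smul c, c • f', hf'.smul c, fun z => by simp [hff']⟩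

/-- The space `A^{1,α}(∂Δ; ℂⁿ)`. -/
def HolDisc (m : ℕ) (α : ℝ≥0) : Type := ↥(holDiscSubmodule m α)

namespace HolDisc

variable {m : ℕ} {α : ℝ≥0}

instance : AddCommGroup (HolDisc m α) := inferInstanceAs (AddCommGroup ↥(holDiscSubmodule m α))

instance : Module ℝ (HolDisc m α) := inferInstanceAs (Module ℝ ↥(holDiscSubmodule m α))

/-- The boundary values of a disc. -/
instance : CoeFun (HolDisc m α) (fun _ => Circle → Cn m) := ⟨fun f => f.1⟩

/-- The holomorphic extension of `f` to the closed disc (it is unique there, and only its values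
there are ever used). -/
def ext (f : HolDisc m α) : ℂ → Cn m := f.2.2.choose

theorem isC1HolderHol_ext (f : HolDisc m α) : IsC1HolderHol α f.ext := f.2.2.choose_spec.1

theorem ext_coe (f : HolDisc m α) (z : Circle) : f.ext z = f z := f.2.2.choose_spec.2 z

/-- The extension is determined on the closed disc by its defining properties. -/
theorem ext_eqOn (f : HolDisc m α) {h : ℂ → Cn m} (hh : IsC1HolderHol α h)
    (hb : ∀ z : Circle, h z = f z) : EqOn f.ext h cDisc := by
  have key : ∀ g : ℂ → Cn m, IsC1HolderHol α g → DiffContOnCl ℂ g (ball 0 1) := fun g hg =>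
    ⟨hg.holo, by rw [closure_ball _ one_ne_zero]; exact hg.contDiffOn.continuousOn⟩
  have := Complex.eqOn_closure_of_eqOn_frontier (isBounded_ball (x := (0 : ℂ)) (r := 1))
    (key _ f.isC1HolderHol_ext) (key _ hh) (fun z hz => by
      rw [frontier_ball _ one_ne_zero] at hz
      have h1 := f.ext_coe ⟨z, by simpa [Submonoid.unitSphere] using hz⟩
      have h2 := hb ⟨z, by simpa [Submonoid.unitSphere] using hz⟩
      exact h1.trans h2.symm)
  rwa [closure_ball _ one_ne_zero] at this

/-- The `C^{1,α}(∂Δ; ℂⁿ)` norm: for the function and for its angular derivative, the supremum norm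
plus the best Hölder constant of exponent `α`. -/
instance : Norm (HolDisc m α) :=
  ⟨fun f => ((⨆ z, ‖f z‖) + nnHolderNorm α f.1) +
    ((⨆ z, ‖circleDeriv f z‖) + nnHolderNorm α (circleDeriv f))⟩

theorem norm_def (f : HolDisc m α) : ‖f‖ = ((⨆ z, ‖f z‖) + nnHolderNorm α f.1) +
    ((⨆ z, ‖circleDeriv f z‖) + nnHolderNorm α (circleDeriv f)) := rfl

/-- The `C^{0,α}` norm of a function on the circle. -/
def holderNorm (α : ℝ≥0) (f : Circle → Cn m) : ℝ := (⨆ z, ‖f z‖) + nnHolderNorm α f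

theorem holderNorm_nonneg (f : Circle → Cn m) : 0 ≤ holderNorm α f :=
  add_nonneg (Real.iSup_nonneg fun _ => norm_nonneg _) NNReal.zero_le_coe

theorem bddAbove_of_memHolder {f : Circle → Cn m} (hf : MemHolder α f) :
    BddAbove (range fun z => ‖f z‖) := by
  obtain ⟨C, hC⟩ := hf
  refine ⟨‖f 1‖ + C * 2 ^ (α : ℝ), ?_⟩
  rintro _ ⟨z, rfl⟩
  have h1 := hC.dist_le z 1
  have h2 : dist z 1 ≤ 2 := by
    have h := norm_sub_le (z : ℂ) 1
    have e : dist z 1 = ‖(z : ℂ) - 1‖ := dist_eq_norm (z : ℂ) 1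
    rw [Circle.norm_coe, norm_one] at h
    linarith
  have h3 : (C : ℝ) * dist z 1 ^ (α : ℝ) ≤ C * 2 ^ (α : ℝ) := by gcongr
  have h4 : ‖f z‖ ≤ ‖f 1‖ + dist (f z) (f 1) := by
    have := norm_add_le (f 1) (f z - f 1)
    rw [dist_eq_norm]
    simpa using this
  linarith

theorem holderNorm_add_le {f g : Circle → Cn m} (hf : MemHolder α f) (hg : MemHolder α g) :
    holderNorm α (f + g) ≤ holderNorm α f + holderNorm α g := by
  have h1 : (⨆ z, ‖(f + g) z‖) ≤ (⨆ z, ‖f z‖) + ⨆ z, ‖g z‖ :=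
    ciSup_le fun z => (norm_add_le _ _).trans (add_le_add
      (le_ciSup (bddAbove_of_memHolder hf) z) (le_ciSup (bddAbove_of_memHolder hg) z))
  have h2 : (nnHolderNorm α (f + g) : ℝ) ≤ nnHolderNorm α f + nnHolderNorm α g := by
    exact_mod_cast hf.nnHolderNorm_add_le hg
  unfold holderNorm
  linarith

theorem holderNorm_smul (c : ℝ) {f : Circle → Cn m} (hf : MemHolder α f) :
    holderNorm α (c • f) = ‖c‖ * holderNorm α f := by
  have h1 : (⨆ z, ‖(c • f) z‖) = ‖c‖ * ⨆ z, ‖f z‖ := by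
    rw [Real.mul_iSup_of_nonneg (norm_nonneg c)]
    simp [norm_smul]
  have h2 : (nnHolderNorm α (c • f) : ℝ) = ‖c‖ * nnHolderNorm α f := by
    rw [hf.nnHolderNorm_smul]
    simp
  unfold holderNorm
  rw [h1, h2]
  ring

theorem normCore : NormedSpace.Core ℝ (HolDisc m α) where
  norm_nonneg f := add_nonneg (holderNorm_nonneg f.1) (holderNorm_nonneg (circleDeriv f.1))
  norm_smul c f := by
    have h1 := holderNorm_smul c f.2.1.holder
    have h2 := holderNorm_smul c f.2.1.holder_deriv
    rw [← circleDeriv_smul c f.2.1] at h2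
    change holderNorm α (c • f.1) + holderNorm α (circleDeriv (c • f.1)) =
      ‖c‖ * (holderNorm α f.1 + holderNorm α (circleDeriv f.1))
    rw [h1, h2]
    ring
  norm_triangle f g := by
    have h1 := holderNorm_add_le f.2.1.holder g.2.1.holder
    have h2 := holderNorm_add_le f.2.1.holder_deriv g.2.1.holder_deriv
    rw [← circleDeriv_add f.2.1 g.2.1] at h2
    change holderNorm α (f.1 + g.1) + holderNorm α (circleDeriv (f.1 + g.1)) ≤
      (holderNorm α f.1 + holderNorm α (circleDeriv f.1)) +
        (holderNorm α g.1 + holderNorm α (circleDeriv g.1))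
    linarith
  norm_eq_zero_iff f := by
    constructor
    · intro h
      change holderNorm α f.1 + holderNorm α (circleDeriv f.1) = 0 at h
      have h1 := holderNorm_nonneg (α := α) f.1
      have h2 := holderNorm_nonneg (α := α) (circleDeriv f.1)
      have h3 : holderNorm α f.1 = 0 := by linarith
      apply Subtype.ext
      funext z
      have h4 := le_ciSup (bddAbove_of_memHolder f.2.1.holder) z
      have h5 : (0 : ℝ) ≤ nnHolderNorm α f.1 := NNReal.zero_le_coe
      unfold holderNorm at h3
      have h6 : ‖f.1 z‖ ≤ 0 := by
        have h7 : ‖f.1 z‖ ≤ ⨆ w, ‖f.1 w‖ := h4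
        linarith
      exact norm_le_zero_iff.1 h6
    · rintro rfl
      have h1 := holderNorm_smul (α := α) 0 (f := (0 : Circle → Cn m)) memHolder_zero
      have h0 : circleDeriv (0 : Circle → Cn m) = 0 := by
        funext z
        exact deriv_const 0 (0 : Cn m)
      change holderNorm α (0 : Circle → Cn m) +
        holderNorm α (circleDeriv (0 : Circle → Cn m)) = 0
      rw [h0]
      simp only [smul_zero, norm_zero, zero_mul] at h1
      rw [h1, add_zero]

instance : NormedAddCommGroup (HolDisc m α) := NormedAddCommGroup.ofCore normCore

instance : NormedSpace ℝ (HolDisc m α) := NormedSpace.ofCore normCore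

end HolDisc

/-! ### Families of attached discs -/

/-- `f` is a normalized analytic disc attached to `S`: its boundary lies in `S`, and its first
component vanishes at `0` with positive derivative there. -/
structure IsNormalizedAttached {m : ℕ} {α : ℝ≥0} (S : Set (Cn m)) (f : HolDisc m α) : Prop where
  attached : ∀ z : Circle, f z ∈ S
  center : f.ext 0 0 = 0
  deriv_im : (deriv (fun ξ : ℂ => f.ext ξ 0) 0).im = 0
  deriv_pos : 0 < (deriv (fun ξ : ℂ => f.ext ξ 0) 0).re

/-- `F` is a `C¹` map from a neighbourhood `Ω` of `D × {0}` in `D × C³(K; ℂⁿ)`, where `D` is the open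
unit ball of `ℝⁿ⁻¹`, to `A^{1,α}(∂Δ; ℂⁿ)`, which at `φ = 0` gives the standard discs
`ξ ↦ (√(1 - ‖t‖²) ξ, t)` and whose value at `(t, φ)` is a normalized analytic disc attached to the
sphere perturbed by `φ`. -/
structure IsDiscFamily {m : ℕ} {r : ℝ} {α : ℝ≥0} (Ω : Set (Rm m × Perturbation m r))
    (F : Rm m × Perturbation m r → HolDisc m α) : Prop where
  isOpen : IsOpen Ω
  subset : Ω ⊆ ball 0 1 ×ˢ univ
  base_mem : ball (0 : Rm m) 1 ×ˢ {0} ⊆ Ω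
  contDiffOn : ContDiffOn ℝ 1 F Ω
  base : ∀ t ∈ ball (0 : Rm m) 1, ∀ z : Circle,
    F (t, 0) z 0 = (√(1 - ‖t‖ ^ 2) : ℝ) * (z : ℂ) ∧ ∀ j : Fin m, F (t, 0) z j.succ = (t j : ℂ)
  normalized : ∀ p ∈ Ω, IsNormalizedAttached (perturbedSphere p.2) (F p)

/-- The map `(ξ, t) ↦ F(t, φ)(ξ)`. -/
def foliationMap {m : ℕ} {r : ℝ} {α : ℝ≥0} (F : Rm m × Perturbation m r → HolDisc m α)
    (φ : Perturbation m r) : ℂ × Rm m → Cn m :=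
  fun p => (F (p.2, φ)).ext p.1

/-- The product of the closed unit disc and the open ball of radius `t` in `ℝⁿ⁻¹`. -/
def discTimesBall (m : ℕ) (t : ℝ) : Set (ℂ × Rm m) := cDisc ×ˢ ball 0 t

instance (m : ℕ) (t : ℝ) : Fact (UniqueDiffOn ℝ (discTimesBall m t)) :=
  ⟨uniqueDiffOn_cDisc.prod isOpen_ball.uniqueDiffOn⟩

/-- `g` is a `C¹` embedding of `X`: it is `C¹` on `X` (up to the boundary points in `X`), an
immersion, and a homeomorphism onto its image. -/
structure IsC1Embedding {E F : Type*} [NormedAddCommGroup E] [NormedSpace ℝ E]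
    [NormedAddCommGroup F] [NormedSpace ℝ F] (g : E → F) (X : Set E) : Prop where
  contDiffOn : ContDiffOn ℝ 1 g X
  immersion : ∀ x ∈ X, Function.Injective (fderivWithin ℝ g X x)
  isEmbedding : IsEmbedding (X.domRestrict g)

/-- `f` is an analytic disc with boundary in `S`. -/
structure IsAnalyticDisc {m : ℕ} (f : ℂ → Cn m) (S : Set (Cn m)) : Prop where
  continuousOn : ContinuousOn f cDisc
  holo : DifferentiableOn ℂ f (ball 0 1)
  boundary : MapsTo f (sphere 0 1) S

end

/-! Attached discs are solutions of a nonlinear Riemann–Hilbert problem, solved by the implicit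
function theorem near each standard disc.

A real Hölder function `u` on the circle has a Schwarz primitive `S u`: the holomorphic function
whose real part has angular derivative `u - mean u` and whose value at the centre is `mean u`. It is
of class `C^{1,α}` up to the boundary because the Cauchy integral preserves Hölder classes
(`exists_isSchwarzPrimitive`). Near the standard disc with parameter `t`, a disc is sought as the
standard disc plus a deviation with components `z S(w_0)` and `i S(w_j)`, where `w` is a tuple of
real Hölder functions (`trialDisc`). The factor `z` makes the first component vanish at the centre
with a real derivative there, and the factor `i` leaves `Re f_j(0) = t_j`, so these normalizations
are built in; positivity of the derivative is an open condition.

The boundary loop `f + φ ∘ f` lies in the sphere iff `‖·‖² - 1` and the imaginary parts of the last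
coordinates vanish along it. Each such function vanishes iff its angular derivative plus its mean
vanishes, and `attachMap` collects these sums. Working with derivatives means that only `C^α` norms
have to be controlled. The map is `C¹` jointly in `t`, `φ`, `w`: by the chain rule everything
reduces to composing the derivatives of `φ` of order at most two with `f` in the sup norm, which is
jointly `C¹` for `φ` in `C³` (`IsBoundedC1Family.contDiffOn_superposition`,
`contDiffOn_derivAlong`). At `φ = 0`, `w = 0` the derivative in `w` is triangular: it returns `w_j`
in the last slots (`defectDeriv_succ`), and it is multiplication by `2√(1 - ‖t‖²)` in the first slot
when the others vanish (`defectDeriv_zero`). Hence it is invertible, and local uniqueness glues the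
local solutions into one family (`exists_contDiffOn_of_local`).

For the second assertion let a disc family be given. On the closed disc times a closed ball of
radius `t < 1` the standard family expands distances up to a constant (`exists_expanding_baseDisc`).
By compactness and the maximum principle, the difference between the map for `φ` and the map for `0`
has a small Lipschitz constant there once `φ` is small (`norm_foliationMap_sub_sub_le`). So the
perturbed map still expands distances, and a `C¹` map of this kind on a convex set with interior
points is an embedding up to the boundary (`isC1Embedding_of_expanding`). The same bounds give
continuity in the `C¹` norm. -/

/-! ### Kernel estimates, the Hardy–Littlewood lemma and Hölder extension to the closure. -/

theorem holderOnWith_of_dist_le {X Y : Type*} [PseudoMetricSpace X] [PseudoMetricSpace Y]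
    {f : X → Y} {s : Set X} {C α : ℝ≥0}
    (h : ∀ x ∈ s, ∀ y ∈ s, dist (f x) (f y) ≤ C * dist x y ^ (α : ℝ)) : HolderOnWith C α f s := by
  intro x hx y hy
  rw [edist_nndist, edist_nndist, ← ENNReal.coe_rpow_of_nonneg _ α.coe_nonneg, ← ENNReal.coe_mul,
    ENNReal.coe_le_coe, ← NNReal.coe_le_coe]
  simpa using h x hx y hy

theorem continuousOn_of_norm_sub_le_rpow {E F : Type*} [SeminormedAddCommGroup E]
    [SeminormedAddCommGroup F] {f : E → F} {s : Set E} {C a : ℝ} (ha : 0 < a)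
    (hC : 0 ≤ C) (h : ∀ x ∈ s, ∀ y ∈ s, ‖f x - f y‖ ≤ C * ‖x - y‖ ^ a) : ContinuousOn f s := by
  lift C to ℝ≥0 using hC
  lift a to ℝ≥0 using ha.le
  have := holderOnWith_of_dist_le (f := f) (s := s) (C := C) (α := a) fun x hx y hy => by
    simpa only [dist_eq_norm] using h x hx y hy
  exact this.continuousOn (by exact_mod_cast ha)

open Real in
-- The exponent is below `-1`, so the explicit primitive on `[0, π]` is dominated by its value at
-- `0`; the term at `π` has a favourable sign and is dropped. Evenness gives the factor `2`.
theorem intervalIntegral_add_abs_rpow_le {a δ : ℝ} (ha : a < 1) (hδ : 0 < δ) :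
    ∫ φ in (-π)..π, (δ + |φ|) ^ (a - 2) ≤ 2 / (1 - a) * δ ^ (a - 1) := by
  have hc : ∀ s t : ℝ, IntervalIntegrable (fun φ : ℝ => (δ + |φ|) ^ (a - 2)) MeasureTheory.volume s t :=
    fun s t => Continuous.intervalIntegrable (Continuous.rpow_const (by fun_prop)
      fun x => Or.inl (by positivity)) _ _
  have h1 : ∫ φ in (0:ℝ)..π, (δ + |φ|) ^ (a - 2) ≤ 1 / (1 - a) * δ ^ (a - 1) := by
    have e : ∫ φ in (0:ℝ)..π, (δ + |φ|) ^ (a - 2) = ∫ φ in (0:ℝ)..π, (δ + φ) ^ (a - 2) := by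
      refine intervalIntegral.integral_congr fun φ hφ => ?_
      rw [uIcc_of_le pi_pos.le] at hφ
      simp only [abs_of_nonneg hφ.1]
    rw [e, intervalIntegral.integral_comp_add_left (fun x : ℝ => x ^ (a - 2)),
      integral_rpow (Or.inr ⟨by linarith, ?_⟩)]
    · have e2 : a - 2 + 1 = a - 1 := by ring
      have h0 : 0 ≤ (δ + π) ^ (a - 1) := rpow_nonneg (by positivity) _
      have h1 : 0 < 1 - a := by linarith
      rw [e2, add_zero, ← neg_div_neg_eq, neg_sub, neg_sub, one_div_mul_eq_div]
      gcongr
      linarith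
    · rw [uIcc_of_le (by linarith [pi_pos])]
      intro h
      linarith [h.1]
  have h2 : ∫ φ in (-π)..0, (δ + |φ|) ^ (a - 2) = ∫ φ in (0:ℝ)..π, (δ + |φ|) ^ (a - 2) := by
    have := intervalIntegral.integral_comp_neg (a := -π) (b := 0) (fun φ : ℝ => (δ + |φ|) ^ (a - 2))
    simpa using this
  rw [← intervalIntegral.integral_add_adjacent_intervals (hc _ 0) (hc 0 _), h2]
  calc _ ≤ 1 / (1 - a) * δ ^ (a - 1) + 1 / (1 - a) * δ ^ (a - 1) := add_le_add h1 h1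
    _ = _ := by ring

open Real in
-- The radial gap `1 - ‖z‖` is at most `‖ζ - z‖`, so replacing `z` by its radial projection at most
-- doubles the distance to `ζ`. Jordan's inequality compares the resulting chord with `|φ|`.
theorem add_abs_le_norm_circleMap_sub {z : ℂ} (hz : ‖z‖ < 1) {φ : ℝ} (hφ : |φ| ≤ π) :
    (2 * π)⁻¹ * ((1 - ‖z‖) + |φ|) ≤ ‖circleMap 0 1 (φ + Complex.arg z) - z‖ := by
  set ζ := circleMap 0 1 (φ + Complex.arg z) with hζ
  have hn : ‖ζ‖ = 1 := by simp [hζ]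
  have h1 : 1 - ‖z‖ ≤ ‖ζ - z‖ := by
    have := norm_sub_norm_le ζ z
    rwa [hn] at this
  have h2 : ‖ζ - circleMap 0 1 (Complex.arg z)‖ ≤ 2 * ‖ζ - z‖ := by
    have e : z - circleMap 0 1 (Complex.arg z) = ((‖z‖ - 1 : ℝ) : ℂ) * circleMap 0 1 (Complex.arg z) := by
      have := Complex.norm_mul_exp_arg_mul_I z
      simp only [circleMap, zero_add, Complex.ofReal_one, one_mul]
      rw [Complex.ofReal_sub, sub_mul, this]
      simp
    have h3 := norm_add_le (ζ - z) (z - circleMap 0 1 (Complex.arg z))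
    rw [sub_add_sub_cancel, e, norm_mul, norm_circleMap_zero, Complex.norm_real, Real.norm_eq_abs,
      abs_sub_comm, abs_of_pos (by linarith : 0 < 1 - ‖z‖)] at h3
    simp only [abs_one, mul_one] at h3
    linarith
  have h4 : 2 / π * |φ| ≤ ‖ζ - circleMap 0 1 (Complex.arg z)‖ := by
    have e : ζ - circleMap 0 1 (Complex.arg z) =
        circleMap 0 1 (Complex.arg z) * (Complex.exp (Complex.I * φ) - 1) := by
      simp only [hζ, circleMap, zero_add, Complex.ofReal_one, one_mul, mul_sub, mul_one,
        ← Complex.exp_add]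
      congr 2
      push_cast
      ring
    rw [e, norm_mul, norm_circleMap_zero, Complex.norm_exp_I_mul_ofReal_sub_one, norm_mul,
      Real.norm_eq_abs, Real.norm_eq_abs, abs_of_pos (by norm_num : (0:ℝ) < 2), abs_one, one_mul]
    have h5 := Real.mul_abs_le_abs_sin (x := φ / 2) (by rw [abs_div, abs_two]; linarith)
    rw [abs_div, abs_two] at h5
    linarith
  have hπ := pi_gt_three
  have h6 : |φ| ≤ π * ‖ζ - z‖ := by
    have := h4.trans h2
    rw [div_mul_eq_mul_div, div_le_iff₀ pi_pos] at this
    linarith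
  rw [inv_mul_le_iff₀ (by positivity)]
  nlinarith [norm_nonneg (ζ - z)]

open Real in
theorem circleAverage_norm_sub_rpow_le {a : ℝ} (ha : a < 1) {z : ℂ} (hz : ‖z‖ < 1) :
    circleAverage (fun ζ => ‖ζ - z‖ ^ (a - 2)) 0 1 ≤
      (2 * π)⁻¹ * ((2 * π) ^ (2 - a) * (2 / (1 - a))) * (1 - ‖z‖) ^ (a - 1) := by
  have hne : ∀ θ : ℝ, 0 < ‖circleMap 0 1 θ - z‖ := fun θ => by
    have h0 : 1 - ‖z‖ ≤ ‖circleMap 0 1 θ - z‖ := by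
      have := norm_sub_norm_le (circleMap 0 1 θ) z
      simpa using this
    linarith
  have hcont : ∀ c : ℝ, Continuous fun θ : ℝ => ‖circleMap 0 1 (θ + c) - z‖ ^ (a - 2) := fun c =>
    Continuous.rpow_const (by fun_prop) fun x => Or.inl (hne _).ne'
  have hδ : 0 < 1 - ‖z‖ := by linarith
  -- The period is centred at `arg z`, so that the angle measured from `z` stays in `[-π, π]`, as
  -- the lower bound for the distance requires.
  rw [circleAverage_eq_integral_add (Complex.arg z - π), smul_eq_mul, mul_assoc, mul_assoc]
  gcongr
  have e : ∫ θ in (0:ℝ)..(2 * π), ‖circleMap 0 1 (θ + (Complex.arg z - π)) - z‖ ^ (a - 2) =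
      ∫ φ in (-π)..π, ‖circleMap 0 1 (φ + Complex.arg z) - z‖ ^ (a - 2) := by
    have := intervalIntegral.integral_comp_sub_right (a := 0) (b := 2 * π)
      (fun φ => ‖circleMap 0 1 (φ + Complex.arg z) - z‖ ^ (a - 2)) π
    rw [show (0:ℝ) - π = -π by ring, show 2 * π - π = π by ring] at this
    rw [← this]
    congr 1
    funext θ
    rw [show θ + (Complex.arg z - π) = θ - π + Complex.arg z by ring]
  rw [e]
  calc ∫ φ in (-π)..π, ‖circleMap 0 1 (φ + Complex.arg z) - z‖ ^ (a - 2)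
      ≤ ∫ φ in (-π)..π, (2 * π) ^ (2 - a) * ((1 - ‖z‖) + |φ|) ^ (a - 2) := by
        refine intervalIntegral.integral_mono_on (by linarith [pi_pos])
          ((hcont _).intervalIntegrable _ _) (Continuous.intervalIntegrable (continuous_const.mul
            (Continuous.rpow_const (by fun_prop) fun x => Or.inl (by positivity))) _ _) ?_
        intro φ hφ
        have h := add_abs_le_norm_circleMap_sub hz (abs_le.2 ⟨hφ.1, hφ.2⟩)
        refine (rpow_le_rpow_of_nonpos (by positivity) h (by linarith)).trans_eq ?_
        rw [mul_rpow (by positivity) (by positivity), inv_rpow (by positivity),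
          ← rpow_neg (by positivity), neg_sub]
    _ = (2 * π) ^ (2 - a) * ∫ φ in (-π)..π, ((1 - ‖z‖) + |φ|) ^ (a - 2) :=
        intervalIntegral.integral_const_mul _ _
    _ ≤ _ := by
        gcongr
        exact intervalIntegral_add_abs_rpow_le ha hδ

/-- The Hardy–Littlewood lemma: growth of the derivative of order `a - 1` gives Hölder
continuity of order `a`. -/
theorem norm_sub_le_of_norm_deriv_le_rpow {k k' : ℂ → ℂ} {M a : ℝ} (ha : 0 < a) (ha1 : a < 1)
    (hM : 0 ≤ M)
    (hk : ∀ z ∈ ball (0 : ℂ) 1, HasDerivAt k (k' z) z)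
    (hb : ∀ z ∈ ball (0 : ℂ) 1, ‖k' z‖ ≤ M * (1 - ‖z‖) ^ (a - 1)) {x y : ℂ}
    (hx : x ∈ ball (0 : ℂ) 1) (hy : y ∈ ball (0 : ℂ) 1) :
    ‖k x - k y‖ ≤ M * (2 / a + 2) * ‖x - y‖ ^ a := by
  rcases eq_or_ne x y with rfl | hxy
  · simp [Real.zero_rpow ha.ne']
  have hd : 0 < ‖x - y‖ := norm_pos_iff.2 (sub_ne_zero.2 hxy)
  rw [mem_ball_zero_iff] at hx hy
  -- Both points are moved inwards by the factor `1 - l` and then joined by a segment. The depth `l`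
  -- is comparable to the distance of the points, which balances the radial and the inner
  -- contribution; halving ensures `l < 1`.
  set l : ℝ := ‖x - y‖ / 2 with hl
  have hl0 : 0 < l := by positivity
  have hl1 : l < 1 := by
    have := norm_sub_le x y
    rw [hl]; linarith
  have hrad : ∀ z : ℂ, ‖z‖ < 1 → ‖k z - k ((1 - l : ℝ) * z)‖ ≤ M / a * l ^ a := by
    intro z hz
    have hmem : ∀ s ∈ Icc (1 - l) 1, ((s : ℝ) : ℂ) * z ∈ ball (0 : ℂ) 1 := by
      intro s hs
      rw [mem_ball_zero_iff, norm_mul, Complex.norm_real, Real.norm_eq_abs,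
        abs_of_nonneg (by linarith [hs.1])]
      nlinarith [hs.1, hs.2, norm_nonneg z]
    have hder : ∀ s ∈ Icc (1 - l) 1, HasDerivAt (fun s : ℝ => k (s * z)) (k' (s * z) * z) s := by
      intro s hs
      have h1 : HasDerivAt (fun s : ℝ => (s : ℂ) * z) z s := by
        simpa using (Complex.ofRealCLM.hasDerivAt (x := s)).mul_const z
      exact (hk _ (hmem s hs)).comp s h1
    -- The majorant is the primitive of `M (1 - s) ^ (a - 1)` that vanishes at `1 - l`. It is
    -- continuous at `s = 1` because `0 < a`, so the comparison reaches that end although the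
    -- derivative blows up.
    have hB : ∀ s ∈ Ico (1 - l) 1, HasDerivAt
        (fun s : ℝ => M / a * l ^ a - M / a * (1 - s) ^ a) (M * (1 - s) ^ (a - 1)) s := by
      intro s hs
      have h1 : HasDerivAt (fun s : ℝ => (1 - s) ^ a) (-1 * a * (1 - s) ^ (a - 1)) s :=
        ((hasDerivAt_id s).const_sub 1).rpow_const (Or.inl (by simp only [id]; linarith [hs.2]))
      have h2 := (h1.const_mul (M / a)).const_sub (M / a * l ^ a)
      refine h2.congr_deriv ?_
      field_simp
    have := image_norm_le_of_norm_deriv_right_le_deriv_boundary'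
      (f := fun s : ℝ => k (s * z) - k ((1 - l : ℝ) * z)) (f' := fun s => k' (s * z) * z)
      (a := 1 - l) (b := 1) (B := fun s : ℝ => M / a * l ^ a - M / a * (1 - s) ^ a)
      (B' := fun s => M * (1 - s) ^ (a - 1))
      (fun s hs => ((hder s hs).sub_const _).continuousAt.continuousWithinAt)
      (fun s hs => ((hder s (Ico_subset_Icc_self hs)).sub_const _).hasDerivWithinAt)
      (by simp) (by
        refine Continuous.continuousOn (continuous_const.sub (continuous_const.mul ?_))
        exact Continuous.rpow_const (by fun_prop) fun x => Or.inr ha.le)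
      (fun s hs => (hB s hs).hasDerivWithinAt)
      (fun s hs => ?_) (x := 1) ⟨by linarith, le_rfl⟩
    · simpa [Real.zero_rpow ha.ne'] using this
    · rw [norm_mul]
      have h1 := hb _ (hmem s (Ico_subset_Icc_self hs))
      have h2 : (1 - ‖(s : ℂ) * z‖) ^ (a - 1) ≤ (1 - s) ^ (a - 1) := by
        refine Real.rpow_le_rpow_of_nonpos (by linarith [hs.2]) ?_ (by linarith)
        rw [norm_mul, Complex.norm_real, Real.norm_eq_abs, abs_of_nonneg (by linarith [hs.1])]
        nlinarith [hs.1, hs.2, norm_nonneg z]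
      calc ‖k' (s * z)‖ * ‖z‖ ≤ ‖k' (s * z)‖ * 1 := by gcongr
        _ ≤ M * (1 - ‖(s : ℂ) * z‖) ^ (a - 1) := by rw [mul_one]; exact h1
        _ ≤ _ := by gcongr
  -- On the disc of radius `1 - l` the derivative is at most `M * l ^ (a - 1)`, and the two points
  -- are at distance at most `2 * l`.
  have hmid : ‖k ((1 - l : ℝ) * x) - k ((1 - l : ℝ) * y)‖ ≤ 2 * M * l ^ a := by
    have hsub : closedBall (0 : ℂ) (1 - l) ⊆ ball 0 1 := closedBall_subset_ball (by linarith)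
    have hm : ∀ z : ℂ, ‖z‖ < 1 → ((1 - l : ℝ) : ℂ) * z ∈ closedBall (0 : ℂ) (1 - l) := by
      intro z hz
      rw [mem_closedBall_zero_iff, norm_mul, Complex.norm_real, Real.norm_eq_abs,
        abs_of_nonneg (by linarith)]
      nlinarith [norm_nonneg z]
    have := (convex_closedBall (0 : ℂ) (1 - l)).norm_image_sub_le_of_norm_hasDerivWithin_le
      (f := k) (f' := k') (C := M * l ^ (a - 1))
      (fun z hz => (hk z (hsub hz)).hasDerivWithinAt) (fun z hz => ?_) (hm y hy) (hm x hx)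
    · refine this.trans ?_
      rw [← mul_sub, norm_mul, Complex.norm_real, Real.norm_eq_abs, abs_of_nonneg (by linarith),
        show ‖x - y‖ = 2 * l by rw [hl]; ring]
      have e : l ^ a = l ^ (a - 1) * l := by
        rw [← Real.rpow_add_one hl0.ne']; congr 1; ring
      rw [e]
      have h0 : 0 ≤ M * l ^ (a - 1) * l := by positivity
      nlinarith
    · refine (hb z (hsub hz)).trans ?_
      rw [mem_closedBall_zero_iff] at hz
      gcongr ?_ * ?_
      exact Real.rpow_le_rpow_of_nonpos hl0 (by linarith) (by linarith)
  have h3 : l ^ a ≤ ‖x - y‖ ^ a := Real.rpow_le_rpow hl0.le (by rw [hl]; linarith) ha.le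
  calc ‖k x - k y‖ = ‖(k x - k ((1 - l : ℝ) * x)) + (k ((1 - l : ℝ) * x) - k ((1 - l : ℝ) * y))
        - (k y - k ((1 - l : ℝ) * y))‖ := by congr 1; ring
    _ ≤ M / a * l ^ a + 2 * M * l ^ a + M / a * l ^ a :=
        (norm_sub_le _ _).trans (add_le_add ((norm_add_le _ _).trans
          (add_le_add (hrad x hx) hmid)) (hrad y hy))
    _ = M * (2 / a + 2) * l ^ a := by ring
    _ ≤ _ := by gcongr

theorem exists_tendsto_of_holder {s : Set ℂ} {k : ℂ → ℂ} {C a : ℝ} (ha : 0 < a)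
    (h : ∀ x ∈ s, ∀ y ∈ s, ‖k x - k y‖ ≤ C * ‖x - y‖ ^ a) {x : ℂ} (hx : x ∈ closure s) :
    ∃ l, Filter.Tendsto k (𝓝[s] x) (𝓝 l) := by
  have : (𝓝[s] x).NeBot := mem_closure_iff_nhdsWithin_neBot.1 hx
  refine cauchy_map_iff_exists_tendsto.1 ?_
  rw [Metric.cauchy_iff]
  refine ⟨inferInstance, fun ε hε => ?_⟩
  have hlim : Filter.Tendsto (fun d : ℝ => C * d ^ a) (𝓝 0) (𝓝 0) := by
    have : Continuous fun d : ℝ => C * d ^ a :=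
      continuous_const.mul (Continuous.rpow_const continuous_id fun _ => Or.inr ha.le)
    simpa [Real.zero_rpow ha.ne'] using this.tendsto 0
  obtain ⟨δ, hδ, hδ'⟩ := Metric.eventually_nhds_iff.1 (hlim.eventually (gt_mem_nhds hε))
  refine ⟨k '' (s ∩ ball x (δ / 2)), Filter.image_mem_map (Filter.inter_mem self_mem_nhdsWithin
    (mem_nhdsWithin_of_mem_nhds (ball_mem_nhds _ (by positivity)))), ?_⟩
  rintro _ ⟨y, hy, rfl⟩ _ ⟨z, hz, rfl⟩
  rw [dist_eq_norm]
  refine (h y hy.1 z hz.1).trans_lt (hδ' ?_)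
  rw [Real.dist_eq, sub_zero, abs_of_nonneg (norm_nonneg _), ← dist_eq_norm]
  have h1 := mem_ball.1 hy.2
  have h2 := mem_ball'.1 hz.2
  linarith [dist_triangle y x z]

/-- A Hölder function on a set extends to its closure with the same Hölder constant. -/
theorem exists_holder_extension {s : Set ℂ} {k : ℂ → ℂ} {C a : ℝ} (ha : 0 < a)
    (h : ∀ x ∈ s, ∀ y ∈ s, ‖k x - k y‖ ≤ C * ‖x - y‖ ^ a) :
    ∃ g : ℂ → ℂ, EqOn g k s ∧ ∀ x ∈ closure s, ∀ y ∈ closure s, ‖g x - g y‖ ≤ C * ‖x - y‖ ^ a := by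
  have hcau : ∀ x ∈ closure s, ∃ l, Filter.Tendsto k (𝓝[s] x) (𝓝 l) :=
    fun x hx => exists_tendsto_of_holder ha h hx
  have heq : EqOn (extendFrom s k) k s := by
    intro x hx
    obtain ⟨l, hl⟩ := hcau x (subset_closure hx)
    have : l = k x := tendsto_nhds_unique (hl.mono_left (pure_le_nhdsWithin hx))
      (tendsto_pure_nhds k x)
    rw [this] at hl
    exact extendFrom_eq (subset_closure hx) hl
  have hcont : ContinuousOn (extendFrom s k) (closure s) :=
    continuousOn_extendFrom subset_rfl hcau
  refine ⟨extendFrom s k, heq, ?_⟩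
  generalize extendFrom s k = g at heq hcont
  have hg : Continuous fun p : ℂ × ℂ => C * ‖p.1 - p.2‖ ^ a := by
    refine continuous_const.mul (Continuous.rpow_const ?_ fun _ => Or.inr ha.le)
    fun_prop
  have hf : ContinuousOn (fun p : ℂ × ℂ => ‖g p.1 - g p.2‖) (closure s ×ˢ closure s) :=
    ((hcont.comp continuousOn_fst fun p hp => hp.1).sub
      (hcont.comp continuousOn_snd fun p hp => hp.2)).norm
  intro x hx y hy
  rw [← closure_prod_eq] at hf
  have hp : (x, y) ∈ closure (s ×ˢ s) := by rw [closure_prod_eq]; exact ⟨hx, hy⟩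
  refine le_on_closure (f := fun p : ℂ × ℂ => ‖g p.1 - g p.2‖)
    (g := fun p : ℂ × ℂ => C * ‖p.1 - p.2‖ ^ a) (fun p hp => ?_) hf hg.continuousOn hp
  rw [heq hp.1, heq hp.2]
  exact h _ hp.1 _ hp.2

open Real in
theorem norm_circleAverage_le_of_norm_le {E : Type*} [NormedAddCommGroup E] [NormedSpace ℝ E]
    {f : ℂ → E} {g : ℂ → ℝ} (hg : ContinuousOn g (sphere 0 1))
    (h : ∀ ζ ∈ sphere (0 : ℂ) 1, ‖f ζ‖ ≤ g ζ) :
    ‖circleAverage f 0 1‖ ≤ circleAverage g 0 1 := by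
  rw [circleAverage_def, circleAverage_def, norm_smul, norm_inv, norm_eq_abs,
    abs_of_pos two_pi_pos, smul_eq_mul]
  gcongr
  refine intervalIntegral.norm_integral_le_of_norm_le two_pi_pos.le
    (Filter.Eventually.of_forall fun θ _ => h _ ?_) ?_
  · simp
  · exact hg.circleIntegrable zero_le_one

theorem one_sub_norm_le_norm_sub {ζ z : ℂ} (hζ : ζ ∈ sphere (0 : ℂ) 1) :
    1 - ‖z‖ ≤ ‖ζ - z‖ := by
  have := norm_sub_norm_le ζ z
  rwa [mem_sphere_zero_iff_norm.1 hζ] at this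

theorem sub_ne_zero_of_mem_sphere {ζ z : ℂ} (hζ : ζ ∈ sphere (0 : ℂ) 1) (hz : z ∈ ball (0 : ℂ) 1) :
    ζ - z ≠ 0 := by
  have := one_sub_norm_le_norm_sub (z := z) hζ
  rw [mem_ball_zero_iff] at hz
  exact norm_pos_iff.1 (by linarith)

theorem continuousOn_norm_sub_rpow {z : ℂ} (hz : z ∈ ball (0 : ℂ) 1) (a : ℝ) :
    ContinuousOn (fun ζ => ‖ζ - z‖ ^ a) (sphere 0 1) :=
  ContinuousOn.rpow_const (by fun_prop) fun _ hζ =>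
    Or.inl (norm_ne_zero_iff.2 (sub_ne_zero_of_mem_sphere hζ hz))

open Real in
-- The inversion `ζ ↦ ζ⁻¹` of the circle turns the integrand into `2ζ² / (1 - zζ)²`, which is
-- holomorphic on the closed disc and vanishes at `0`; the mean value property applies. Consequently
-- a constant may be subtracted from the density when the Cauchy integral is differentiated.
theorem circleAverage_two_div_sub_sq {z : ℂ} (hz : z ∈ ball (0 : ℂ) 1) :
    circleAverage (fun ζ => 2 / (ζ - z) ^ 2) 0 1 = 0 := by
  have hne : ∀ ζ ∈ closedBall (0 : ℂ) 1, 1 - z * ζ ≠ 0 := by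
    intro ζ hζ h0
    rw [mem_closedBall_zero_iff] at hζ
    rw [mem_ball_zero_iff] at hz
    have h1 : ‖z * ζ‖ = 1 := by rw [← sub_eq_zero.1 h0]; simp
    rw [norm_mul] at h1
    nlinarith [norm_nonneg z, norm_nonneg ζ]
  have h1 : DiffContOnCl ℂ (fun ζ : ℂ => 2 * ζ ^ 2 / (1 - z * ζ) ^ 2) (ball 0 |1|) := by
    apply DifferentiableOn.diffContOnCl
    rw [abs_one, closure_ball _ one_ne_zero]
    intro ζ hζ
    exact DifferentiableAt.differentiableWithinAt (by
      refine DifferentiableAt.fun_div (by fun_prop) (by fun_prop) (pow_ne_zero _ (hne ζ hζ)))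
  have h2 := h1.circleAverage
  rw [← circleAverage_zero_one_congr_inv] at h2
  simp only [ne_eq, OfNat.ofNat_ne_zero, not_false_eq_true, zero_pow, mul_zero, zero_div] at h2
  refine Eq.trans (circleAverage_congr_sphere fun ζ hζ => ?_) h2
  rw [abs_one] at hζ
  have h0 : ζ ≠ 0 := by
    rintro rfl
    simp at hζ
  have := sub_ne_zero_of_mem_sphere hζ hz
  field_simp

open Real in
/-- The Cauchy-type integral of `w`, twice. -/
noncomputable def cauchyAverage (w : ℂ → ℂ) (z : ℂ) : ℂ := circleAverage (fun ζ => 2 / (ζ - z) * w ζ) 0 1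

/-! ### The Cauchy integral of a Hölder density and the Schwarz primitive. -/

section

variable {w : ℂ → ℂ} (hw : ContinuousOn w (sphere 0 1))
include hw

theorem continuousOn_two_div_mul {z : ℂ} (hz : z ∈ ball (0 : ℂ) 1) :
    ContinuousOn (fun ζ => 2 / (ζ - z) * w ζ) (sphere 0 1) :=
  ContinuousOn.mul (ContinuousOn.div (by fun_prop) (by fun_prop) fun _ hζ =>
    sub_ne_zero_of_mem_sphere hζ hz) hw

open Real in
-- The kernel splits as `(ζ + z) / (ζ - z) = 1 + z * (2 / (ζ - z))`.
theorem herglotz_circleAverage_eq {z : ℂ} (hz : z ∈ ball (0 : ℂ) 1) :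
    circleAverage (fun ζ => herglotzRieszKernel 0 z ζ • w ζ) 0 1 =
      circleAverage w 0 1 + z * cauchyAverage w z := by
  have h := continuousOn_two_div_mul hw hz
  rw [cauchyAverage, ← smul_eq_mul z, ← circleAverage_fun_smul, ← circleAverage_fun_add
    (hw.circleIntegrable zero_le_one) ((continuousOn_const.fun_smul h).circleIntegrable zero_le_one)]
  refine circleAverage_congr_sphere fun ζ hζ => ?_
  rw [abs_one] at hζ
  have := sub_ne_zero_of_mem_sphere hζ hz
  simp only [herglotzRieszKernel_def, sub_zero, smul_eq_mul]
  field_simp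
  ring

open Real in
-- Differentiation under the integral is taken from the Herglotz–Riesz kernel: applied to the
-- density `ζ⁻¹ w`, that kernel gives the Cauchy integral of `w` up to an additive constant, since
-- `(ζ + z) / (ζ - z) * ζ⁻¹ + ζ⁻¹ = 2 / (ζ - z)`.
theorem hasDerivAt_cauchyAverage {z : ℂ} (hz : z ∈ ball (0 : ℂ) 1) :
    HasDerivAt (cauchyAverage w) (circleAverage (fun ζ => 2 / (ζ - z) ^ 2 * w ζ) 0 1) z := by
  have hne : ∀ ζ ∈ sphere (0 : ℂ) 1, ζ ≠ 0 := by
    rintro ζ hζ rfl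
    simp at hζ
  have hw' : ContinuousOn (fun ζ => ζ⁻¹ * w ζ) (sphere 0 1) :=
    ContinuousOn.mul (continuousOn_id.inv₀ hne) hw
  have h1 := hasDerivAt_circleAverage_herglotzRieszKernel_smul
    (hw'.circleIntegrable zero_le_one) hz
  have h2 := h1.add_const (circleAverage (fun ζ => ζ⁻¹ * w ζ) 0 1)
  have e : circleAverage (fun ζ => (2 * ζ / (ζ - z) ^ 2) • (ζ⁻¹ * w ζ)) 0 1 =
      circleAverage (fun ζ => 2 / (ζ - z) ^ 2 * w ζ) 0 1 := by
    refine circleAverage_congr_sphere fun ζ hζ => ?_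
    rw [abs_one] at hζ
    have := hne ζ hζ
    simp only [smul_eq_mul]
    field_simp
  rw [e] at h2
  refine h2.congr_of_eventuallyEq ?_
  filter_upwards [isOpen_ball.mem_nhds hz] with y hy
  rw [herglotz_circleAverage_eq hw' hy, cauchyAverage, cauchyAverage, ← smul_eq_mul y,
    ← circleAverage_fun_smul, add_comm, ← add_assoc, ← two_mul, ← smul_eq_mul (2 : ℂ),
    ← circleAverage_fun_smul, ← circleAverage_fun_add]
  · refine circleAverage_congr_sphere fun ζ hζ => ?_
    rw [abs_one] at hζ
    have := hne ζ hζ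
    have := sub_ne_zero_of_mem_sphere hζ hy
    simp only [smul_eq_mul]
    field_simp
    ring
  · exact (continuousOn_const.fun_smul hw').circleIntegrable zero_le_one
  · exact (continuousOn_const.fun_smul (continuousOn_two_div_mul hw' hy)).circleIntegrable zero_le_one

variable {A a : ℝ} (ha : 0 < a) (ha1 : a < 1) (hA : 0 ≤ A)
  (hb : ∀ ζ ∈ sphere (0 : ℂ) 1, ∀ η ∈ sphere (0 : ℂ) 1, ‖w ζ - w η‖ ≤ A * ‖ζ - η‖ ^ a)
include ha hA hb

omit hw in
theorem norm_sub_le_of_holder_of_mem_ball {ζ z : ℂ} (hζ : ζ ∈ sphere (0 : ℂ) 1)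
    (hz : z ∈ ball (0 : ℂ) 1) :
    ‖w ζ - w (circleMap 0 1 (Complex.arg z))‖ ≤ A * 2 ^ a * ‖ζ - z‖ ^ a := by
  set η := circleMap 0 1 (Complex.arg z) with hη
  have hη' : η ∈ sphere (0 : ℂ) 1 := by simp [hη]
  rw [mem_ball_zero_iff] at hz
  have h1 : ‖z - η‖ = 1 - ‖z‖ := by
    have e : z - η = ((‖z‖ - 1 : ℝ) : ℂ) * η := by
      have := Complex.norm_mul_exp_arg_mul_I z
      simp only [hη, circleMap, zero_add, Complex.ofReal_one, one_mul]
      rw [Complex.ofReal_sub, sub_mul, this]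
      simp
    rw [e, norm_mul, mem_sphere_zero_iff_norm.1 hη', Complex.norm_real, Real.norm_eq_abs,
      abs_of_nonpos (by linarith)]
    ring
  have h2 : ‖ζ - η‖ ≤ 2 * ‖ζ - z‖ := by
    have h3 := norm_add_le (ζ - z) (z - η)
    rw [sub_add_sub_cancel, h1] at h3
    linarith [one_sub_norm_le_norm_sub (z := z) hζ]
  refine (hb ζ hζ η hη').trans ?_
  rw [mul_assoc, ← Real.mul_rpow two_pos.le (norm_nonneg _)]
  gcongr

include ha1

open Real in
-- The squared kernel has mean zero, so the value of `w` at the radial projection of `z` can be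
-- subtracted from the density. The Hölder condition then lowers the singularity from `‖ζ - z‖ ^
-- (-2)` to `‖ζ - z‖ ^ (a - 2)`. This is the growth that the Hardy–Littlewood lemma asks for.
theorem norm_deriv_cauchyAverage_le {z : ℂ} (hz : z ∈ ball (0 : ℂ) 1) :
    ‖circleAverage (fun ζ => 2 / (ζ - z) ^ 2 * w ζ) 0 1‖ ≤
      2 * (A * 2 ^ a) * ((2 * π)⁻¹ * ((2 * π) ^ (2 - a) * (2 / (1 - a)))) *
        (1 - ‖z‖) ^ (a - 1) := by
  set c := w (circleMap 0 1 (Complex.arg z))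
  have hk : ContinuousOn (fun ζ : ℂ => 2 / (ζ - z) ^ 2) (sphere 0 1) :=
    ContinuousOn.div (by fun_prop) (by fun_prop) fun _ hζ =>
      pow_ne_zero _ (sub_ne_zero_of_mem_sphere hζ hz)
  have e : circleAverage (fun ζ => 2 / (ζ - z) ^ 2 * w ζ) 0 1 =
      circleAverage (fun ζ => 2 / (ζ - z) ^ 2 * (w ζ - c)) 0 1 := by
    have h0 : circleAverage (fun ζ => c • (2 / (ζ - z) ^ 2)) 0 1 = 0 := by
      rw [circleAverage_fun_smul, circleAverage_two_div_sub_sq hz, smul_zero]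
    refine (sub_eq_self.2 h0).symm.trans ?_
    rw [← circleAverage_fun_sub]
    · congr 1
      funext ζ
      simp only [smul_eq_mul]
      ring
    · exact (hk.mul hw).circleIntegrable zero_le_one
    · exact (continuousOn_const.fun_smul hk).circleIntegrable zero_le_one
  rw [e]
  have hI := circleAverage_norm_sub_rpow_le ha1 (mem_ball_zero_iff.1 hz)
  refine (norm_circleAverage_le_of_norm_le (g := fun ζ => (2 * (A * 2 ^ a)) • ‖ζ - z‖ ^ (a - 2))
    (continuousOn_const.fun_smul (continuousOn_norm_sub_rpow hz _)) fun ζ hζ => ?_).trans ?_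
  · have hpos := norm_pos_iff.2 (sub_ne_zero_of_mem_sphere hζ hz)
    rw [norm_mul, norm_div, norm_pow, Complex.norm_ofNat, smul_eq_mul]
    have h1 := norm_sub_le_of_holder_of_mem_ball ha hA hb hζ hz
    calc 2 / ‖ζ - z‖ ^ 2 * ‖w ζ - c‖ ≤ 2 / ‖ζ - z‖ ^ 2 * (A * 2 ^ a * ‖ζ - z‖ ^ a) := by gcongr
      _ = _ := by
        rw [rpow_sub hpos, rpow_two]
        ring
  · rw [circleAverage_fun_smul, smul_eq_mul, mul_assoc (2 * (A * 2 ^ a))]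
    gcongr

end

open Real in
-- Constants are reproduced by the Poisson integral, so only `W - c` is integrated. The Poisson
-- kernel is at most `2 (1 - ‖z‖) / ‖ζ - z‖²`, and its numerator raises the exponent from `a - 1` to
-- `a`. The quantitative form yields the radial limits needed for the Schwarz primitive.
theorem norm_poisson_sub_le {W : ℂ → ℝ} (hW : ContinuousOn W (sphere 0 1)) {A a : ℝ} (ha : 0 < a)
    (ha1 : a < 1) (hA : 0 ≤ A)
    (hb : ∀ ζ ∈ sphere (0 : ℂ) 1, ∀ η ∈ sphere (0 : ℂ) 1, |W ζ - W η| ≤ A * ‖ζ - η‖ ^ a)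
    {z : ℂ} (hz : z ∈ ball (0 : ℂ) 1) :
    |circleAverage ((Complex.re ∘ herglotzRieszKernel 0 z) • W) 0 1 -
        W (circleMap 0 1 (Complex.arg z))| ≤
      2 * (A * 2 ^ a) * ((2 * π)⁻¹ * ((2 * π) ^ (2 - a) * (2 / (1 - a)))) * (1 - ‖z‖) ^ a := by
  set c := W (circleMap 0 1 (Complex.arg z)) with hc
  have hk : ContinuousOn (Complex.re ∘ herglotzRieszKernel 0 z) (sphere 0 1) := by
    have := continuousOn_herglotzRieszKernel_sphere hz
    rw [abs_one] at this
    exact Complex.continuous_re.comp_continuousOn this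
  have h1 : circleAverage ((Complex.re ∘ herglotzRieszKernel 0 z) • fun _ => c) 0 1 = c := by
    have h : InnerProductSpace.HarmonicOnNhd (fun _ : ℂ => c) (closedBall 0 1) := fun _ _ =>
      InnerProductSpace.harmonicAt_const _
    exact h.circleAverage_re_herglotzRieszKernel_smul hz
  have hz' := mem_ball_zero_iff.1 hz
  have hI := circleAverage_norm_sub_rpow_le ha1 hz'
  rw [← h1, ← circleAverage_sub ((hk.smul hW).circleIntegrable zero_le_one)
    ((hk.smul (g := fun _ => c) continuousOn_const).circleIntegrable zero_le_one), ← norm_eq_abs]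
  refine (norm_circleAverage_le_of_norm_le
    (g := fun ζ => (2 * (A * 2 ^ a) * (1 - ‖z‖)) • ‖ζ - z‖ ^ (a - 2))
    (continuousOn_const.fun_smul (continuousOn_norm_sub_rpow hz _)) fun ζ hζ => ?_).trans ?_
  · have hpos := norm_pos_iff.2 (sub_ne_zero_of_mem_sphere hζ hz)
    have h2 : ‖W ζ - c‖ ≤ A * 2 ^ a * ‖ζ - z‖ ^ a := by
      have := norm_sub_le_of_holder_of_mem_ball (w := fun ζ => (W ζ : ℂ)) ha hA
        (fun ζ hζ η hη => by
          rw [← Complex.ofReal_sub, Complex.norm_real]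
          exact hb ζ hζ η hη) hζ hz
      rwa [← Complex.ofReal_sub, Complex.norm_real] at this
    have h3 : ‖(herglotzRieszKernel 0 z ζ).re‖ ≤ 2 * (1 - ‖z‖) / ‖ζ - z‖ ^ 2 := by
      have e := congrFun (poissonKernel_eq_re_herglotzRieszKernel (c := 0) (w := z)) ζ
      simp only [Function.comp_apply] at e
      rw [← e, poissonKernel_def, sub_zero, sub_zero, mem_sphere_zero_iff_norm.1 hζ, norm_div,
        norm_pow, norm_norm, norm_eq_abs, abs_of_nonneg (by nlinarith [norm_nonneg z])]
      gcongr
      nlinarith [norm_nonneg z]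
    have e : ((Complex.re ∘ herglotzRieszKernel 0 z) • W -
        (Complex.re ∘ herglotzRieszKernel 0 z) • (fun _ => c) : ℂ → ℝ) ζ =
        (herglotzRieszKernel 0 z ζ).re * (W ζ - c) := (mul_sub _ _ _).symm
    rw [e, norm_mul, smul_eq_mul]
    calc _ ≤ 2 * (1 - ‖z‖) / ‖ζ - z‖ ^ 2 * (A * 2 ^ a * ‖ζ - z‖ ^ a) := by
          gcongr
      _ = _ := by
        rw [rpow_sub hpos, rpow_two]
        ring
  · have h0 : 0 < 1 - ‖z‖ := by linarith
    have e : (1 - ‖z‖) ^ a = (1 - ‖z‖) * (1 - ‖z‖) ^ (a - 1) := by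
      rw [mul_comm, ← rpow_add_one h0.ne']; congr 1; ring
    rw [circleAverage_fun_smul, smul_eq_mul, e]
    calc _ ≤ 2 * (A * 2 ^ a) * (1 - ‖z‖) *
          ((2 * π)⁻¹ * ((2 * π) ^ (2 - a) * (2 / (1 - a))) * (1 - ‖z‖) ^ (a - 1)) := by gcongr
      _ = _ := by ring

/-- `h` and `p` are continuous on the closed disc, `h' = p` in the open disc, and up to its mean
`W` is the angular derivative of the real part of `h` on the circle. -/
structure IsSchwarzPrimitive (a A : ℝ) (W : ℂ → ℝ) (h p : ℂ → ℂ) : Prop where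
  continuousOn : ContinuousOn h (closedBall 0 1)
  hasDerivAt : ∀ z ∈ ball (0 : ℂ) 1, HasDerivAt h (p z) z
  holder : ∀ x ∈ closedBall (0 : ℂ) 1, ∀ y ∈ closedBall (0 : ℂ) 1, ‖p x - p y‖ ≤ A * ‖x - y‖ ^ a
  norm_le : ∀ x ∈ closedBall (0 : ℂ) 1, ‖h x‖ ≤ A
  norm_deriv_le : ∀ x ∈ closedBall (0 : ℂ) 1, ‖p x‖ ≤ A
  center : h 0 = Real.circleAverage W 0 1
  formula : ∀ z ∈ ball (0 : ℂ) 1, p z = -Complex.I * cauchyAverage (fun ζ => (W ζ : ℂ)) z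
  boundary : ∀ ζ ∈ sphere (0 : ℂ) 1, (Complex.I * ζ * p ζ).re = W ζ - Real.circleAverage W 0 1

open Real in
theorem re_mul_cauchyAverage {W : ℂ → ℝ} (hW : ContinuousOn W (sphere 0 1)) {z : ℂ}
    (hz : z ∈ ball (0 : ℂ) 1) :
    (z * cauchyAverage (fun ζ => (W ζ : ℂ)) z).re =
      circleAverage ((Complex.re ∘ herglotzRieszKernel 0 z) • W) 0 1 - circleAverage W 0 1 := by
  have hW' : ContinuousOn (fun ζ => (W ζ : ℂ)) (sphere 0 1) :=
    Complex.continuous_ofReal.comp_continuousOn hW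
  have h1 := herglotz_circleAverage_eq hW' hz
  have h2 := re_circleAverage_herglotzRieszKernel_smul (hW.circleIntegrable zero_le_one) hz
  have h3 := Complex.ofRealCLM.circleAverage_comp_comm (hW.circleIntegrable zero_le_one)
  have h4 : circleAverage (fun ζ => (W ζ : ℂ)) 0 1 = (circleAverage W 0 1 : ℝ) := h3
  rw [h1, Complex.add_re, h4, Complex.ofReal_re] at h2
  linarith

open Real in
-- Put `p = -i P`, where `P` is the Cauchy integral of `W`. Then `i z p(z) = z P(z)`, whose real
-- part is the Poisson integral of `W` minus the mean. The growth bound for `P'` makes `p` Hölder,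
-- so it extends to the closed disc, and its primitive `h` is Lipschitz and extends as well. The
-- angular derivative cannot see the mean of `W`; the value of `h` at the centre stores it.
theorem exists_isSchwarzPrimitive {a : ℝ} (ha : 0 < a) (ha1 : a < 1) :
    ∃ C : ℝ, 0 ≤ C ∧ ∀ (W : ℂ → ℝ) (A : ℝ), 0 ≤ A → (∀ ζ ∈ sphere (0 : ℂ) 1, |W ζ| ≤ A) →
      (∀ ζ ∈ sphere (0 : ℂ) 1, ∀ η ∈ sphere (0 : ℂ) 1, |W ζ - W η| ≤ A * ‖ζ - η‖ ^ a) →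
      ∃ h p, IsSchwarzPrimitive a (C * A) W h p := by
  set c0 : ℝ := 2 * 2 ^ a * ((2 * π)⁻¹ * ((2 * π) ^ (2 - a) * (2 / (1 - a)))) with hc0
  have h1a : 0 < 1 - a := by linarith
  have hc0' : 0 ≤ c0 := by positivity
  set c1 : ℝ := c0 * (2 / a + 2) with hc1
  have hc1' : 0 ≤ c1 := by positivity
  refine ⟨3 + c1, by positivity, fun W A hA hsup hb => ?_⟩
  have hW : ContinuousOn W (sphere 0 1) := continuousOn_of_norm_sub_le_rpow ha hA hb
  have hW' : ContinuousOn (fun ζ => (W ζ : ℂ)) (sphere 0 1) :=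
    Complex.continuous_ofReal.comp_continuousOn hW
  set P := cauchyAverage fun ζ => (W ζ : ℂ) with hP
  have hcl : closure (ball (0 : ℂ) 1) = closedBall 0 1 := closure_ball _ one_ne_zero
  have hPd := fun z (hz : z ∈ ball (0 : ℂ) 1) => hasDerivAt_cauchyAverage hW' hz
  have hhol : ∀ x ∈ ball (0 : ℂ) 1, ∀ y ∈ ball (0 : ℂ) 1,
      ‖(-Complex.I * P x) - (-Complex.I * P y)‖ ≤ c1 * A * ‖x - y‖ ^ a := by
    intro x hx y hy
    have h := norm_sub_le_of_norm_deriv_le_rpow (M := c0 * A) ha ha1 (by positivity) hPd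
      (fun z hz => (norm_deriv_cauchyAverage_le hW' ha ha1 hA (fun ζ hζ η hη => by
        rw [← Complex.ofReal_sub, Complex.norm_real]
        exact hb ζ hζ η hη) hz).trans_eq (by rw [hc0]; ring)) hx hy
    rw [← mul_sub, norm_mul, norm_neg, Complex.norm_I, one_mul]
    exact h.trans_eq (by rw [hc1]; ring)
  obtain ⟨p, hpP, hp⟩ := exists_holder_extension ha hhol
  rw [hcl] at hp
  have h0mem : (0 : ℂ) ∈ ball (0 : ℂ) 1 := mem_ball_self one_pos
  have hp0 : ‖p 0‖ ≤ 2 * A := by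
    rw [hpP h0mem, norm_mul, norm_neg, Complex.norm_I, one_mul, hP, cauchyAverage]
    refine (norm_circleAverage_le_of_norm_le (g := fun _ => 2 * A) continuousOn_const
      fun ζ hζ => ?_).trans_eq (circleAverage_const _ _ _)
    rw [sub_zero, norm_mul, norm_div, mem_sphere_zero_iff_norm.1 hζ, Complex.norm_ofNat, div_one,
      Complex.norm_real]
    gcongr
    exact hsup ζ hζ
  have hpb : ∀ x ∈ closedBall (0 : ℂ) 1, ‖p x‖ ≤ (2 + c1) * A := by
    intro x hx
    have h1 := hp x hx 0 (ball_subset_closedBall h0mem)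
    rw [sub_zero] at h1
    have h2 : ‖x‖ ^ a ≤ 1 := rpow_le_one (norm_nonneg _) (mem_closedBall_zero_iff.1 hx) ha.le
    have h3 := norm_le_norm_add_norm_sub' (p x) (p 0)
    have h4 : c1 * A * ‖x‖ ^ a ≤ c1 * A * 1 := by gcongr
    linarith
  have hpc : ContinuousOn p (closedBall 0 1) :=
    continuousOn_of_norm_sub_le_rpow ha (by positivity) hp
  have hpd : DifferentiableOn ℂ p (ball 0 1) := by
    refine DifferentiableOn.congr ?_ hpP
    exact fun z hz => ((hPd z hz).const_mul _).differentiableAt.differentiableWithinAt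
  obtain ⟨h0, hh0, hh0d⟩ := hpd.isExactOn_ball.with_val_at 0 ((circleAverage W 0 1 : ℝ) : ℂ)
  have hlip : ∀ x ∈ ball (0 : ℂ) 1, ∀ y ∈ ball (0 : ℂ) 1,
      ‖h0 x - h0 y‖ ≤ (2 + c1) * A * ‖x - y‖ ^ (1 : ℝ) := by
    intro x hx y hy
    rw [rpow_one]
    exact (convex_ball (0 : ℂ) 1).norm_image_sub_le_of_norm_hasDerivWithin_le
      (fun z hz => (hh0d z hz).hasDerivWithinAt)
      (fun z hz => hpb z (ball_subset_closedBall hz)) hy hx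
  obtain ⟨h, hh, hhl⟩ := exists_holder_extension one_pos hlip
  rw [hcl] at hhl
  simp only [rpow_one] at hhl
  have hWavg : |circleAverage W 0 1| ≤ A := by
    rw [← norm_eq_abs]
    exact (norm_circleAverage_le_of_norm_le (g := fun _ => A) continuousOn_const hsup).trans_eq
      (circleAverage_const _ _ _)
  refine ⟨h, p, ⟨?_, ?_, ?_, ?_, ?_, ?_, hpP, ?_⟩⟩
  · have : LipschitzOnWith ⟨(2 + c1) * A, by positivity⟩ h (closedBall 0 1) :=
      LipschitzOnWith.of_dist_le_mul fun x hx y hy => by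
        rw [dist_eq_norm, dist_eq_norm]
        exact hhl x hx y hy
    exact this.continuousOn
  · intro z hz
    refine (hh0d z hz).congr_of_eventuallyEq ?_
    filter_upwards [isOpen_ball.mem_nhds hz] with y hy using hh hy
  · intro x hx y hy
    refine (hp x hx y hy).trans ?_
    gcongr
    linarith
  · intro x hx
    have h1 := hhl x hx 0 (ball_subset_closedBall h0mem)
    rw [hh h0mem, hh0, sub_zero] at h1
    have h3 := norm_le_norm_add_norm_sub' (h x) ((circleAverage W 0 1 : ℝ) : ℂ)
    rw [Complex.norm_real, norm_eq_abs] at h3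
    have h4 : (2 + c1) * A * ‖x‖ ≤ (2 + c1) * A * 1 := by
      gcongr
      exact mem_closedBall_zero_iff.1 hx
    linarith
  · intro x hx
    refine (hpb x hx).trans ?_
    gcongr
    linarith
  · rw [hh h0mem, hh0]
  · intro ζ hζ
    -- The boundary identity compares two limits along the ray `ρ ζ` as `ρ` increases to `1`: one by
    -- continuity of the extended `p`, the other by the convergence of the Poisson integral.
    have hray : ∀ ρ ∈ Ico (0 : ℝ) 1, ((ρ : ℝ) : ℂ) * ζ ∈ ball (0 : ℂ) 1 := by
      intro ρ hρ
      rw [mem_ball_zero_iff, norm_mul, mem_sphere_zero_iff_norm.1 hζ, Complex.norm_real,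
        norm_eq_abs, abs_of_nonneg hρ.1, mul_one]
      exact hρ.2
    have hcircle : circleMap 0 1 (Complex.arg ζ) = ζ := by
      have := Complex.norm_mul_exp_arg_mul_I ζ
      rw [mem_sphere_zero_iff_norm.1 hζ] at this
      simpa [circleMap] using this
    have hmap : Filter.Tendsto (fun ρ : ℝ => (ρ : ℂ) * ζ) (𝓝[Ico 0 1] 1)
        (𝓝[closedBall 0 1] ζ) := by
      refine tendsto_nhdsWithin_iff.2 ⟨?_, ?_⟩
      · have : Continuous fun ρ : ℝ => (ρ : ℂ) * ζ := by fun_prop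
        simpa using (this.tendsto 1).mono_left nhdsWithin_le_nhds
      · filter_upwards [self_mem_nhdsWithin] with ρ hρ using ball_subset_closedBall (hray ρ hρ)
    have hne : (𝓝[Ico (0 : ℝ) 1] 1).NeBot := by
      rw [← mem_closure_iff_nhdsWithin_neBot, closure_Ico zero_ne_one]
      exact ⟨zero_le_one, le_rfl⟩
    have hlim1 : Filter.Tendsto (fun ρ : ℝ => (Complex.I * ((ρ : ℂ) * ζ) * p ((ρ : ℂ) * ζ)).re)
        (𝓝[Ico 0 1] 1) (𝓝 (Complex.I * ζ * p ζ).re) := by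
      have hcont : ContinuousOn (fun z => (Complex.I * z * p z).re) (closedBall 0 1) :=
        Complex.continuous_re.comp_continuousOn
          (ContinuousOn.mul (by fun_prop) hpc)
      exact (hcont ζ (sphere_subset_closedBall hζ)).tendsto.comp hmap
    have hlim2 : Filter.Tendsto (fun ρ : ℝ => (Complex.I * ((ρ : ℂ) * ζ) * p ((ρ : ℂ) * ζ)).re)
        (𝓝[Ico 0 1] 1) (𝓝 (W ζ - circleAverage W 0 1)) := by
      have hz : Filter.Tendsto (fun ρ : ℝ => c0 * A * (1 - ρ) ^ a) (𝓝[Ico 0 1] 1) (𝓝 0) := by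
        have : Continuous fun ρ : ℝ => c0 * A * (1 - ρ) ^ a :=
          continuous_const.mul (Continuous.rpow_const (by fun_prop) fun _ => Or.inr ha.le)
        simpa [zero_rpow ha.ne'] using (this.tendsto 1).mono_left nhdsWithin_le_nhds
      rw [tendsto_iff_dist_tendsto_zero]
      refine squeeze_zero' (Filter.Eventually.of_forall fun _ => dist_nonneg) ?_ hz
      filter_upwards [self_mem_nhdsWithin, mem_nhdsWithin_of_mem_nhds (lt_mem_nhds zero_lt_one)]
        with ρ hρ hρ0
      have hm := hray ρ hρ
      have h1 := norm_poisson_sub_le hW ha ha1 hA hb hm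
      have harg : Complex.arg ((ρ : ℂ) * ζ) = Complex.arg ζ := Complex.arg_real_mul _ hρ0
      have hnorm : ‖(ρ : ℂ) * ζ‖ = ρ := by
        rw [norm_mul, mem_sphere_zero_iff_norm.1 hζ, Complex.norm_real, norm_eq_abs,
          abs_of_nonneg hρ.1, mul_one]
      have h2 := re_mul_cauchyAverage hW hm
      have h3 : Complex.I * ((ρ : ℂ) * ζ) * p ((ρ : ℂ) * ζ) = (ρ : ℂ) * ζ * P ((ρ : ℂ) * ζ) := by
        rw [hpP hm]
        linear_combination (-(ρ : ℂ) * ζ * P ((ρ : ℂ) * ζ)) * Complex.I_mul_I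
      rw [harg, hcircle, hnorm] at h1
      rw [h3, h2, dist_eq, sub_sub_sub_cancel_right]
      exact h1.trans_eq (by rw [hc0]; ring)
    exact tendsto_nhds_unique hlim1 hlim2

/-! ### The Banach space of Hölder functions on the circle. -/

open scoped BoundedContinuousFunction in
/-- The Hölder functions of exponent `α` on the circle, encoded by the function together with its
Hölder difference quotients. -/
noncomputable def holderSubmodule (α : ℝ≥0) (V : Type*) [NormedAddCommGroup V] [NormedSpace ℝ V] :
    Submodule ℝ (C(Circle, V) × ({q : Circle × Circle // q.1 ≠ q.2} →ᵇ V)) where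
  carrier := {p | ∀ q : {q : Circle × Circle // q.1 ≠ q.2},
    (dist q.1.1 q.1.2 ^ (α : ℝ)) • p.2 q = p.1 q.1.1 - p.1 q.1.2}
  zero_mem' q := by simp
  add_mem' {p p'} h h' q := by
    have h1 := h q
    have h2 := h' q
    simp only [Prod.snd_add, BoundedContinuousFunction.coe_add, Pi.add_apply, smul_add, h1, h2,
      Prod.fst_add, ContinuousMap.add_apply]
    abel
  smul_mem' c p h q := by
    have h1 := h q
    simp only [Prod.smul_snd, BoundedContinuousFunction.coe_smul, Prod.smul_fst,
      ContinuousMap.smul_apply, ← smul_sub, ← h1]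
    exact smul_comm _ _ _

/-- The Banach space of Hölder functions of exponent `α` on the circle. -/
def HolderSpace (α : ℝ≥0) (V : Type*) [NormedAddCommGroup V] [NormedSpace ℝ V] : Type _ :=
  ↥(holderSubmodule α V)

namespace HolderSpace

variable {α : ℝ≥0} {V W U P : Type*} [NormedAddCommGroup V] [NormedSpace ℝ V]
  [NormedAddCommGroup W] [NormedSpace ℝ W] [NormedAddCommGroup U] [NormedSpace ℝ U]
  [NormedAddCommGroup P] [NormedSpace ℝ P]

noncomputable instance : NormedAddCommGroup (HolderSpace α V) :=
  inferInstanceAs (NormedAddCommGroup ↥(holderSubmodule α V))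

noncomputable instance : NormedSpace ℝ (HolderSpace α V) :=
  inferInstanceAs (NormedSpace ℝ ↥(holderSubmodule α V))

open scoped BoundedContinuousFunction in
-- Recording the difference quotients as a second coordinate makes the Hölder norm the norm of a
-- product of complete spaces. The relation between the two coordinates involves one pair of points
-- at a time, hence is closed, and completeness is inherited.
theorem isClosed_holderSubmodule : IsClosed (holderSubmodule α V :
    Set (C(Circle, V) × ({q : Circle × Circle // q.1 ≠ q.2} →ᵇ V))) := by
  have : (holderSubmodule α V : Set (C(Circle, V) × ({q : Circle × Circle // q.1 ≠ q.2} →ᵇ V))) = ⋂ q : {q : Circle × Circle // q.1 ≠ q.2},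
      {p | (dist q.1.1 q.1.2 ^ (α : ℝ)) • p.2 q = p.1 q.1.1 - p.1 q.1.2} := by
    ext p
    rw [mem_iInter]
    rfl
  rw [this]
  refine isClosed_iInter fun q => isClosed_eq ?_ ?_
  · exact Continuous.const_smul
      ((continuous_eval_const q).comp continuous_snd) _
  · exact ((continuous_eval_const q.1.1).comp continuous_fst).sub
      ((continuous_eval_const q.1.2).comp continuous_fst)

instance [CompleteSpace V] : CompleteSpace (HolderSpace α V) :=
  (isClosed_holderSubmodule (α := α) (V := V)).completeSpace_coe

/-- The continuous function underlying a Hölder function. -/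
noncomputable def toC : HolderSpace α V →L[ℝ] C(Circle, V) :=
  show ↥(holderSubmodule α V) →L[ℝ] C(Circle, V) from
    (ContinuousLinearMap.fst ℝ _ _).comp (holderSubmodule α V).subtypeL

noncomputable instance : CoeFun (HolderSpace α V) fun _ => Circle → V := ⟨fun u => toC u⟩

theorem norm_toC_le (u : HolderSpace α V) : ‖toC u‖ ≤ ‖u‖ := norm_fst_le u.1

theorem norm_apply_le (u : HolderSpace α V) (x : Circle) : ‖u x‖ ≤ ‖u‖ :=
  ((toC u).norm_coe_le_norm x).trans (norm_toC_le u)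

theorem norm_sub_le (u : HolderSpace α V) (x y : Circle) :
    ‖u x - u y‖ ≤ ‖u‖ * dist x y ^ (α : ℝ) := by
  rcases eq_or_ne x y with rfl | h
  · rw [sub_self, norm_zero]
    positivity
  · have h1 := u.2 ⟨(x, y), h⟩
    have h2 : u x - u y = (dist x y ^ (α : ℝ)) • u.1.2 ⟨(x, y), h⟩ := h1.symm
    rw [h2, norm_smul, Real.norm_of_nonneg (by positivity), mul_comm]
    gcongr
    exact (BoundedContinuousFunction.norm_coe_le_norm _ _).trans (norm_snd_le u.1)

theorem toC_injective : Function.Injective (toC (α := α) (V := V)) := by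
  intro u v h
  refine Subtype.ext (Prod.ext h ?_)
  ext q
  have h1 := u.2 q
  rw [show u.1.1 = v.1.1 from h, ← v.2 q] at h1
  exact smul_right_injective _ (Real.rpow_pos_of_pos (dist_pos.2 q.2) _).ne' h1

theorem ext {u v : HolderSpace α V} (h : ∀ x, u x = v x) : u = v :=
  toC_injective (ContinuousMap.ext h)

omit [NormedSpace ℝ V] in
theorem continuous_of_norm_sub_le (hα : 0 < α) {f : Circle → V} {C : ℝ}
    (hf : ∀ x y, ‖f x - f y‖ ≤ C * dist x y ^ (α : ℝ)) : Continuous f := by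
  have h : ∀ x y, dist (f x) (f y) ≤ C.toNNReal * dist x y ^ (α : ℝ) := fun x y => by
    rw [dist_eq_norm]
    refine (hf x y).trans ?_
    gcongr
    exact Real.le_coe_toNNReal C
  have := holderOnWith_of_dist_le (s := univ) fun x _ y _ => h x y
  exact continuousOn_univ.1 (this.continuousOn hα)

theorem norm_differenceQuotient_le {f : Circle → V} {C : ℝ}
    (hf : ∀ x y, ‖f x - f y‖ ≤ C * dist x y ^ (α : ℝ)) (q : {q : Circle × Circle // q.1 ≠ q.2}) :
    ‖(dist q.1.1 q.1.2 ^ (α : ℝ))⁻¹ • (f q.1.1 - f q.1.2)‖ ≤ C := by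
  have := Real.rpow_pos_of_pos (dist_pos.2 q.2) α
  rw [norm_smul, norm_inv, Real.norm_of_nonneg this.le, inv_mul_le_iff₀ this, mul_comm]
  exact hf _ _

/-- The element of the Hölder space given by a Hölder function. -/
noncomputable def ofHolder (hα : 0 < α) (f : Circle → V) (C : ℝ)
    (hf : ∀ x y, ‖f x - f y‖ ≤ C * dist x y ^ (α : ℝ)) : HolderSpace α V :=
  ⟨(⟨f, continuous_of_norm_sub_le hα hf⟩,
    BoundedContinuousFunction.ofNormedAddCommGroup
      (fun q : {q : Circle × Circle // q.1 ≠ q.2} =>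
        (dist q.1.1 q.1.2 ^ (α : ℝ))⁻¹ • (f q.1.1 - f q.1.2))
      (by
        have := continuous_of_norm_sub_le hα hf
        refine Continuous.smul (Continuous.inv₀ ?_ fun q =>
          (Real.rpow_pos_of_pos (dist_pos.2 q.2) _).ne') (by fun_prop)
        exact Continuous.rpow_const (by fun_prop) fun q => Or.inl (dist_pos.2 q.2).ne')
      C
      (norm_differenceQuotient_le hf)),
    fun q => by
      have := Real.rpow_pos_of_pos (dist_pos.2 q.2) α
      exact smul_inv_smul₀ this.ne' _⟩

@[simp]
theorem ofHolder_apply (hα : 0 < α) (f : Circle → V) (C : ℝ)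
    (hf : ∀ x y, ‖f x - f y‖ ≤ C * dist x y ^ (α : ℝ)) (x : Circle) :
    ofHolder hα f C hf x = f x := rfl

theorem norm_ofHolder_le (hα : 0 < α) (f : Circle → V) (C : ℝ)
    (hf : ∀ x y, ‖f x - f y‖ ≤ C * dist x y ^ (α : ℝ)) (hC : 0 ≤ C) (hs : ∀ x, ‖f x‖ ≤ C) :
    ‖ofHolder hα f C hf‖ ≤ C := by
  refine max_le ((ContinuousMap.norm_le _ hC).2 hs) ?_
  exact (BoundedContinuousFunction.norm_le hC).2 (norm_differenceQuotient_le hf)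

/-- A bounded linear map into the Hölder space. -/
noncomputable def mkCLM (hα : 0 < α) (L : P →ₗ[ℝ] (Circle → V)) (C : ℝ) (hC : 0 ≤ C)
    (hs : ∀ p x, ‖L p x‖ ≤ C * ‖p‖)
    (hf : ∀ p x y, ‖L p x - L p y‖ ≤ C * ‖p‖ * dist x y ^ (α : ℝ)) : P →L[ℝ] HolderSpace α V :=
  LinearMap.mkContinuous
    { toFun := fun p => ofHolder hα (L p) (C * ‖p‖) (hf p)
      map_add' := fun p q => ext fun x => by simp
      map_smul' := fun c p => ext fun x => by simp }
    C fun p => norm_ofHolder_le hα _ _ (hf p) (by positivity) (hs p)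

/-- The constant Hölder functions. -/
noncomputable def const (hα : 0 < α) : V →L[ℝ] HolderSpace α V :=
  mkCLM hα (LinearMap.pi fun _ => LinearMap.id) 1 zero_le_one (fun p x => by simp)
    fun p x y => by simp; positivity

/-- Pointwise application of a bounded linear map. -/
noncomputable def map (hα : 0 < α) (B : V →L[ℝ] W) : HolderSpace α V →L[ℝ] HolderSpace α W :=
  mkCLM hα (LinearMap.pi fun x => B.toLinearMap ∘ₗ (ContinuousMap.evalCLM ℝ x).toLinearMap ∘ₗ
      toC.toLinearMap) ‖B‖ (norm_nonneg _)
    (fun u x => (B.le_opNorm _).trans (by gcongr; exact norm_apply_le u x))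
    fun u x y => by
      change ‖B (u x) - B (u y)‖ ≤ _
      rw [← map_sub, mul_assoc]
      exact (B.le_opNorm _).trans (by gcongr; exact norm_sub_le u x y)

/-- The increment of the product is split into one increment in each factor, which accounts for the
`2`; the sup bound would hold without it. -/
theorem bilin_bounds (B : V →L[ℝ] W →L[ℝ] U) (u : HolderSpace α V)
    (v : HolderSpace α W) :
    (∀ x, ‖B (u x) (v x)‖ ≤ 2 * ‖B‖ * ‖u‖ * ‖v‖) ∧
      ∀ x y, ‖B (u x) (v x) - B (u y) (v y)‖ ≤ 2 * ‖B‖ * ‖u‖ * ‖v‖ * dist x y ^ (α : ℝ) := by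
  constructor
  · intro x
    refine (B.le_opNorm₂ _ _).trans ?_
    have h1 := norm_apply_le u x
    have h2 := norm_apply_le v x
    calc ‖B‖ * ‖u x‖ * ‖v x‖ ≤ ‖B‖ * ‖u‖ * ‖v‖ := by gcongr
      _ ≤ 2 * (‖B‖ * ‖u‖ * ‖v‖) := by linarith [show 0 ≤ ‖B‖ * ‖u‖ * ‖v‖ by positivity]
      _ = _ := by ring
  · intro x y
    have e : B (u x) (v x) - B (u y) (v y) = B (u x - u y) (v x) + B (u y) (v x - v y) := by
      simp [map_sub]
    rw [e]
    refine (norm_add_le _ _).trans ((add_le_add (B.le_opNorm₂ _ _) (B.le_opNorm₂ _ _)).trans ?_)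
    have h1 := norm_apply_le u y
    have h2 := norm_apply_le v x
    have h3 := norm_sub_le u x y
    have h4 := norm_sub_le v x y
    calc ‖B‖ * ‖u x - u y‖ * ‖v x‖ + ‖B‖ * ‖u y‖ * ‖v x - v y‖
        ≤ ‖B‖ * (‖u‖ * dist x y ^ (α : ℝ)) * ‖v‖ + ‖B‖ * ‖u‖ * (‖v‖ * dist x y ^ (α : ℝ)) := by
          gcongr
      _ = _ := by ring

/-- Pointwise application of a bounded bilinear map. -/
noncomputable def bilin (hα : 0 < α) (B : V →L[ℝ] W →L[ℝ] U) :
    HolderSpace α V →L[ℝ] HolderSpace α W →L[ℝ] HolderSpace α U :=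
  LinearMap.mkContinuous₂
    (LinearMap.mk₂ ℝ
      (fun u v => ofHolder hα (fun x => B (u x) (v x)) _ (bilin_bounds B u v).2)
      (fun u u' v => ext fun x => by simp)
      (fun c u v => ext fun x => by simp)
      (fun u v v' => ext fun x => by simp)
      (fun c u v => ext fun x => by simp))
    (2 * ‖B‖) fun u v => norm_ofHolder_le hα _ _ (bilin_bounds B u v).2 (by positivity) (bilin_bounds B u v).1

@[simp]
theorem bilin_apply (hα : 0 < α) (B : V →L[ℝ] W →L[ℝ] U) (u : HolderSpace α V)
    (v : HolderSpace α W) (x : Circle) : bilin hα B u v x = B (u x) (v x) := rfl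

end HolderSpace

theorem le_two_mul_rpow {d a : ℝ} (hd : 0 ≤ d) (hd2 : d ≤ 2) (ha : 0 ≤ a) (ha1 : a ≤ 1) :
    d ≤ 2 * d ^ a := by
  rcases hd.eq_or_lt with h | h
  · rw [← h]; positivity
  rcases le_total d 1 with h1 | h1
  · have := Real.rpow_le_rpow_of_exponent_ge h h1 ha1
    rw [Real.rpow_one] at this
    linarith
  · have := Real.one_le_rpow h1 ha
    linarith

/-! ### Means and primitives on the circle. -/

section CircleMean

variable {V : Type*} [NormedAddCommGroup V] [NormedSpace ℝ V]

open Real in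
/-- The mean over the circle. -/
noncomputable def circleMean : C(Circle, V) →L[ℝ] V :=
  LinearMap.mkContinuous
    { toFun := fun v => (2 * π)⁻¹ • ∫ θ in (0 : ℝ)..(2 * π), v (Circle.exp θ)
      map_add' := fun u v => by
        rw [← smul_add, ← intervalIntegral.integral_add]
        · rfl
        · exact Continuous.intervalIntegrable (by fun_prop) _ _
        · exact Continuous.intervalIntegrable (by fun_prop) _ _
      map_smul' := fun c v => by
        simp only [ContinuousMap.smul_apply, intervalIntegral.integral_smul, RingHom.id_apply]
        exact smul_comm _ _ _ }
    1 fun v => by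
      have h := intervalIntegral.norm_integral_le_of_norm_le_const (a := 0) (b := 2 * π)
        (f := fun θ => v (Circle.exp θ)) (C := ‖v‖) fun θ _ => v.norm_coe_le_norm _
      change ‖(2 * π)⁻¹ • ∫ θ in (0 : ℝ)..(2 * π), v (Circle.exp θ)‖ ≤ _
      rw [norm_smul, norm_inv, norm_of_nonneg two_pi_pos.le, inv_mul_le_iff₀ two_pi_pos]
      rw [sub_zero, abs_of_pos two_pi_pos] at h
      linarith

open Real in
theorem circleMean_apply (v : C(Circle, V)) :
    circleMean v = (2 * π)⁻¹ • ∫ θ in (0 : ℝ)..(2 * π), v (Circle.exp θ) := rfl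

theorem norm_circleMean_le (v : C(Circle, V)) : ‖circleMean v‖ ≤ ‖v‖ := by
  have := (circleMean (V := V)).le_of_opNorm_le (LinearMap.mkContinuous_norm_le _ zero_le_one _) v
  simpa using this

open Real in
theorem abs_arg_le_dist (x y : Circle) : |Complex.arg (x / y : Circle)| ≤ π / 2 * dist x y := by
  set δ := Complex.arg (x / y : Circle) with hδ
  have hδπ : |δ| ≤ π := Complex.abs_arg_le_pi _
  have e : dist x y = ‖Complex.exp (Complex.I * δ) - 1‖ := by
    have h1 : ((x / y : Circle) : ℂ) = Complex.exp (Complex.I * δ) := by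
      conv_lhs => rw [← Circle.exp_arg (x / y)]
      rw [Circle.coe_exp, mul_comm, hδ]
    rw [← h1, show dist x y = ‖(x : ℂ) - y‖ from dist_eq_norm (x : ℂ) y, Circle.coe_div,
      div_sub_one y.coe_ne_zero, norm_div, Circle.norm_coe, div_one]
  rw [e, Complex.norm_exp_I_mul_ofReal_sub_one, norm_mul, norm_two, norm_eq_abs]
  have h5 := Real.mul_abs_le_abs_sin (x := δ / 2) (by rw [abs_div, abs_two]; linarith)
  rw [abs_div, abs_two] at h5
  calc |δ| = π / 2 * (2 * (2 / π * (|δ| / 2))) := by field_simp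
    _ ≤ _ := by gcongr

theorem dist_le_two_mul_rpow {a : ℝ} (ha : 0 ≤ a) (ha1 : a ≤ 1) (x y : Circle) :
    dist x y ≤ 2 * dist x y ^ a := by
  refine le_two_mul_rpow dist_nonneg ?_ ha ha1
  have h := norm_sub_le (x : ℂ) y
  rw [Circle.norm_coe, Circle.norm_coe] at h
  exact (show dist x y = ‖(x : ℂ) - y‖ from dist_eq_norm (x : ℂ) y).trans_le (by linarith)

end CircleMean

section Primitive

variable {V : Type*} [NormedAddCommGroup V] [NormedSpace ℝ V]

open Real in
/-- The primitive of `v` minus its mean, as a function of the angle. -/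
noncomputable def anglePrimitive (v : C(Circle, V)) (t : ℝ) : V :=
  ∫ θ in (0 : ℝ)..t, (v (Circle.exp θ) - circleMean v)

omit [NormedSpace ℝ V] in
theorem intervalIntegrable_comp_exp (v : C(Circle, V)) (c : V) (s t : ℝ) :
    IntervalIntegrable (fun θ => v (Circle.exp θ) - c) MeasureTheory.volume s t :=
  Continuous.intervalIntegrable (by fun_prop) _ _

open Real in
-- After the mean is subtracted the integral over a period vanishes. So the primitive descends to
-- the circle, and the jump of `arg` at `-1` is harmless.
theorem anglePrimitive_periodic (v : C(Circle, V)) [CompleteSpace V] :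
    Function.Periodic (anglePrimitive v) (2 * π) := by
  intro t
  have hp : Function.Periodic (fun θ => v (Circle.exp θ) - circleMean v) (2 * π) := fun θ => by
    simp only [Circle.periodic_exp θ]
  have h0 : ∫ θ in (0 : ℝ)..(2 * π), (v (Circle.exp θ) - circleMean v) = 0 := by
    rw [intervalIntegral.integral_sub (Continuous.intervalIntegrable (by fun_prop) _ _)
      intervalIntegrable_const, circleMean_apply, intervalIntegral.integral_const, sub_zero,
      smul_inv_smul₀ two_pi_pos.ne', sub_self]
  unfold anglePrimitive
  rw [← intervalIntegral.integral_add_adjacent_intervals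
    (intervalIntegrable_comp_exp v _ 0 t) (intervalIntegrable_comp_exp v _ t (t + 2 * π)),
    hp.intervalIntegral_add_eq t 0, zero_add, h0, add_zero]

theorem anglePrimitive_arg_exp (v : C(Circle, V)) [CompleteSpace V] (t : ℝ) :
    anglePrimitive v (Complex.arg (Circle.exp t)) = anglePrimitive v t := by
  have h : Circle.exp (Complex.arg (Circle.exp t)) = Circle.exp t := Circle.exp_arg _
  obtain ⟨k, hk⟩ := Circle.exp_eq_exp.1 h
  rw [hk]
  exact (anglePrimitive_periodic v).int_mul k t

theorem norm_anglePrimitive_sub_le (v : C(Circle, V)) (s t : ℝ) :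
    ‖anglePrimitive v s - anglePrimitive v t‖ ≤ 2 * ‖v‖ * |s - t| := by
  unfold anglePrimitive
  rw [intervalIntegral.integral_interval_sub_left (intervalIntegrable_comp_exp v _ 0 s)
    (intervalIntegrable_comp_exp v _ 0 t)]
  refine intervalIntegral.norm_integral_le_of_norm_le_const fun θ _ => ?_
  refine (norm_sub_le _ _).trans ?_
  linarith [v.norm_coe_le_norm (Circle.exp θ), norm_circleMean_le v]

open Real in
theorem norm_anglePrimitive_arg_sub_le (v : C(Circle, V)) [CompleteSpace V] (x y : Circle) :
    ‖anglePrimitive v (Complex.arg x) - anglePrimitive v (Complex.arg y)‖ ≤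
      π * ‖v‖ * dist x y := by
  have hx : Circle.exp (Complex.arg y + Complex.arg (x / y : Circle)) = x := by
    rw [Circle.exp_add, Circle.exp_arg, Circle.exp_arg, mul_div_cancel]
  have h := norm_anglePrimitive_sub_le v (Complex.arg y + Complex.arg (x / y : Circle))
    (Complex.arg y)
  rw [← anglePrimitive_arg_exp v (Complex.arg y + _), hx, add_sub_cancel_left] at h
  refine h.trans ?_
  calc 2 * ‖v‖ * |Complex.arg (x / y : Circle)| ≤ 2 * ‖v‖ * (π / 2 * dist x y) := by
        gcongr
        exact abs_arg_le_dist x y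
    _ = _ := by ring

open Real in
/-- The Hölder function with value `u 1` at `1` whose angular derivative is `v` minus its mean. -/
noncomputable def HolderSpace.ofDeriv {α : ℝ≥0} (hα : 0 < α) (hα1 : α ≤ 1) [CompleteSpace V] :
    C(Circle, V) × C(Circle, V) →L[ℝ] HolderSpace α V :=
  HolderSpace.mkCLM hα
    { toFun := fun p z => p.1 1 + anglePrimitive p.2 (Complex.arg z)
      map_add' := fun p q => by
        funext z
        simp only [anglePrimitive, Prod.fst_add, Prod.snd_add, ContinuousMap.add_apply, map_add,
          Pi.add_apply]
        have e : ∀ θ, p.2 (Circle.exp θ) + q.2 (Circle.exp θ) - (circleMean p.2 + circleMean q.2) =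
          (p.2 (Circle.exp θ) - circleMean p.2) + (q.2 (Circle.exp θ) - circleMean q.2) :=
          fun θ => by abel
        simp only [e]
        rw [intervalIntegral.integral_add (intervalIntegrable_comp_exp _ _ _ _)
          (intervalIntegrable_comp_exp _ _ _ _)]
        abel
      map_smul' := fun c p => by
        funext z
        simp only [anglePrimitive, Prod.smul_fst, Prod.smul_snd, ContinuousMap.smul_apply, map_smul,
          ← smul_sub, intervalIntegral.integral_smul, Pi.smul_apply, smul_add, RingHom.id_apply] }
    (1 + 2 * π) (by positivity)
    (fun p z => by
      have h1 : ‖p.1 1‖ ≤ ‖p‖ := (p.1.norm_coe_le_norm 1).trans (norm_fst_le p)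
      have h2 := norm_anglePrimitive_sub_le p.2 (Complex.arg z) 0
      have h3 : |Complex.arg z| ≤ π := Complex.abs_arg_le_pi _
      have h4 := norm_snd_le p
      rw [sub_zero, show anglePrimitive p.2 0 = 0 from intervalIntegral.integral_same,
        sub_zero] at h2
      change ‖p.1 1 + anglePrimitive p.2 (Complex.arg z)‖ ≤ _
      calc _ ≤ ‖p‖ + 2 * ‖p‖ * π := (norm_add_le _ _).trans (add_le_add h1 (h2.trans (by gcongr)))
        _ = _ := by ring)
    (fun p x y => by
      change ‖p.1 1 + anglePrimitive p.2 (Complex.arg x) -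
        (p.1 1 + anglePrimitive p.2 (Complex.arg y))‖ ≤ _
      rw [add_sub_add_left_eq_sub]
      have h4 := norm_snd_le p
      have h5 := dist_le_two_mul_rpow α.coe_nonneg (by exact_mod_cast hα1 : (α : ℝ) ≤ 1) x y
      calc _ ≤ π * ‖p.2‖ * dist x y := norm_anglePrimitive_arg_sub_le p.2 x y
        _ ≤ π * ‖p‖ * (2 * dist x y ^ (α : ℝ)) := by gcongr
        _ = 2 * π * ‖p‖ * dist x y ^ (α : ℝ) := by ring
        _ ≤ _ := by
          gcongr
          linarith)

theorem circleMean_eq_zero_of_hasDerivAt {u : Circle → V} {v : C(Circle, V)} [CompleteSpace V]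
    (h : ∀ θ : ℝ, HasDerivAt (fun θ : ℝ => u (Circle.exp θ)) (v (Circle.exp θ)) θ) :
    circleMean v = 0 := by
  rw [circleMean_apply, intervalIntegral.integral_eq_sub_of_hasDerivAt (fun θ _ => h θ)
    (Continuous.intervalIntegrable (by fun_prop) _ _)]
  simp

/-- A genuine angular derivative has mean zero, so the correction in `ofDeriv` disappears. Thus `C¹`
functions enter the Hölder space through one bounded linear operator applied to sup-norm data, and
smooth dependence in the Hölder norm follows from smooth dependence of the value and the derivative
in the sup norm. -/
theorem HolderSpace.ofDeriv_eq {α : ℝ≥0} (hα : 0 < α) (hα1 : α ≤ 1) [CompleteSpace V]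
    {u v : C(Circle, V)}
    (h : ∀ θ : ℝ, HasDerivAt (fun θ : ℝ => u (Circle.exp θ)) (v (Circle.exp θ)) θ) (z : Circle) :
    HolderSpace.ofDeriv hα hα1 (u, v) z = u z := by
  change u 1 + anglePrimitive v (Complex.arg z) = u z
  rw [anglePrimitive, circleMean_eq_zero_of_hasDerivAt h]
  simp only [sub_zero]
  rw [intervalIntegral.integral_eq_sub_of_hasDerivAt (fun θ _ => h θ)
    (Continuous.intervalIntegrable (by fun_prop) _ _), Circle.exp_arg]
  simp

end Primitive

/-! ### Evaluation and composition as jointly `C¹` operations. -/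

section BoundedFamily

variable {P E W X : Type*} [NormedAddCommGroup P] [NormedSpace ℝ P] [NormedAddCommGroup E]
  [NormedSpace ℝ E] [NormedAddCommGroup W] [NormedSpace ℝ W]

/-- A family of `C¹` functions on `K` depending linearly and boundedly on a parameter. -/
structure IsBoundedC1Family (A : P → E → W) (K : Set E) (C : ℝ) : Prop where
  nonneg : 0 ≤ C
  add : ∀ p q, ∀ x ∈ K, A (p + q) x = A p x + A q x
  smul : ∀ (c : ℝ) p, ∀ x ∈ K, A (c • p) x = c • A p x
  contDiffOn : ∀ p, ContDiffOn ℝ 1 (A p) K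
  norm_le : ∀ p, ∀ x ∈ K, ‖A p x‖ ≤ C * ‖p‖
  norm_fderivWithin_le : ∀ p, ∀ x ∈ K, ‖fderivWithin ℝ (A p) K x‖ ≤ C * ‖p‖

theorem contDiffOn_one_of_hasFDerivWithinAt {f : E → W} {f' : E → E →L[ℝ] W} {s : Set E}
    (hs : UniqueDiffOn ℝ s) (hd : ∀ x ∈ s, HasFDerivWithinAt f (f' x) s x)
    (hc : ContinuousOn f' s) : ContDiffOn ℝ 1 f s := by
  rw [show (1 : WithTop ℕ∞) = 0 + 1 from rfl, contDiffOn_succ_iff_fderivWithin hs]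
  refine ⟨fun x hx => (hd x hx).differentiableWithinAt, by simp, ?_⟩
  rw [contDiffOn_zero]
  exact hc.congr fun x hx => (hd x hx).fderivWithin (hs x hx)

namespace IsBoundedC1Family

variable {A : P → E → W} {K : Set E} {C : ℝ}

theorem sub (h : IsBoundedC1Family A K C) (p q : P) {x : E} (hx : x ∈ K) :
    A (p - q) x = A p x - A q x := by
  have h1 := h.smul (-1) q x hx
  rw [sub_eq_add_neg, h.add _ _ x hx, ← neg_one_smul ℝ q, h1, neg_one_smul, sub_eq_add_neg]

open Classical in
/-- Evaluation of the family at a point. -/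
noncomputable def evalAt (h : IsBoundedC1Family A K C) (x : E) : P →L[ℝ] W :=
  if hx : x ∈ K then LinearMap.mkContinuous
    { toFun := fun p => A p x
      map_add' := fun p q => h.add p q x hx
      map_smul' := fun c p => h.smul c p x hx } C fun p => h.norm_le p x hx
  else 0

theorem evalAt_apply (h : IsBoundedC1Family A K C) {x : E} (hx : x ∈ K) (p : P) :
    h.evalAt x p = A p x := by
  rw [evalAt, dif_pos hx]
  rfl

theorem fderivWithin_sub (h : IsBoundedC1Family A K C) (hK : UniqueDiffOn ℝ K) (p q : P) {x : E}
    (hx : x ∈ K) : fderivWithin ℝ (A (p - q)) K x =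
      fderivWithin ℝ (A p) K x - fderivWithin ℝ (A q) K x := by
  rw [← _root_.fderivWithin_fun_sub (hK x hx) ((h.contDiffOn p).differentiableOn one_ne_zero x hx)
    ((h.contDiffOn q).differentiableOn one_ne_zero x hx)]
  exact fderivWithin_congr (fun y hy => h.sub p q hy) (h.sub p q hx)

theorem norm_sub_le (h : IsBoundedC1Family A K C) {s : Set E} (hs : s ⊆ K) (hc : Convex ℝ s)
    (p : P) {x y : E} (hx : x ∈ s) (hy : y ∈ s) : ‖A p y - A p x‖ ≤ C * ‖p‖ * ‖y - x‖ :=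
  hc.norm_image_sub_le_of_norm_hasFDerivWithin_le (f' := fun z => fderivWithin ℝ (A p) K z)
    (fun z hz => (((h.contDiffOn p).differentiableOn one_ne_zero z
      (hs hz)).hasFDerivWithinAt).mono hs)
    (fun z hz => h.norm_fderivWithin_le p z (hs hz)) hx hy

/-- The derivative of the evaluation map. -/
noncomputable def derivEval (h : IsBoundedC1Family A K C) (q : P × E) : P × E →L[ℝ] W :=
  (h.evalAt q.2).comp (.fst ℝ P E) + (fderivWithin ℝ (A q.1) K q.2).comp (.snd ℝ P E)

/-- The increment splits into a linear term in the parameter at fixed `x`, an increment in the point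
at fixed `p`, and the cross term `A (q.1 - p) q.2 - A (q.1 - p) x`. By the mean value inequality on
a convex neighbourhood in `K` the cross term is at most `C ‖q.1 - p‖ ‖q.2 - x‖`, which is quadratic.
-/
theorem hasFDerivWithinAt_eval (h : IsBoundedC1Family A K C)
    (hloc : ∀ x ∈ K, ∃ ε > 0, Convex ℝ (K ∩ ball x ε)) {q : P × E} (hq : q.2 ∈ K) :
    HasFDerivWithinAt (fun q : P × E => A q.1 q.2) (h.derivEval q) (univ ×ˢ K) q := by
  obtain ⟨p, x⟩ := q
  have h1 : HasFDerivWithinAt (fun q : P × E => h.evalAt x q.1)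
      ((h.evalAt x).comp (.fst ℝ P E)) (univ ×ˢ K) (p, x) :=
    ((h.evalAt x).comp (ContinuousLinearMap.fst ℝ P E)).hasFDerivWithinAt
  have h2 : HasFDerivWithinAt (fun q : P × E => A p q.2)
      ((fderivWithin ℝ (A p) K x).comp (.snd ℝ P E)) (univ ×ˢ K) (p, x) :=
    HasFDerivWithinAt.comp (p, x) (((h.contDiffOn p).differentiableOn one_ne_zero x
      hq).hasFDerivWithinAt) hasFDerivWithinAt_snd fun q hq => hq.2
  have h3 : HasFDerivWithinAt (fun q : P × E => A (q.1 - p) q.2 - A (q.1 - p) x)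
      (0 : P × E →L[ℝ] W)
      (univ ×ˢ K) (p, x) := by
    refine Asymptotics.IsBigO.hasFDerivWithinAt (𝕜 := ℝ) (n := 2) ?_ ⟨mem_univ _, hq⟩ one_lt_two
    refine Asymptotics.IsBigO.of_bound C ?_
    obtain ⟨ε, hε, hc⟩ := hloc x hq
    have hnear : ∀ᶠ q : P × E in 𝓝[univ ×ˢ K] (p, x), q.2 ∈ ball x ε :=
      nhdsWithin_le_nhds (continuous_snd.continuousAt.eventually (ball_mem_nhds x hε))
    filter_upwards [hnear, self_mem_nhdsWithin] with q hq1 hq2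
    have h4 := h.norm_sub_le inter_subset_left hc (q.1 - p) ⟨hq, mem_ball_self hε⟩ ⟨hq2.2, hq1⟩
    have h5 : ‖q.1 - p‖ ≤ ‖q - (p, x)‖ := norm_fst_le (q - (p, x))
    have h6 : ‖q.2 - x‖ ≤ ‖q - (p, x)‖ := norm_snd_le (q - (p, x))
    have := h.nonneg
    rw [norm_pow, norm_norm, pow_two, ← mul_assoc]
    exact h4.trans (by gcongr)
  have h4 := ((h1.add h2).add h3).sub_const (A p x)
  rw [add_zero] at h4
  refine h4.congr (fun q hq' => ?_) ?_
  · simp only [Pi.add_apply, h.evalAt_apply hq, h.sub q.1 p hq'.2, h.sub q.1 p hq]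
    abel
  · simp only [Pi.add_apply, h.evalAt_apply hq, h.sub p p hq]
    abel

/-- Evaluation at a point is locally Lipschitz in the operator norm by the mean value inequality.
For the derivative in the point, the uniform bound in the parameter reduces joint continuity to
continuity at a fixed parameter. -/
theorem continuousOn_derivEval (h : IsBoundedC1Family A K C) (hK : UniqueDiffOn ℝ K)
    (hloc : ∀ x ∈ K, ∃ ε > 0, Convex ℝ (K ∩ ball x ε)) :
    ContinuousOn h.derivEval (univ ×ˢ K) := by
  have h1 : ContinuousOn h.evalAt K := by
    intro x hx
    obtain ⟨ε, hε, hc⟩ := hloc x hx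
    refine tendsto_iff_norm_sub_tendsto_zero.2 ?_
    have hlim : Filter.Tendsto (fun y => C * ‖y - x‖) (𝓝[K] x) (𝓝 0) := by
      have : Continuous fun y => C * ‖y - x‖ := by fun_prop
      simpa using (this.tendsto x).mono_left nhdsWithin_le_nhds
    refine squeeze_zero' (Filter.Eventually.of_forall fun _ => norm_nonneg _) ?_ hlim
    filter_upwards [self_mem_nhdsWithin, mem_nhdsWithin_of_mem_nhds (ball_mem_nhds x hε)]
      with y hy hy'
    refine ContinuousLinearMap.opNorm_le_bound _ (mul_nonneg h.nonneg (norm_nonneg _)) fun p => ?_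
    rw [_root_.sub_apply, h.evalAt_apply hy, h.evalAt_apply hx, mul_right_comm]
    exact h.norm_sub_le inter_subset_left hc p ⟨hx, mem_ball_self hε⟩ ⟨hy, hy'⟩
  have h2 : ContinuousOn (fun q : P × E => fderivWithin ℝ (A q.1) K q.2) (univ ×ˢ K) := by
    rintro ⟨p, x⟩ ⟨-, hx⟩
    refine tendsto_iff_norm_sub_tendsto_zero.2 ?_
    have hc : ContinuousOn (fderivWithin ℝ (A p) K) K :=
      (h.contDiffOn p).continuousOn_fderivWithin hK le_rfl
    have hlim : Filter.Tendsto (fun q : P × E => C * ‖q.1 - p‖ +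
        ‖fderivWithin ℝ (A p) K q.2 - fderivWithin ℝ (A p) K x‖) (𝓝[univ ×ˢ K] (p, x)) (𝓝 0) := by
      have h3 : ContinuousWithinAt (fun q : P × E => C * ‖q.1 - p‖ +
          ‖fderivWithin ℝ (A p) K q.2 - fderivWithin ℝ (A p) K x‖) (univ ×ˢ K) (p, x) := by
        refine ContinuousWithinAt.add (by fun_prop) (ContinuousWithinAt.norm
          (ContinuousWithinAt.sub ?_ continuousWithinAt_const))
        exact (hc x hx).comp (t := K) continuous_snd.continuousWithinAt fun q hq => hq.2
      simpa [ContinuousWithinAt] using h3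
    refine squeeze_zero' (Filter.Eventually.of_forall fun _ => norm_nonneg _) ?_ hlim
    filter_upwards [self_mem_nhdsWithin] with q hq
    have e : fderivWithin ℝ (A q.1) K q.2 - fderivWithin ℝ (A p) K x =
        fderivWithin ℝ (A (q.1 - p)) K q.2 +
          (fderivWithin ℝ (A p) K q.2 - fderivWithin ℝ (A p) K x) := by
      rw [h.fderivWithin_sub hK _ _ hq.2]
      abel
    rw [e]
    exact (norm_add_le _ _).trans (add_le_add_left (h.norm_fderivWithin_le _ _ hq.2) _)
  exact ((h1.comp continuousOn_snd fun q hq => hq.2).clm_comp continuousOn_const).add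
    (h2.clm_comp continuousOn_const)

/-- Evaluation is `C¹` jointly in the parameter and the point. -/
theorem contDiffOn_eval (h : IsBoundedC1Family A K C) (hK : UniqueDiffOn ℝ K)
    (hloc : ∀ x ∈ K, ∃ ε > 0, Convex ℝ (K ∩ ball x ε)) :
    ContDiffOn ℝ 1 (fun q : P × E => A q.1 q.2) (univ ×ˢ K) := by
  have hu : UniqueDiffOn ℝ ((univ : Set P) ×ˢ K) := uniqueDiffOn_univ.prod hK
  exact contDiffOn_one_of_hasFDerivWithinAt hu
    (fun q hq => h.hasFDerivWithinAt_eval hloc hq.2) (h.continuousOn_derivEval hK hloc)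

end IsBoundedC1Family

section Superposition

variable [TopologicalSpace X] [CompactSpace X]

open Classical in
/-- Composition with `g` on the left, for continuous functions with values in `K`. -/
noncomputable def superposition (K : Set E) (g : E → W) (f : C(X, E)) : C(X, W) :=
  if h : Continuous (g ∘ f) ∧ MapsTo f univ K then ⟨g ∘ f, h.1⟩ else 0

/-- The continuous functions with values in `K`. -/
def mapsToSet (X : Type*) [TopologicalSpace X] (K : Set E) : Set C(X, E) := {f | MapsTo f univ K}

omit [NormedSpace ℝ E] in
theorem isOpen_mapsToSet {K : Set E} (hK : IsOpen K) : IsOpen (mapsToSet X K) :=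
  ContinuousMap.isOpen_setOfPred_mapsTo isCompact_univ hK

omit [NormedSpace ℝ E] [NormedSpace ℝ W] [CompactSpace X] in
theorem superposition_apply {K : Set E} {g : E → W} (hg : ContinuousOn g K) {f : C(X, E)}
    (hf : f ∈ mapsToSet X K) (x : X) : superposition K g f x = g (f x) := by
  have : Continuous (g ∘ f) := hg.comp_continuous f.continuous fun x => hf (mem_univ x)
  rw [superposition, dif_pos ⟨this, hf⟩]
  rfl

omit [NormedSpace ℝ E] [NormedSpace ℝ W] in
-- The range of `f` is compact, so one radius works at all its points, both for staying inside `K`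
-- and for the oscillation of `g`.
theorem exists_uniform_of_mem_mapsToSet {K : Set E} (hK : IsOpen K) {g : E → W}
    (hg : ContinuousOn g K) {f : C(X, E)} (hf : f ∈ mapsToSet X K) {ε : ℝ} (hε : 0 < ε) :
    ∃ δ > 0, ∀ x, ball (f x) δ ⊆ K ∧ ∀ y ∈ ball (f x) δ, ‖g y - g (f x)‖ < ε := by
  have hc : IsCompact (range f) := isCompact_range f.continuous
  have hs : range f ⊆ K := by
    rintro _ ⟨x, rfl⟩
    exact hf (mem_univ x)
  obtain ⟨δ₁, hδ₁, h₁⟩ := hc.exists_thickening_subset_open hK hs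
  have h₂ := hc.uniformContinuousAt_of_continuousAt g
    (fun a ha => hg.continuousAt (hK.mem_nhds (hs ha))) (Metric.dist_mem_uniformity hε)
  obtain ⟨δ₂, hδ₂, h₃⟩ := Metric.mem_uniformity_dist.1 h₂
  refine ⟨min δ₁ δ₂, lt_min hδ₁ hδ₂, fun x => ⟨fun y hy => h₁ ?_, fun y hy => ?_⟩⟩
  · exact Metric.mem_thickening_iff.2 ⟨f x, mem_range_self x, lt_of_lt_of_le hy (min_le_left _ _)⟩
  · have := h₃ (a := f x) (b := y)
      (by rw [dist_comm]; exact lt_of_lt_of_le hy (min_le_right _ _)) (mem_range_self x)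
    rw [← dist_eq_norm, dist_comm]
    exact this

omit [NormedSpace ℝ E] [NormedSpace ℝ W] in
theorem continuousOn_superposition {K : Set E} (hK : IsOpen K) {g : E → W}
    (hg : ContinuousOn g K) : ContinuousOn (superposition (X := X) K g) (mapsToSet X K) := by
  intro f hf
  rw [ContinuousWithinAt, Metric.tendsto_nhds]
  intro ε hε
  obtain ⟨δ, hδ, h⟩ := exists_uniform_of_mem_mapsToSet hK hg hf (half_pos hε)
  filter_upwards [mem_nhdsWithin_of_mem_nhds (ball_mem_nhds f hδ), self_mem_nhdsWithin] with f' h1 h2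
  refine lt_of_le_of_lt ((ContinuousMap.dist_le (half_pos hε).le).2 fun x => ?_) (half_lt_self hε)
  rw [superposition_apply hg hf, superposition_apply hg h2, dist_eq_norm]
  exact ((h x).2 _ ((ContinuousMap.dist_apply_le_dist x).trans_lt h1)).le

/-- Pointwise application of a bilinear map to continuous functions. -/
noncomputable def pointwiseApply : C(X, E →L[ℝ] W) →L[ℝ] C(X, E) →L[ℝ] C(X, W) :=
  LinearMap.mkContinuous₂
    (LinearMap.mk₂ ℝ (fun (u : C(X, E →L[ℝ] W)) (v : C(X, E)) => (⟨fun x => u x (v x), by fun_prop⟩ : C(X, W)))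
      (fun u u' v => by ext; simp) (fun c u v => by ext; simp) (fun u v v' => by ext; simp)
      (fun c u v => by ext; simp))
    1 fun u v => by
      rw [one_mul]
      refine (ContinuousMap.norm_le _ (by positivity)).2 fun x => ?_
      have h1 := u.norm_coe_le_norm x
      have h2 := v.norm_coe_le_norm x
      exact ((u x).le_opNorm _).trans (by gcongr)

@[simp]
theorem pointwiseApply_apply (u : C(X, E →L[ℝ] W)) (v : C(X, E)) (x : X) :
    pointwiseApply u v x = u x (v x) := rfl

/-- The mean value inequality is applied at each `x` on a ball around `f x`, where the derivative of
`g` varies by at most `ε`; the radius is uniform in `x`, so the pointwise estimate is an estimate in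
the sup norm. -/
theorem hasFDerivAt_superposition {K : Set E} (hK : IsOpen K) {g : E → W}
    (hg : ContDiffOn ℝ 1 g K) {f : C(X, E)} (hf : f ∈ mapsToSet X K) :
    HasFDerivAt (superposition K g) (pointwiseApply (superposition K (fderiv ℝ g) f)) f := by
  have hd : ∀ y ∈ K, HasFDerivAt g (fderiv ℝ g y) y := fun y hy =>
    ((hg.differentiableOn one_ne_zero).differentiableAt (hK.mem_nhds hy)).hasFDerivAt
  have hg' : ContinuousOn (fderiv ℝ g) K := hg.continuousOn_fderiv_of_isOpen hK le_rfl
  refine .of_isLittleO <| Asymptotics.isLittleO_iff.2 fun ε hε => ?_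
  obtain ⟨δ, hδ, h⟩ := exists_uniform_of_mem_mapsToSet hK hg' hf hε
  filter_upwards [ball_mem_nhds f hδ, (isOpen_mapsToSet hK).mem_nhds hf] with f' h1 h2
  refine (ContinuousMap.norm_le _ (by positivity)).2 fun x => ?_
  simp only [ContinuousMap.sub_apply, pointwiseApply_apply, superposition_apply hg.continuousOn hf,
    superposition_apply hg.continuousOn h2, superposition_apply hg' hf]
  have h3 : f' x ∈ ball (f x) δ := (ContinuousMap.dist_apply_le_dist x).trans_lt h1
  have h4 := (convex_ball (f x) δ).norm_image_sub_le_of_norm_hasFDerivWithin_le'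
    (f' := fun y => fderiv ℝ g y) (φ := fderiv ℝ g (f x))
    (fun y hy => (hd y ((h x).1 hy)).hasFDerivWithinAt) (fun y hy => ((h x).2 y hy).le)
    (mem_ball_self hδ) h3
  exact h4.trans (by gcongr; exact (f' - f).norm_coe_le_norm x)

theorem contDiffOn_superposition {K : Set E} (hK : IsOpen K) {g : E → W}
    (hg : ContDiffOn ℝ 1 g K) : ContDiffOn ℝ 1 (superposition (X := X) K g) (mapsToSet X K) := by
  have hd := fun f (hf : f ∈ mapsToSet X K) => hasFDerivAt_superposition hK hg hf
  refine contDiffOn_one_of_hasFDerivWithinAt (isOpen_mapsToSet hK).uniqueDiffOn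
    (fun f hf => (hd f hf).hasFDerivWithinAt) ?_
  exact pointwiseApply.continuous.comp_continuousOn
    (continuousOn_superposition hK (hg.continuousOn_fderiv_of_isOpen hK le_rfl))

/-- Composition with the members of a family is again a family of the same kind, now on an open set
of continuous maps and with the same constant. Joint differentiability of composition therefore
becomes an instance of joint differentiability of evaluation. -/
theorem IsBoundedC1Family.superposition {A : P → E → W} {K : Set E} {C : ℝ} (hK : IsOpen K)
    (h : IsBoundedC1Family A K C) :
    IsBoundedC1Family (fun p => superposition (X := X) K (A p)) (mapsToSet X K) C where
  nonneg := h.nonneg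
  add p q f hf := by
    ext x
    simp only [ContinuousMap.add_apply, superposition_apply (h.contDiffOn _).continuousOn hf]
    exact h.add p q _ (hf (mem_univ x))
  smul c p f hf := by
    ext x
    simp only [ContinuousMap.smul_apply, superposition_apply (h.contDiffOn _).continuousOn hf]
    exact h.smul c p _ (hf (mem_univ x))
  contDiffOn p := contDiffOn_superposition hK (h.contDiffOn p)
  norm_le p f hf := by
    have := h.nonneg
    refine (ContinuousMap.norm_le _ (by positivity)).2 fun x => ?_
    rw [superposition_apply (h.contDiffOn _).continuousOn hf]
    exact h.norm_le p _ (hf (mem_univ x))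
  norm_fderivWithin_le p f hf := by
    have h0 := h.nonneg
    have hg := (h.contDiffOn p).continuousOn_fderiv_of_isOpen hK le_rfl
    rw [fderivWithin_of_isOpen (isOpen_mapsToSet hK) hf,
      (hasFDerivAt_superposition hK (h.contDiffOn p) hf).fderiv]
    refine ContinuousLinearMap.opNorm_le_bound _ (by positivity) fun v => ?_
    refine (ContinuousMap.norm_le _ (by positivity)).2 fun x => ?_
    rw [pointwiseApply_apply, superposition_apply hg hf]
    refine (ContinuousLinearMap.le_opNorm _ _).trans ?_
    gcongr
    · rw [← fderivWithin_of_isOpen hK (hf (mem_univ x))]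
      exact h.norm_fderivWithin_le p _ (hf (mem_univ x))
    · exact v.norm_coe_le_norm x

/-- Composition is `C¹` jointly in the outer and the inner function. -/
theorem IsBoundedC1Family.contDiffOn_superposition {A : P → E → W} {K : Set E} {C : ℝ}
    (hK : IsOpen K) (h : IsBoundedC1Family A K C) :
    ContDiffOn ℝ 1 (fun q : P × C(X, E) => _root_.superposition K (A q.1) q.2)
      (univ ×ˢ mapsToSet X K) :=
  (h.superposition hK).contDiffOn_eval (isOpen_mapsToSet hK).uniqueDiffOn fun f hf => by
    obtain ⟨ε, hε, hb⟩ := Metric.isOpen_iff.1 (isOpen_mapsToSet (X := X) hK) f hf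
    refine ⟨ε, hε, ?_⟩
    rw [inter_eq_self_of_subset_right hb]
    exact convex_ball f ε

end Superposition

end BoundedFamily

/-! ### Completeness of `C^k` spaces, and derivatives as bounded families. -/

namespace CkSpace

variable {E F : Type*} [NormedAddCommGroup E] [NormedSpace ℝ E]
  [NormedAddCommGroup F] [NormedSpace ℝ F] {k : ℕ} {X : Set E} [hX : Fact (UniqueDiffOn ℝ X)]

theorem supDeriv_le_norm {j : ℕ} (hj : j ≤ k) (f : CkSpace k X F) : supDeriv j f ≤ ‖f‖ := by
  rw [norm_def]
  exact Finset.single_le_sum (f := fun j => supDeriv j f) (fun i _ => supDeriv_nonneg i f)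
    (Finset.mem_range.2 (Nat.lt_succ_of_le hj))

theorem norm_iteratedFDerivWithin_le {j : ℕ} (hj : j ≤ k) (f : CkSpace k X F) {x : E}
    (hx : x ∈ X) : ‖iteratedFDerivWithin ℝ j f X x‖ ≤ ‖f‖ :=
  (le_supDeriv hj f ⟨x, hx⟩).trans (supDeriv_le_norm hj f)

theorem iteratedFDerivWithin_sub {j : ℕ} (hj : j ≤ k) (f g : CkSpace k X F) {x : E}
    (hx : x ∈ X) : iteratedFDerivWithin ℝ j (f - g : CkSpace k X F).1 X x =
      iteratedFDerivWithin ℝ j f X x - iteratedFDerivWithin ℝ j g X x := by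
  have hj' : (j : WithTop ℕ∞) ≤ k := by exact_mod_cast hj
  exact iteratedFDerivWithin_sub_apply ((f.2.2.1 x hx).of_le hj') ((g.2.2.1 x hx).of_le hj')
    hX.out hx

/-- Along a Cauchy sequence the derivatives of each order at most `k` converge uniformly. Uniform
convergence of the derivatives lets differentiation pass to the limit, so the limits form a Taylor
series up to order `k` for the limit function. -/
theorem complete_of_isOpen [CompleteSpace F] (hXo : IsOpen X) : CompleteSpace (CkSpace k X F) := by
  refine Metric.complete_of_cauchySeq_tendsto fun u hu => ?_
  have hcau : ∀ j ≤ k, ∀ x ∈ X, CauchySeq fun n => iteratedFDerivWithin ℝ j (u n) X x := by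
    intro j hj x hx
    rw [Metric.cauchySeq_iff] at hu ⊢
    intro ε hε
    obtain ⟨N, hN⟩ := hu ε hε
    refine ⟨N, fun m hm n hn => lt_of_le_of_lt ?_ (hN m hm n hn)⟩
    rw [dist_eq_norm, dist_eq_norm, ← iteratedFDerivWithin_sub hj _ _ hx]
    exact norm_iteratedFDerivWithin_le hj _ hx
  have hlim : ∀ (x : E) (j : ℕ), ∃ l : E [×j]→L[ℝ] F, x ∈ X → j ≤ k →
      Filter.Tendsto (fun n => iteratedFDerivWithin ℝ j (u n) X x) Filter.atTop (𝓝 l) := by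
    intro x j
    by_cases h : x ∈ X ∧ j ≤ k
    · obtain ⟨l, hl⟩ := cauchySeq_tendsto_of_complete (hcau j h.2 x h.1)
      exact ⟨l, fun _ _ => hl⟩
    · exact ⟨0, fun h1 h2 => (h ⟨h1, h2⟩).elim⟩
  choose p hp using hlim
  have hunif : ∀ j ≤ k, ∀ ε > 0, ∃ N, ∀ n ≥ N, ∀ x ∈ X,
      ‖iteratedFDerivWithin ℝ j (u n) X x - p x j‖ ≤ ε := by
    intro j hj ε hε
    obtain ⟨N, hN⟩ := Metric.cauchySeq_iff.1 hu ε hε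
    refine ⟨N, fun n hn x hx => ?_⟩
    refine le_of_tendsto (tendsto_const_nhds.sub (hp x j hx hj)).norm ?_
    filter_upwards [Filter.eventually_ge_atTop N] with m hm
    rw [← iteratedFDerivWithin_sub hj _ _ hx]
    refine (norm_iteratedFDerivWithin_le hj _ hx).trans ?_
    rw [← dist_eq_norm]
    exact (hN n hn m hm).le
  have hunif' : ∀ j ≤ k, TendstoUniformlyOn (fun n x => iteratedFDerivWithin ℝ j (u n) X x)
      (fun x => p x j) Filter.atTop X := by
    intro j hj
    rw [Metric.tendstoUniformlyOn_iff]
    intro ε hε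
    obtain ⟨N, hN⟩ := hunif j hj (ε / 2) (half_pos hε)
    filter_upwards [Filter.eventually_ge_atTop N] with n hn x hx
    rw [dist_comm, dist_eq_norm]
    exact (hN n hn x hx).trans_lt (half_lt_self hε)
  classical
  set f : E → F := fun x => if x ∈ X then (p x 0).curry0 else 0 with hf
  have hser : HasFTaylorSeriesUpToOn k f p X := by
    constructor
    · intro x hx
      simp only [hf, if_pos hx]
    · intro j hj x hx
      have hj' : j + 1 ≤ k := by exact_mod_cast Order.add_one_le_of_lt (by exact_mod_cast hj : j < k)
      have hd : HasFDerivAt (fun y => p y j) ((p x j.succ).curryLeft) x := by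
        refine hasFDerivAt_of_tendstoUniformlyOn (l := Filter.atTop) (s := X) hXo
          (f := fun n y => iteratedFDerivWithin ℝ j (u n) X y)
          (f' := fun n y => (iteratedFDerivWithin ℝ (j + 1) (u n) X y).curryLeft)
          (g' := fun y => (p y j.succ).curryLeft) ?_ ?_ ?_ hx
        · exact ((continuousMultilinearCurryLeftEquiv ℝ (fun _ : Fin (j + 1) => E)
            F).toContinuousLinearEquiv.toContinuousLinearMap.uniformContinuous).comp_tendstoUniformlyOn
            (hunif' (j + 1) hj')
        · intro n y hy
          have hlt : (j : WithTop ℕ∞) < k := hj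
          have h1 := ((u n).2.2.1.differentiableOn_iteratedFDerivWithin hlt hX.out y hy)
          have h2 := h1.hasFDerivWithinAt.hasFDerivAt (hXo.mem_nhds hy)
          rwa [fderivWithin_iteratedFDerivWithin] at h2
        · exact fun y hy => hp y j hy (by omega)
      exact hd.hasFDerivWithinAt
    · intro j hj
      have hj' : j ≤ k := by exact_mod_cast hj
      refine (hunif' j hj').continuousOn (Filter.Frequently.of_forall fun n => ?_)
      exact (u n).2.2.1.continuousOn_iteratedFDerivWithin hj hX.out
  have hder : ∀ j ≤ k, ∀ x ∈ X, iteratedFDerivWithin ℝ j f X x = p x j := fun j hj x hx =>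
    (hser.eq_iteratedFDerivWithin_of_uniqueDiffOn (by exact_mod_cast hj) hX.out hx).symm
  have hfm : f ∈ ckSubmodule k X F := by
    refine ⟨fun x hx => if_neg hx, hser.contDiffOn, fun j hj => ?_⟩
    obtain ⟨N, hN⟩ := hunif j hj 1 one_pos
    refine ⟨‖u N‖ + 1, ?_⟩
    rintro _ ⟨x, rfl⟩
    simp only [hder j hj x x.2]
    have h1 := hN N le_rfl x x.2
    have h2 := norm_iteratedFDerivWithin_le hj (u N) x.2
    have h3 := norm_le_norm_add_norm_sub (iteratedFDerivWithin ℝ j (u N) X x) (p x j)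
    linarith
  obtain ⟨g, hg⟩ : ∃ g : CkSpace k X F, g.1 = f := ⟨⟨f, hfm⟩, rfl⟩
  rw [← hg] at hder
  refine ⟨g, tendsto_iff_norm_sub_tendsto_zero.2 ?_⟩
  simp only [norm_def]
  rw [← Finset.sum_const_zero (s := Finset.range (k + 1))]
  refine tendsto_finsetSum _ fun j hj => ?_
  have hj' := Nat.lt_succ_iff.1 (Finset.mem_range.1 hj)
  rw [Metric.tendsto_atTop]
  intro ε hε
  obtain ⟨N, hN⟩ := hunif j hj' (ε / 2) (half_pos hε)
  refine ⟨N, fun n hn => ?_⟩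
  rw [Real.dist_0_eq_abs, abs_of_nonneg (supDeriv_nonneg _ _)]
  refine lt_of_le_of_lt (Real.iSup_le (fun x => ?_) (half_pos hε).le) (half_lt_self hε)
  rw [iteratedFDerivWithin_sub hj' _ _ x.2]
  have := hN n hn x x.2
  rwa [← hder j hj' x x.2] at this

theorem norm_iteratedFDeriv_le (hXo : IsOpen X) {j : ℕ} (hj : j ≤ k) (f : CkSpace k X F) {x : E}
    (hx : x ∈ X) : ‖iteratedFDeriv ℝ j f x‖ ≤ ‖f‖ := by
  rw [← iteratedFDerivWithin_of_isOpen j hXo hx]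
  exact norm_iteratedFDerivWithin_le hj f hx

theorem isBoundedC1Family_coe (hXo : IsOpen X) (hk : 1 ≤ k) :
    IsBoundedC1Family (fun f : CkSpace k X F => (f : E → F)) X 1 where
  nonneg := zero_le_one
  add _ _ _ _ := rfl
  smul _ _ _ _ := rfl
  contDiffOn f := f.2.2.1.of_le (by exact_mod_cast hk)
  norm_le f x hx := by
    simpa using norm_iteratedFDeriv_le hXo (Nat.zero_le k) f hx
  norm_fderivWithin_le f x hx := by
    rw [fderivWithin_of_isOpen hXo hx, one_mul, ← norm_iteratedFDeriv_zero (𝕜 := ℝ),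
      norm_iteratedFDeriv_fderiv]
    exact norm_iteratedFDeriv_le hXo hk f hx

theorem contDiffOn_fderiv (hXo : IsOpen X) {j : ℕ} (hk : j + 1 ≤ k) (f : CkSpace k X F) :
    ContDiffOn ℝ j (fderiv ℝ f) X :=
  f.2.2.1.fderiv_of_isOpen hXo (by exact_mod_cast hk)

theorem contDiffOn_fderiv_fderiv (hXo : IsOpen X) {j : ℕ} (hk : j + 2 ≤ k) (f : CkSpace k X F) :
    ContDiffOn ℝ j (fderiv ℝ (fderiv ℝ f)) X :=
  (f.contDiffOn_fderiv hXo (j := j + 1) hk).fderiv_of_isOpen hXo (by norm_cast)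

theorem isBoundedC1Family_fderiv (hXo : IsOpen X) (hk : 2 ≤ k) :
    IsBoundedC1Family (fun f : CkSpace k X F => fderiv ℝ (f : E → F)) X 1 where
  nonneg := zero_le_one
  add f g x hx := fderiv_add
    ((f.2.2.1.differentiableOn (by positivity)).differentiableAt (hXo.mem_nhds hx))
    ((g.2.2.1.differentiableOn (by positivity)).differentiableAt (hXo.mem_nhds hx))
  smul c f x hx := fderiv_const_smul
    ((f.2.2.1.differentiableOn (by positivity)).differentiableAt (hXo.mem_nhds hx)) c
  contDiffOn f := f.contDiffOn_fderiv hXo (j := 1) hk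
  norm_le f x hx := by
    rw [one_mul, ← norm_iteratedFDeriv_zero (𝕜 := ℝ), norm_iteratedFDeriv_fderiv]
    exact norm_iteratedFDeriv_le hXo (by omega) f hx
  norm_fderivWithin_le f x hx := by
    rw [fderivWithin_of_isOpen hXo hx, one_mul, ← norm_iteratedFDeriv_zero (𝕜 := ℝ),
      norm_iteratedFDeriv_fderiv, norm_iteratedFDeriv_fderiv]
    exact norm_iteratedFDeriv_le hXo hk f hx

/-- The second derivative must itself be `C¹` with a bound by the norm, which uses the third
derivative. This is where `C³` perturbations are needed. -/
theorem isBoundedC1Family_fderiv_fderiv (hXo : IsOpen X) (hk : 3 ≤ k) :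
    IsBoundedC1Family (fun f : CkSpace k X F => fderiv ℝ (fderiv ℝ (f : E → F))) X 1 where
  nonneg := zero_le_one
  add f g x hx := by
    have hd := fun f : CkSpace k X F =>
      ((f.contDiffOn_fderiv hXo (j := 1) (by omega)).differentiableOn one_ne_zero).differentiableAt
        (hXo.mem_nhds hx)
    refine Eq.trans (Filter.EventuallyEq.fderiv_eq ?_) (fderiv_add (hd f) (hd g))
    filter_upwards [hXo.mem_nhds hx] with y hy
    exact (isBoundedC1Family_fderiv hXo (by omega)).add f g y hy
  smul c f x hx := by
    have hd := ((f.contDiffOn_fderiv hXo (j := 1) (by omega)).differentiableOn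
      one_ne_zero).differentiableAt (hXo.mem_nhds hx)
    refine Eq.trans (Filter.EventuallyEq.fderiv_eq ?_) (fderiv_const_smul hd c)
    filter_upwards [hXo.mem_nhds hx] with y hy
    exact (isBoundedC1Family_fderiv hXo (by omega)).smul c f y hy
  contDiffOn f := f.contDiffOn_fderiv_fderiv hXo (j := 1) hk
  norm_le f x hx := by
    rw [one_mul, ← norm_iteratedFDeriv_zero (𝕜 := ℝ), norm_iteratedFDeriv_fderiv,
      norm_iteratedFDeriv_fderiv]
    exact norm_iteratedFDeriv_le hXo (by omega) f hx
  norm_fderivWithin_le f x hx := by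
    rw [fderivWithin_of_isOpen hXo hx, one_mul, ← norm_iteratedFDeriv_zero (𝕜 := ℝ),
      norm_iteratedFDeriv_fderiv, norm_iteratedFDeriv_fderiv, norm_iteratedFDeriv_fderiv]
    exact norm_iteratedFDeriv_le hXo hk f hx

end CkSpace

instance (m : ℕ) (r : ℝ) : CompleteSpace (Perturbation m r) :=
  CkSpace.complete_of_isOpen (isOpen_tube m r)

/-! ### Holomorphic functions with Hölder derivative up to the boundary. -/

theorem Circle.coe_mem_cDisc (z : Circle) : (z : ℂ) ∈ cDisc :=
  mem_closedBall_zero_iff.2 (Circle.norm_coe z).le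

theorem Circle.coe_mem_sphere (z : Circle) : (z : ℂ) ∈ sphere (0 : ℂ) 1 :=
  mem_sphere_zero_iff_norm.2 (Circle.norm_coe z)

theorem hasDerivAt_coe_circleExp (θ : ℝ) :
    HasDerivAt (fun θ : ℝ => (Circle.exp θ : ℂ)) (Complex.I * Circle.exp θ) θ := by
  have h : HasDerivAt (fun θ : ℝ => Complex.exp (θ * Complex.I))
      (Complex.exp (θ * Complex.I) * (1 * Complex.I)) θ :=
    (((Complex.ofRealCLM.hasDerivAt (x := θ)).mul_const Complex.I)).cexp
  simpa [Circle.coe_exp, mul_comm] using h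

theorem closure_ball_eq_cDisc : closure (ball (0 : ℂ) 1) = cDisc := closure_ball _ one_ne_zero

section

variable {V : Type*} [NormedAddCommGroup V] [NormedSpace ℂ V]

/-- Multiplication of a fixed vector by complex numbers, as a real linear map. -/
noncomputable def smulVec : V →L[ℝ] ℂ →L[ℝ] V := (ContinuousLinearMap.lsmul ℝ ℂ).flip

@[simp]
theorem smulVec_apply (v : V) (c : ℂ) : smulVec v c = c • v := rfl

theorem norm_smulVec_le (v : V) : ‖smulVec v‖ ≤ ‖v‖ :=
  ContinuousLinearMap.opNorm_le_bound _ (norm_nonneg _) fun c => by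
    rw [smulVec_apply, norm_smul, mul_comm]

theorem hasFDerivAt_smulVec {h : ℂ → V} {d : V} {z : ℂ} (hd : HasDerivAt h d z) :
    HasFDerivAt h (smulVec d) z := by
  have h1 := hd.hasFDerivAt.restrictScalars ℝ
  exact h1.congr_fderiv (by ext; simp)

/-- A holomorphic function on the disc whose derivative extends continuously to the closed disc is
differentiable up to the boundary. -/
theorem hasFDerivWithinAt_smulVec {h p : ℂ → V} (hc : ContinuousOn h cDisc)
    (hd : ∀ z ∈ ball (0 : ℂ) 1, HasDerivAt h (p z) z) (hp : ContinuousOn p cDisc) {z : ℂ}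
    (hz : z ∈ cDisc) : HasFDerivWithinAt h (smulVec (p z)) cDisc z := by
  rw [← closure_ball_eq_cDisc] at hz hp hc ⊢
  refine hasFDerivWithinAt_closure_of_tendsto_fderiv (fun y hy =>
    (hasFDerivAt_smulVec (hd y hy)).differentiableAt.differentiableWithinAt) (convex_ball _ _)
    isOpen_ball (fun y hy => (hc y hy).mono subset_closure) ?_
  refine Filter.Tendsto.congr' (f₁ := fun y => smulVec (p y)) ?_ ?_
  · filter_upwards [self_mem_nhdsWithin] with y hy
    exact (hasFDerivAt_smulVec (hd y hy)).fderiv.symm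
  · exact (smulVec.continuous.tendsto _).comp ((hp z hz).mono subset_closure)

theorem eqOn_zero_of_hasDerivAt_zero {D : ℂ → V} (hc : ContinuousOn D cDisc)
    (hd : ∀ z ∈ ball (0 : ℂ) 1, HasDerivAt D 0 z) (h0 : D 0 = 0) : ∀ z ∈ cDisc, D z = 0 := by
  have h1 : EqOn D 0 (ball 0 1) := fun z hz => by
    have := (convex_ball (0 : ℂ) 1).norm_image_sub_le_of_norm_hasDerivWithin_le (C := 0)
      (fun y hy => (hd y hy).hasDerivWithinAt) (fun y _ => by simp)
      (mem_ball_self one_pos) hz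
    simpa [h0] using this
  intro z hz
  rw [← closure_ball_eq_cDisc] at hz hc
  exact h1.of_subset_closure hc continuousOn_const subset_closure subset_rfl hz

/-- `h` is holomorphic in the disc with derivative `p`, with bounds by `C` for `h` and for the Hölder
norm of `p` on the closed disc. -/
structure IsHolderPrimitive (a C : ℝ) (h p : ℂ → V) : Prop where
  nonneg : 0 ≤ C
  continuousOn : ContinuousOn h cDisc
  hasDerivAt : ∀ z ∈ ball (0 : ℂ) 1, HasDerivAt h (p z) z
  holder : ∀ x ∈ cDisc, ∀ y ∈ cDisc, ‖p x - p y‖ ≤ C * ‖x - y‖ ^ a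
  norm_le : ∀ x ∈ cDisc, ‖h x‖ ≤ C
  norm_deriv_le : ∀ x ∈ cDisc, ‖p x‖ ≤ C

namespace IsHolderPrimitive

variable {a C : ℝ} {h p : ℂ → V}

theorem continuousOn_deriv (H : IsHolderPrimitive a C h p) (ha : 0 < a) : ContinuousOn p cDisc :=
  continuousOn_of_norm_sub_le_rpow ha H.nonneg H.holder

theorem hasFDerivWithinAt (H : IsHolderPrimitive a C h p) (ha : 0 < a) {z : ℂ} (hz : z ∈ cDisc) :
    HasFDerivWithinAt h (smulVec (p z)) cDisc z :=
  hasFDerivWithinAt_smulVec H.continuousOn H.hasDerivAt (H.continuousOn_deriv ha) hz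

theorem norm_sub_le (H : IsHolderPrimitive a C h p) (ha : 0 < a) {x y : ℂ} (hx : x ∈ cDisc)
    (hy : y ∈ cDisc) : ‖h x - h y‖ ≤ C * ‖x - y‖ :=
  (convex_closedBall (0 : ℂ) 1).norm_image_sub_le_of_norm_hasFDerivWithin_le
    (fun _ hz => H.hasFDerivWithinAt ha hz)
    (fun z hz => (norm_smulVec_le _).trans (H.norm_deriv_le z hz)) hy hx

theorem norm_sub_le_rpow (H : IsHolderPrimitive a C h p) (ha : 0 < a) (ha1 : a ≤ 1) {x y : ℂ}
    (hx : x ∈ cDisc) (hy : y ∈ cDisc) : ‖h x - h y‖ ≤ 2 * C * ‖x - y‖ ^ a := by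
  have h2 : ‖x - y‖ ≤ 2 := by
    have := _root_.norm_sub_le x y
    have h3 := mem_closedBall_zero_iff.1 hx
    have h4 := mem_closedBall_zero_iff.1 hy
    linarith
  have h1 := le_two_mul_rpow (norm_nonneg (x - y)) h2 ha.le ha1
  have h3 := H.nonneg
  calc _ ≤ C * ‖x - y‖ := H.norm_sub_le ha hx hy
    _ ≤ C * (2 * ‖x - y‖ ^ a) := by gcongr
    _ = _ := by ring

theorem hasDerivAt_circle (H : IsHolderPrimitive a C h p) (ha : 0 < a) (θ : ℝ) :
    HasDerivAt (fun θ : ℝ => h (Circle.exp θ))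
      ((Complex.I * Circle.exp θ : ℂ) • p (Circle.exp θ)) θ := by
  have h1 := (H.hasFDerivWithinAt ha (Circle.coe_mem_cDisc (Circle.exp θ))).comp_hasDerivAt θ
    (hasDerivAt_coe_circleExp θ) (Filter.Eventually.of_forall fun θ => Circle.coe_mem_cDisc _)
  exact h1

end IsHolderPrimitive

end

/-! ### Discs built from such functions. -/

namespace HolDisc

variable {m : ℕ} {α : ℝ≥0} {C : ℝ} {h p : ℂ → Cn m}

theorem circleDeriv_eq {f : Circle → Cn m} {d : Cn m} (z : Circle)
    (hd : HasDerivAt (fun θ : ℝ => f (Circle.exp θ)) d (Complex.arg z)) :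
    circleDeriv f z = d := by
  have h1 : (fun θ : ℝ => f (z * Circle.exp θ)) =
      fun θ : ℝ => (fun θ : ℝ => f (Circle.exp θ)) (Complex.arg z + θ) := by
    funext θ
    simp [Circle.exp_add]
  rw [circleDeriv, h1]
  exact (HasDerivAt.comp_const_add (Complex.arg z) 0 (by rwa [add_zero])).deriv

theorem dist_circle (x y : Circle) : dist x y = ‖(x : ℂ) - y‖ := dist_eq_norm (x : ℂ) y

theorem _root_.IsHolderPrimitive.circleDeriv_eq (H : IsHolderPrimitive α C h p) (hα : 0 < α)
    (z : Circle) : circleDeriv (fun z : Circle => h z) z = (Complex.I * z : ℂ) • p z := by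
  have := HolDisc.circleDeriv_eq (f := fun z : Circle => h z) z
    (H.hasDerivAt_circle (NNReal.coe_pos.2 hα) _)
  rwa [Circle.exp_arg] at this

theorem norm_circleDeriv_sub_le (H : IsHolderPrimitive α C h p) (hα1 : α < 1) (x y : Circle) :
    ‖(Complex.I * x : ℂ) • p x - (Complex.I * y : ℂ) • p y‖ ≤ 3 * C * dist x y ^ (α : ℝ) := by
  have h1 := dist_le_two_mul_rpow α.coe_nonneg (by exact_mod_cast hα1.le : (α : ℝ) ≤ 1) x y
  have h2 := H.holder _ x.coe_mem_cDisc _ y.coe_mem_cDisc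
  have h3 := H.norm_deriv_le _ x.coe_mem_cDisc
  have h4 := H.nonneg
  rw [← dist_circle] at h2
  have e : (Complex.I * x : ℂ) • p x - (Complex.I * y : ℂ) • p y =
      (Complex.I * (x - y) : ℂ) • p x + (Complex.I * y : ℂ) • (p x - p y) := by
    rw [mul_sub, sub_smul, smul_sub]
    abel
  rw [e]
  refine (norm_add_le _ _).trans ?_
  rw [norm_smul, norm_smul, norm_mul, norm_mul, Complex.norm_I, one_mul, one_mul, Circle.norm_coe,
    one_mul, ← dist_circle]
  calc _ ≤ 2 * dist x y ^ (α : ℝ) * C + C * dist x y ^ (α : ℝ) := by gcongr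
    _ = _ := by ring

theorem isC1HolderHol_of (H : IsHolderPrimitive α C h p) (hα : 0 < α) (hα1 : α < 1) :
    IsC1HolderHol α h := by
  have ha : 0 < (α : ℝ) := NNReal.coe_pos.2 hα
  have hC := H.nonneg
  have hd := fun z (hz : z ∈ cDisc) => H.hasFDerivWithinAt ha hz
  refine ⟨fun z hz => (H.hasDerivAt z hz).differentiableAt.differentiableWithinAt,
    contDiffOn_one_of_hasFDerivWithinAt uniqueDiffOn_cDisc hd
      (smulVec.continuous.comp_continuousOn (H.continuousOn_deriv ha)), ?_, ?_⟩
  · refine (HolderWith.restrict_iff.2 (holderOnWith_of_dist_le (C := (2 * C).toNNReal) ?_)).memHolder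
    intro x hx y hy
    rw [dist_eq_norm, dist_eq_norm, Real.coe_toNNReal _ (by positivity)]
    exact H.norm_sub_le_rpow ha (by exact_mod_cast hα1.le) hx hy
  · refine (HolderWith.restrict_iff.2 (holderOnWith_of_dist_le (C := C.toNNReal) ?_)).memHolder
    intro x hx y hy
    rw [dist_eq_norm, dist_eq_norm, Real.coe_toNNReal _ hC,
      (hd x hx).fderivWithin (uniqueDiffOn_cDisc x hx),
      (hd y hy).fderivWithin (uniqueDiffOn_cDisc y hy), ← map_sub]
    exact (norm_smulVec_le _).trans (H.holder x hx y hy)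

theorem isC1HolderCircle_of (H : IsHolderPrimitive α C h p) (hα : 0 < α) (hα1 : α < 1) :
    IsC1HolderCircle α fun z : Circle => h z := by
  have ha : 0 < (α : ℝ) := NNReal.coe_pos.2 hα
  have hC := H.nonneg
  refine ⟨?_, ?_, ?_⟩
  · have hd := fun θ : ℝ => H.hasDerivAt_circle ha θ
    rw [contDiff_one_iff_deriv]
    refine ⟨fun θ => (hd θ).differentiableAt, ?_⟩
    rw [funext fun θ => (hd θ).deriv]
    refine Continuous.smul (f := fun θ : ℝ => Complex.I * (Circle.exp θ : ℂ)) (by fun_prop) ?_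
    exact (H.continuousOn_deriv ha).comp_continuous (f := fun θ : ℝ => (Circle.exp θ : ℂ))
      (by fun_prop) fun θ => Circle.coe_mem_cDisc _
  · refine (holderOnWith_univ.1 (holderOnWith_of_dist_le (C := (2 * C).toNNReal) ?_)).memHolder
    intro x _ y _
    rw [dist_eq_norm, dist_circle, Real.coe_toNNReal _ (by positivity)]
    exact H.norm_sub_le_rpow ha (by exact_mod_cast hα1.le) x.coe_mem_cDisc y.coe_mem_cDisc
  · refine (holderOnWith_univ.1 (holderOnWith_of_dist_le (C := (3 * C).toNNReal) ?_)).memHolder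
    intro x _ y _
    rw [dist_eq_norm, Real.coe_toNNReal _ (by positivity), H.circleDeriv_eq hα,
      H.circleDeriv_eq hα]
    exact norm_circleDeriv_sub_le H hα1 x y

/-- The disc given by a holomorphic function with Hölder derivative. -/
noncomputable def ofPrimitive (H : IsHolderPrimitive α C h p) (hα : 0 < α) (hα1 : α < 1) :
    HolDisc m α :=
  ⟨fun z => h z, isC1HolderCircle_of H hα hα1, h, isC1HolderHol_of H hα hα1, fun _ => rfl⟩

theorem ext_ofPrimitive (H : IsHolderPrimitive α C h p) (hα : 0 < α) (hα1 : α < 1) :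
    EqOn (ofPrimitive H hα hα1).ext h cDisc :=
  ext_eqOn _ (isC1HolderHol_of H hα hα1) fun _ => rfl

theorem holderNorm_le {f : Circle → Cn m} {A B : ℝ} (hB : 0 ≤ B) (hA : ∀ z, ‖f z‖ ≤ A)
    (h : ∀ x y, ‖f x - f y‖ ≤ B * dist x y ^ (α : ℝ)) : holderNorm α f ≤ A + B := by
  refine add_le_add (ciSup_le hA) ?_
  have h1 : HolderWith B.toNNReal α f := holderOnWith_univ.1 (holderOnWith_of_dist_le
    fun x _ y _ => by
      rw [dist_eq_norm, Real.coe_toNNReal _ hB]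
      exact h x y)
  have h2 : (nnHolderNorm α f : ℝ) ≤ B.toNNReal := by exact_mod_cast h1.nnholderNorm_le
  rwa [Real.coe_toNNReal _ hB] at h2

theorem norm_ofPrimitive_le (H : IsHolderPrimitive α C h p) (hα : 0 < α) (hα1 : α < 1) :
    ‖ofPrimitive H hα hα1‖ ≤ 7 * C := by
  have ha : 0 < (α : ℝ) := NNReal.coe_pos.2 hα
  have hC := H.nonneg
  have h1 : holderNorm α (fun z : Circle => h z) ≤ C + 2 * C :=
    holderNorm_le (by positivity) (fun z => H.norm_le _ z.coe_mem_cDisc) fun x y => by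
      rw [dist_circle]
      exact H.norm_sub_le_rpow ha (by exact_mod_cast hα1.le) x.coe_mem_cDisc y.coe_mem_cDisc
  have h2 : holderNorm α (circleDeriv fun z : Circle => h z) ≤ C + 3 * C := by
    rw [funext (H.circleDeriv_eq hα)]
    refine holderNorm_le (by positivity) (fun z => ?_) (norm_circleDeriv_sub_le H hα1)
    rw [norm_smul, norm_mul, Complex.norm_I, Circle.norm_coe, one_mul, one_mul]
    exact H.norm_deriv_le _ z.coe_mem_cDisc
  calc ‖ofPrimitive H hα hα1‖ = holderNorm α (fun z : Circle => h z) +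
        holderNorm α (circleDeriv fun z : Circle => h z) := rfl
    _ ≤ (C + 2 * C) + (C + 3 * C) := add_le_add h1 h2
    _ = _ := by ring

/-! ### Bounds for the values and the derivative of a disc -/

theorem norm_eq (f : HolDisc m α) : ‖f‖ = holderNorm α f.1 + holderNorm α (circleDeriv f.1) := rfl

theorem norm_apply_le (f : HolDisc m α) (z : Circle) : ‖f z‖ ≤ ‖f‖ := by
  have h1 := le_ciSup (bddAbove_of_memHolder f.2.1.holder) z
  have h2 : (0 : ℝ) ≤ nnHolderNorm α f.1 := NNReal.zero_le_coe
  have h3 := holderNorm_nonneg (α := α) (circleDeriv f.1)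
  rw [norm_eq, holderNorm]
  linarith

theorem norm_circleDeriv_le (f : HolDisc m α) (z : Circle) : ‖circleDeriv f z‖ ≤ ‖f‖ := by
  have h1 := le_ciSup (bddAbove_of_memHolder f.2.1.holder_deriv) z
  have h2 : (0 : ℝ) ≤ nnHolderNorm α (circleDeriv f.1) := NNReal.zero_le_coe
  have h3 := holderNorm_nonneg (α := α) f.1
  rw [norm_eq]
  unfold holderNorm at h3 ⊢
  linarith

theorem norm_circleDeriv_sub_le_norm (f : HolDisc m α) (x y : Circle) :
    ‖circleDeriv f x - circleDeriv f y‖ ≤ ‖f‖ * dist x y ^ (α : ℝ) := by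
  have h0 := f.2.1.holder_deriv.holderWith.dist_le x y
  have h1 : 0 ≤ ⨆ z, ‖circleDeriv f z‖ := Real.iSup_nonneg fun _ => norm_nonneg _
  have h3 := holderNorm_nonneg (α := α) f.1
  rw [dist_eq_norm] at h0
  refine h0.trans ?_
  gcongr
  rw [norm_eq]
  unfold holderNorm at h3 ⊢
  linarith

theorem diffContOnCl (f : HolDisc m α) : DiffContOnCl ℂ f.ext (ball 0 1) :=
  ⟨f.isC1HolderHol_ext.holo, by
    rw [closure_ball_eq_cDisc]; exact f.isC1HolderHol_ext.contDiffOn.continuousOn⟩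

theorem exists_circle_of_mem_sphere {z : ℂ} (hz : z ∈ sphere (0 : ℂ) 1) :
    ∃ w : Circle, (w : ℂ) = z :=
  ⟨⟨z, by simpa [Submonoid.unitSphere] using hz⟩, rfl⟩

theorem norm_ext_le (f : HolDisc m α) {z : ℂ} (hz : z ∈ cDisc) : ‖f.ext z‖ ≤ ‖f‖ := by
  rw [← closure_ball_eq_cDisc] at hz
  refine Complex.norm_le_of_forall_mem_frontier_norm_le isBounded_ball f.diffContOnCl
    (fun w hw => ?_) hz
  rw [frontier_ball _ one_ne_zero] at hw
  obtain ⟨w, rfl⟩ := exists_circle_of_mem_sphere hw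
  rw [ext_coe]
  exact f.norm_apply_le w

theorem hasFDerivWithinAt_ext (f : HolDisc m α) {z : ℂ} (hz : z ∈ cDisc) :
    HasFDerivWithinAt f.ext (fderivWithin ℝ f.ext cDisc z) cDisc z :=
  (f.isC1HolderHol_ext.contDiffOn.differentiableOn one_ne_zero z hz).hasFDerivWithinAt

theorem continuousOn_fderivWithin_ext (f : HolDisc m α) :
    ContinuousOn (fderivWithin ℝ f.ext cDisc) cDisc :=
  f.isC1HolderHol_ext.contDiffOn.continuousOn_fderivWithin uniqueDiffOn_cDisc le_rfl

theorem hasDerivAt_ext (f : HolDisc m α) {z : ℂ} (hz : z ∈ ball (0 : ℂ) 1) :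
    HasDerivAt f.ext (deriv f.ext z) z :=
  (f.isC1HolderHol_ext.holo.differentiableAt (isOpen_ball.mem_nhds hz)).hasDerivAt

theorem fderivWithin_ext_of_mem_ball (f : HolDisc m α) {z : ℂ} (hz : z ∈ ball (0 : ℂ) 1) :
    fderivWithin ℝ f.ext cDisc z = smulVec (deriv f.ext z) := by
  have hz' : z ∈ cDisc := ball_subset_closedBall hz
  exact ((hasFDerivAt_smulVec (f.hasDerivAt_ext hz)).hasFDerivWithinAt).fderivWithin
    (uniqueDiffOn_cDisc z hz')

/-- The derivative is complex linear in the open disc, and this passes to the boundary by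
continuity. -/
theorem fderivWithin_ext_eq (f : HolDisc m α) {z : ℂ} (hz : z ∈ cDisc) :
    fderivWithin ℝ f.ext cDisc z = smulVec (fderivWithin ℝ f.ext cDisc z 1) := by
  have hc := f.continuousOn_fderivWithin_ext
  have h1 : EqOn (fun z => fderivWithin ℝ f.ext cDisc z)
      (fun z => smulVec (fderivWithin ℝ f.ext cDisc z 1)) (ball 0 1) := fun z hz => by
    simp only [f.fderivWithin_ext_of_mem_ball hz, smulVec_apply, one_smul]
  have hc2 : ContinuousOn (fun z => smulVec (fderivWithin ℝ f.ext cDisc z 1)) cDisc :=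
    smulVec.continuous.comp_continuousOn (hc.clm_apply continuousOn_const)
  rw [← closure_ball_eq_cDisc] at hz
  refine h1.of_subset_closure ?_ ?_ subset_closure subset_rfl hz
  · rw [closure_ball_eq_cDisc]; exact hc
  · rw [closure_ball_eq_cDisc]; exact hc2

theorem hasDerivAt_circle (f : HolDisc m α) (θ : ℝ) :
    HasDerivAt (fun θ : ℝ => f (Circle.exp θ)) (circleDeriv f (Circle.exp θ)) θ := by
  have h1 := ((f.2.1.contDiff.differentiable one_ne_zero) θ).hasDerivAt
  have h2 : circleDeriv f (Circle.exp θ) = deriv (fun θ : ℝ => f.1 (Circle.exp θ)) θ := by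
    have e : (fun t : ℝ => f (Circle.exp θ * Circle.exp t)) =
        fun t : ℝ => (fun θ : ℝ => f (Circle.exp θ)) (θ + t) := by
      funext t
      simp [Circle.exp_add]
    rw [circleDeriv, e]
    exact (HasDerivAt.comp_const_add θ 0 (by rwa [add_zero])).deriv
  rw [h2]
  exact h1

/-- At a boundary point the angular derivative is the complex derivative multiplied by the
unimodular number `i z`. -/
theorem norm_fderivWithin_ext_one_circle (f : HolDisc m α) (z : Circle) :
    ‖fderivWithin ℝ f.ext cDisc z 1‖ = ‖circleDeriv f z‖ := by
  have h1 := (f.hasFDerivWithinAt_ext (Circle.coe_mem_cDisc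
    (Circle.exp (Complex.arg z)))).comp_hasDerivAt (Complex.arg z)
    (hasDerivAt_coe_circleExp (Complex.arg z))
    (Filter.Eventually.of_forall fun θ => Circle.coe_mem_cDisc _)
  have h2 : (f.ext ∘ fun θ : ℝ => (Circle.exp θ : ℂ)) = fun θ : ℝ => f (Circle.exp θ) := by
    funext θ
    exact f.ext_coe _
  rw [h2] at h1
  have h3 := h1.unique (f.hasDerivAt_circle _)
  rw [Circle.exp_arg] at h3
  rw [← h3, f.fderivWithin_ext_eq z.coe_mem_cDisc, smulVec_apply, smulVec_apply, one_smul,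
    norm_smul, norm_mul, Complex.norm_I, Circle.norm_coe, one_mul, one_mul]

/-- The complex derivative is holomorphic inside and continuous up to the circle, so the maximum
principle reduces the bound to the angular derivative. Thus a norm defined on the circle alone
controls the `C¹` norm on the closed disc. -/
theorem norm_fderivWithin_ext_le (f : HolDisc m α) {z : ℂ} (hz : z ∈ cDisc) :
    ‖fderivWithin ℝ f.ext cDisc z‖ ≤ ‖f‖ := by
  have hd : DiffContOnCl ℂ (fun z => fderivWithin ℝ f.ext cDisc z 1) (ball 0 1) := by
    refine ⟨?_, ?_⟩
    · refine ((f.isC1HolderHol_ext.holo.deriv isOpen_ball)).congr fun z hz => ?_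
      rw [f.fderivWithin_ext_of_mem_ball hz, smulVec_apply, one_smul]
    · rw [closure_ball_eq_cDisc]
      exact f.continuousOn_fderivWithin_ext.clm_apply continuousOn_const
  rw [f.fderivWithin_ext_eq hz]
  refine (norm_smulVec_le _).trans ?_
  rw [← closure_ball_eq_cDisc] at hz
  refine Complex.norm_le_of_forall_mem_frontier_norm_le isBounded_ball hd (fun w hw => ?_) hz
  rw [frontier_ball _ one_ne_zero] at hw
  obtain ⟨w, rfl⟩ := exists_circle_of_mem_sphere hw
  rw [norm_fderivWithin_ext_one_circle]
  exact f.norm_circleDeriv_le w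

/-- Since `ext` is a choice, its linearity on the closed disc rests on uniqueness of the extension;
the bounds are the maximum principle. As a consequence `(f, ξ) ↦ f(ξ)` is jointly `C¹`, including at
boundary points `ξ`. -/
theorem isBoundedC1Family_ext : IsBoundedC1Family (fun f : HolDisc m α => f.ext) cDisc 1 where
  nonneg := zero_le_one
  add f g z hz := (f + g).ext_eqOn (f.isC1HolderHol_ext.add g.isC1HolderHol_ext) (fun z => by
    rw [Pi.add_apply, ext_coe, ext_coe]; rfl) hz
  smul c f z hz := (c • f).ext_eqOn (f.isC1HolderHol_ext.smul c) (fun z => by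
    rw [Pi.smul_apply, ext_coe]; rfl) hz
  contDiffOn f := f.isC1HolderHol_ext.contDiffOn
  norm_le f z hz := by rw [one_mul]; exact f.norm_ext_le hz
  norm_fderivWithin_le f z hz := by rw [one_mul]; exact f.norm_fderivWithin_ext_le hz

/-- The boundary values of a disc, as a continuous function. -/
noncomputable def toC : HolDisc m α →L[ℝ] C(Circle, Cn m) :=
  LinearMap.mkContinuous
    { toFun := fun f => ⟨fun z => f z, by
        have : (fun z : Circle => f z) = fun z : Circle => f.ext z := funext fun z => (f.ext_coe z).symm
        rw [this]
        exact f.isC1HolderHol_ext.contDiffOn.continuousOn.comp_continuous (by fun_prop)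
          fun z => z.coe_mem_cDisc⟩
      map_add' := fun _ _ => rfl
      map_smul' := fun _ _ => rfl } 1 fun f => by
    rw [one_mul]
    exact (ContinuousMap.norm_le _ (norm_nonneg _)).2 f.norm_apply_le

/-- The angular derivative of a disc, as a Hölder function. -/
noncomputable def angular (hα : 0 < α) : HolDisc m α →L[ℝ] HolderSpace α (Cn m) :=
  HolderSpace.mkCLM hα
    { toFun := fun f => circleDeriv f
      map_add' := fun f g => circleDeriv_add f.2.1 g.2.1
      map_smul' := fun c f => circleDeriv_smul c f.2.1 } 1 zero_le_one
    (fun f z => by rw [one_mul]; exact f.norm_circleDeriv_le z)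
    fun f x y => by rw [one_mul]; exact f.norm_circleDeriv_sub_le_norm x y

@[simp]
theorem angular_apply (hα : 0 < α) (f : HolDisc m α) (z : Circle) :
    angular hα f z = circleDeriv f z := rfl

end HolDisc

/-! ### The Schwarz operator on Hölder functions. -/

namespace HolderSpace

variable {α : ℝ≥0}

/-- The values of a function on the circle, as a function on the plane. -/
noncomputable def onPlane (u : HolderSpace α ℝ) (ζ : ℂ) : ℝ := u (Circle.exp (Complex.arg ζ))

@[simp]
theorem onPlane_coe (u : HolderSpace α ℝ) (z : Circle) : u.onPlane z = u z := by
  rw [onPlane, Circle.exp_arg]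

theorem abs_onPlane_le (u : HolderSpace α ℝ) {ζ : ℂ} (hζ : ζ ∈ sphere (0 : ℂ) 1) :
    |u.onPlane ζ| ≤ ‖u‖ := by
  obtain ⟨z, rfl⟩ := HolDisc.exists_circle_of_mem_sphere hζ
  rw [onPlane_coe]
  exact norm_apply_le u z

theorem abs_onPlane_sub_le (u : HolderSpace α ℝ) {ζ η : ℂ} (hζ : ζ ∈ sphere (0 : ℂ) 1)
    (hη : η ∈ sphere (0 : ℂ) 1) : |u.onPlane ζ - u.onPlane η| ≤ ‖u‖ * ‖ζ - η‖ ^ (α : ℝ) := by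
  obtain ⟨z, rfl⟩ := HolDisc.exists_circle_of_mem_sphere hζ
  obtain ⟨w, rfl⟩ := HolDisc.exists_circle_of_mem_sphere hη
  rw [onPlane_coe, onPlane_coe, ← HolDisc.dist_circle]
  exact norm_sub_le u z w

theorem continuousOn_onPlane (hα : 0 < α) (u : HolderSpace α ℝ) :
    ContinuousOn u.onPlane (sphere 0 1) :=
  continuousOn_of_norm_sub_le_rpow (NNReal.coe_pos.2 hα) (norm_nonneg u)
    fun _ hx _ hy => u.abs_onPlane_sub_le hx hy

theorem circleAverage_onPlane (u : HolderSpace α ℝ) :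
    Real.circleAverage u.onPlane 0 1 = circleMean (toC u) := by
  rw [Real.circleAverage, circleMean_apply]
  congr 2
  funext θ
  have : circleMap 0 1 θ = (Circle.exp θ : ℂ) := by simp [circleMap]
  rw [this, onPlane_coe]

theorem exists_schwarz (hα : 0 < α) (hα1 : α < 1) : ∃ C : ℝ, 0 ≤ C ∧
    ∀ u : HolderSpace α ℝ, ∃ h p, IsSchwarzPrimitive α (C * ‖u‖) u.onPlane h p := by
  obtain ⟨C, hC, h⟩ := exists_isSchwarzPrimitive (NNReal.coe_pos.2 hα)
    (by exact_mod_cast hα1 : (α : ℝ) < 1)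
  exact ⟨C, hC, fun u => h _ _ (norm_nonneg u) (fun _ => u.abs_onPlane_le)
    fun _ hx _ hy => u.abs_onPlane_sub_le hx hy⟩

/-- The bound for the Schwarz primitive. -/
noncomputable def schwarzBound (hα : 0 < α) (hα1 : α < 1) : ℝ := (exists_schwarz hα hα1).choose

/-- The holomorphic function with `Re h` having angular derivative `u - circleMean u` and
`h 0 = circleMean u`. -/
noncomputable def schwarz (hα : 0 < α) (hα1 : α < 1) (u : HolderSpace α ℝ) : ℂ → ℂ :=
  ((exists_schwarz hα hα1).choose_spec.2 u).choose

/-- The derivative of the Schwarz primitive. -/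
noncomputable def schwarzDeriv (hα : 0 < α) (hα1 : α < 1) (u : HolderSpace α ℝ) : ℂ → ℂ :=
  ((exists_schwarz hα hα1).choose_spec.2 u).choose_spec.choose

variable (hα : 0 < α) (hα1 : α < 1)

theorem schwarzBound_nonneg : 0 ≤ schwarzBound hα hα1 := (exists_schwarz hα hα1).choose_spec.1

theorem isSchwarzPrimitive_schwarz (u : HolderSpace α ℝ) :
    IsSchwarzPrimitive α (schwarzBound hα hα1 * ‖u‖) u.onPlane (schwarz hα hα1 u)
      (schwarzDeriv hα hα1 u) :=
  ((exists_schwarz hα hα1).choose_spec.2 u).choose_spec.choose_spec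

theorem schwarz_zero_eq (u : HolderSpace α ℝ) :
    schwarz hα hα1 u 0 = circleMean (toC u) := by
  rw [(isSchwarzPrimitive_schwarz hα hα1 u).center, circleAverage_onPlane]

theorem re_mul_schwarzDeriv (u : HolderSpace α ℝ) (z : Circle) :
    (Complex.I * z * schwarzDeriv hα hα1 u z).re = u z - circleMean (toC u) := by
  rw [(isSchwarzPrimitive_schwarz hα hα1 u).boundary _ z.coe_mem_sphere, onPlane_coe,
    circleAverage_onPlane]

theorem cauchyAverage_onPlane_add_smul (hα : 0 < α) (u v : HolderSpace α ℝ) (c : ℝ) {z : ℂ}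
    (hz : z ∈ ball (0 : ℂ) 1) :
    cauchyAverage (fun ζ => ((u + c • v).onPlane ζ : ℂ)) z =
      cauchyAverage (fun ζ => (u.onPlane ζ : ℂ)) z +
        c * cauchyAverage (fun ζ => (v.onPlane ζ : ℂ)) z := by
  have hi : ∀ w : HolderSpace α ℝ,
      CircleIntegrable (fun ζ => 2 / (ζ - z) * (w.onPlane ζ : ℂ)) 0 1 := fun w =>
    (continuousOn_two_div_mul (Complex.continuous_ofReal.comp_continuousOn
      (continuousOn_onPlane hα w)) hz).circleIntegrable zero_le_one
  rw [cauchyAverage, cauchyAverage, cauchyAverage, ← smul_eq_mul (c : ℂ),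
    ← Real.circleAverage_fun_smul, ← Real.circleAverage_fun_add (hi u)
      (CircleIntegrable.const_fun_smul (hi v))]
  congr 1
  funext ζ
  have : (u + c • v).onPlane ζ = u.onPlane ζ + c * v.onPlane ζ := by simp [onPlane]
  rw [this, smul_eq_mul]
  push_cast
  ring

/-- The primitives are chosen separately for each function, so linearity comes from uniqueness: the
derivative is given by a Cauchy integral, the value at the centre by a mean, and both are linear. -/
theorem schwarz_add_smul (u v : HolderSpace α ℝ) (c : ℝ) {z : ℂ} (hz : z ∈ cDisc) :
    schwarz hα hα1 (u + c • v) z = schwarz hα hα1 u z + c * schwarz hα hα1 v z := by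
  have H := isSchwarzPrimitive_schwarz hα hα1
  have h1 := eqOn_zero_of_hasDerivAt_zero
    (D := fun z => schwarz hα hα1 (u + c • v) z - (schwarz hα hα1 u z + c * schwarz hα hα1 v z))
    ((H _).continuousOn.sub ((H u).continuousOn.add (continuousOn_const.mul (H v).continuousOn)))
    (fun z hz => by
      refine (((H (u + c • v)).hasDerivAt z hz).sub (((H u).hasDerivAt z hz).add
        (((H v).hasDerivAt z hz).const_mul (c : ℂ)))).congr_deriv ?_
      rw [(H _).formula z hz, (H _).formula z hz, (H _).formula z hz,
        cauchyAverage_onPlane_add_smul hα u v c hz]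
      ring)
    (by simp [schwarz_zero_eq]) z hz
  exact sub_eq_zero.1 h1

/-- This is the product rule; in the Hölder bound for the derivative, `5 = 2 + 2 + 1` comes from the
increments of `h`, of the affine factor and of `p`. -/
theorem isHolderPrimitive_affine_mul {V : Type*} [NormedAddCommGroup V] [NormedSpace ℂ V]
    {a C : ℝ} {h p : ℂ → ℂ} (hC : 0 ≤ C) (H : IsHolderPrimitive a C h p) (ha : 0 < a)
    (ha1 : a ≤ 1) {c d : ℂ} (hd : ‖d‖ ≤ 1) (hcd : ∀ z ∈ cDisc, ‖c + d * z‖ ≤ 1) {e : V}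
    (he : ‖e‖ ≤ 1) :
    IsHolderPrimitive a (5 * C) (fun z => ((c + d * z) * h z) • e)
      (fun z => (d * h z + (c + d * z) * p z) • e) where
  nonneg := by positivity
  continuousOn := by
    have := H.continuousOn
    fun_prop
  hasDerivAt z hz := by
    have h1 : HasDerivAt (fun z => c + d * z) d z := by
      simpa using ((hasDerivAt_id z).const_mul d).const_add c
    exact (h1.mul (H.hasDerivAt z hz)).smul_const e
  holder x hx y hy := by
    have h1 := H.norm_sub_le_rpow ha ha1 hx hy
    have h2 := H.holder x hx y hy
    have h3 := H.norm_deriv_le x hx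
    have h4 := le_two_mul_rpow (norm_nonneg (x - y)) (by
      have := _root_.norm_sub_le x y
      have h3 := mem_closedBall_zero_iff.1 hx
      have h4 := mem_closedBall_zero_iff.1 hy
      linarith) ha.le ha1
    have h5 := hcd y hy
    rw [← sub_smul, norm_smul]
    have e1 : d * h x + (c + d * x) * p x - (d * h y + (c + d * y) * p y) =
        d * (h x - h y) + d * (x - y) * p x + (c + d * y) * (p x - p y) := by ring
    rw [e1]
    refine (mul_le_of_le_one_right (norm_nonneg _) he).trans ((norm_add₃_le).trans ?_)
    rw [norm_mul, norm_mul, norm_mul, norm_mul]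
    calc _ ≤ 1 * (2 * C * ‖x - y‖ ^ a) + 1 * (2 * ‖x - y‖ ^ a) * C + 1 * (C * ‖x - y‖ ^ a) := by
          gcongr
      _ = _ := by ring
  norm_le x hx := by
    rw [norm_smul, norm_mul]
    calc _ ≤ 1 * C * 1 := by
          gcongr
          · exact hcd x hx
          · exact H.norm_le x hx
      _ ≤ _ := by linarith
  norm_deriv_le x hx := by
    rw [norm_smul]
    refine (mul_le_of_le_one_right (norm_nonneg _) he).trans ((norm_add_le _ _).trans ?_)
    rw [norm_mul, norm_mul]
    calc _ ≤ 1 * C + 1 * C := by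
          gcongr
          · exact H.norm_le x hx
          · exact hcd x hx
          · exact H.norm_deriv_le x hx
      _ ≤ _ := by linarith

theorem isHolderPrimitive_schwarz (u : HolderSpace α ℝ) :
    IsHolderPrimitive α (schwarzBound hα hα1 * ‖u‖) (schwarz hα hα1 u) (schwarzDeriv hα hα1 u) :=
  have H := isSchwarzPrimitive_schwarz hα hα1 u
  ⟨mul_nonneg (schwarzBound_nonneg hα hα1) (norm_nonneg u), H.continuousOn, H.hasDerivAt, H.holder,
    H.norm_le, H.norm_deriv_le⟩

end HolderSpace

/-! ### Discs parametrized by real boundary data. -/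

namespace HolDisc

open HolderSpace

variable {m : ℕ} {α : ℝ≥0} (hα : 0 < α) (hα1 : α < 1)

/-- The constant and linear coefficient of the affine function that multiplies the `k`-th component
of a disc: `z` for the distinguished component, and `i` for the others. -/
noncomputable def twist (k : Fin (m + 1)) : ℂ × ℂ := Fin.cases (0, 1) (fun _ => (Complex.I, 0)) k

@[simp]
theorem twist_zero : twist (0 : Fin (m + 1)) = (0, 1) := rfl

@[simp]
theorem twist_succ (j : Fin m) : twist j.succ = (Complex.I, 0) := rfl

theorem norm_twist_le (k : Fin (m + 1)) {z : ℂ} (hz : z ∈ cDisc) :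
    ‖(twist k).1 + (twist k).2 * z‖ ≤ 1 := by
  refine Fin.cases ?_ (fun j => ?_) k
  · simpa using hz
  · simp

theorem norm_twist_snd_le (k : Fin (m + 1)) : ‖(twist k).2‖ ≤ 1 := by
  refine Fin.cases ?_ (fun j => ?_) k <;> simp

theorem isHolderPrimitive_component (k : Fin (m + 1)) (u : HolderSpace α ℝ) :
    IsHolderPrimitive α (5 * (schwarzBound hα hα1 * ‖u‖))
      (fun z => (((twist k).1 + (twist k).2 * z) * schwarz hα hα1 u z) •
        (EuclideanSpace.single k 1 : Cn m))
      (fun z => ((twist k).2 * schwarz hα hα1 u z +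
        ((twist k).1 + (twist k).2 * z) * schwarzDeriv hα hα1 u z) •
        (EuclideanSpace.single k 1 : Cn m)) :=
  isHolderPrimitive_affine_mul (isHolderPrimitive_schwarz hα hα1 u).nonneg
    (isHolderPrimitive_schwarz hα hα1 u) (NNReal.coe_pos.2 hα) (by exact_mod_cast hα1.le)
    (norm_twist_snd_le k) (fun _ => norm_twist_le k) (by simp)

/-- The bounded linear map given by a family of functions with Hölder derivatives. -/
noncomputable def primitiveCLM {P : Type*} [NormedAddCommGroup P] [NormedSpace ℝ P]
    (h p : P → ℂ → Cn m) (C : ℝ) (H : ∀ u, IsHolderPrimitive α (C * ‖u‖) (h u) (p u))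
    (hadd : ∀ u v, ∀ z : Circle, h (u + v) z = h u z + h v z)
    (hsmul : ∀ (c : ℝ) u, ∀ z : Circle, h (c • u) z = c • h u z) : P →L[ℝ] HolDisc m α :=
  LinearMap.mkContinuous
    { toFun := fun u => ofPrimitive (H u) hα hα1
      map_add' := fun u v => Subtype.ext (funext (hadd u v))
      map_smul' := fun c u => Subtype.ext (funext (hsmul c u)) }
    (7 * C) fun u => (norm_ofPrimitive_le (H u) hα hα1).trans_eq (mul_assoc _ _ _).symm

/-- The disc with only one component, given by a Schwarz primitive. -/
noncomputable def component (k : Fin (m + 1)) : HolderSpace α ℝ →L[ℝ] HolDisc m α :=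
  primitiveCLM hα hα1 _ _ (5 * schwarzBound hα hα1)
    (fun u => (mul_assoc 5 (schwarzBound hα hα1) ‖u‖).symm ▸
      isHolderPrimitive_component hα hα1 k u)
    (fun u v z => by
      have h1 := schwarz_add_smul hα hα1 u v 1 z.coe_mem_cDisc
      rw [one_smul, Complex.ofReal_one, one_mul] at h1
      rw [h1, mul_add, add_smul])
    (fun c u z => by
      -- Additivity at zero gives the value `0` for the zero function, which turns the combined rule
      -- for `u + c • v` into homogeneity.
      have h0 := schwarz_add_smul hα hα1 (0 : HolderSpace α ℝ) 0 1 z.coe_mem_cDisc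
      have h1 := schwarz_add_smul hα hα1 0 u c z.coe_mem_cDisc
      rw [smul_zero, add_zero, Complex.ofReal_one, one_mul, left_eq_add] at h0
      rw [zero_add, h0, zero_add] at h1
      rw [h1, mul_left_comm, mul_smul, Complex.coe_smul])

theorem ext_component (k : Fin (m + 1)) (u : HolderSpace α ℝ) {z : ℂ} (hz : z ∈ cDisc) :
    (component hα hα1 k u).ext z = (((twist k).1 + (twist k).2 * z) * schwarz hα hα1 u z) •
        (EuclideanSpace.single k 1 : Cn m) :=
  ext_ofPrimitive (isHolderPrimitive_component hα hα1 k u) hα hα1 hz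

theorem circleDeriv_component (k : Fin (m + 1)) (u : HolderSpace α ℝ) (z : Circle) :
    circleDeriv (component hα hα1 k u) z =
      (Complex.I * z : ℂ) • ((twist k).2 * schwarz hα hα1 u z +
        ((twist k).1 + (twist k).2 * z) * schwarzDeriv hα hα1 u z) •
        (EuclideanSpace.single k 1 : Cn m) :=
  (isHolderPrimitive_component hα hα1 k u).circleDeriv_eq hα z

/-- The disc whose components are given by Schwarz primitives. -/
noncomputable def ofBoundary : (Fin (m + 1) → HolderSpace α ℝ) →L[ℝ] HolDisc m α :=
  ∑ k, component hα hα1 k ∘L ContinuousLinearMap.proj k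

theorem ofBoundary_apply (w : Fin (m + 1) → HolderSpace α ℝ) :
    (ofBoundary hα hα1 w : HolDisc m α) = ∑ k, component hα hα1 k (w k) := by
  simp [ofBoundary]

/-- Evaluation of a disc at a point of the closed disc. -/
noncomputable def evalAt {z : ℂ} (hz : z ∈ cDisc) : HolDisc m α →ₗ[ℝ] Cn m where
  toFun f := f.ext z
  map_add' f g := isBoundedC1Family_ext.add f g _ hz
  map_smul' c f := isBoundedC1Family_ext.smul c f _ hz

theorem sum_smul_single_apply {c : Fin (m + 1) → ℂ} (k : Fin (m + 1)) :
    (∑ i, c i • (EuclideanSpace.single i 1 : Cn m)) k = c k := by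
  have := map_sum (EuclideanSpace.proj k : Cn m →L[ℂ] ℂ)
    (fun i => c i • (EuclideanSpace.single i 1 : Cn m)) Finset.univ
  change (EuclideanSpace.proj k : Cn m →L[ℂ] ℂ) (∑ i, c i • (EuclideanSpace.single i 1 : Cn m)) = _
  rw [this, Finset.sum_eq_single k]
  · simp
  · intro b _ hb
    simp [hb.symm]
  · simp

theorem ext_ofBoundary (w : Fin (m + 1) → HolderSpace α ℝ) {z : ℂ} (hz : z ∈ cDisc)
    (k : Fin (m + 1)) : (ofBoundary hα hα1 w : HolDisc m α).ext z k =
      ((twist k).1 + (twist k).2 * z) * schwarz hα hα1 (w k) z := by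
  have h1 : (ofBoundary hα hα1 w : HolDisc m α).ext z =
      ∑ i, (((twist i).1 + (twist i).2 * z) * schwarz hα hα1 (w i) z) •
        (EuclideanSpace.single i 1 : Cn m) := by
    rw [ofBoundary_apply]
    change evalAt hz _ = _
    rw [map_sum]
    exact Finset.sum_congr rfl fun i _ => ext_component hα hα1 i (w i) hz
  rw [h1, sum_smul_single_apply]

theorem ofBoundary_coe (w : Fin (m + 1) → HolderSpace α ℝ) (z : Circle) (k : Fin (m + 1)) :
    (ofBoundary hα hα1 w : HolDisc m α) z k =
      ((twist k).1 + (twist k).2 * z) * schwarz hα hα1 (w k) z := by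
  rw [← ext_coe, ext_ofBoundary hα hα1 w z.coe_mem_cDisc]

theorem circleDeriv_ofBoundary (w : Fin (m + 1) → HolderSpace α ℝ) (z : Circle)
    (k : Fin (m + 1)) : circleDeriv (ofBoundary hα hα1 w : HolDisc m α) z k =
      Complex.I * z * ((twist k).2 * schwarz hα hα1 (w k) z +
        ((twist k).1 + (twist k).2 * z) * schwarzDeriv hα hα1 (w k) z) := by
  have h1 : circleDeriv (ofBoundary hα hα1 w : HolDisc m α) z =
      ∑ i, (Complex.I * z * ((twist i).2 * schwarz hα hα1 (w i) z +
        ((twist i).1 + (twist i).2 * z) * schwarzDeriv hα hα1 (w i) z)) •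
        (EuclideanSpace.single i 1 : Cn m) := by
    rw [ofBoundary_apply, ← angular_apply hα, map_sum]
    have h2 := map_sum (ContinuousMap.evalCLM ℝ z ∘L HolderSpace.toC)
      (fun i => angular hα (component hα hα1 i (w i) : HolDisc m α)) Finset.univ
    refine h2.trans (Finset.sum_congr rfl fun i _ => ?_)
    change circleDeriv (component hα hα1 i (w i)) z = _
    rw [circleDeriv_component, smul_smul]
  rw [h1, sum_smul_single_apply]

/-! ### The discs of the unperturbed family -/

theorem isHolderPrimitive_const (v : Cn m) :
    IsHolderPrimitive α (1 * ‖v‖) (fun _ => v) (fun _ => 0) where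
  nonneg := by positivity
  continuousOn := continuousOn_const
  hasDerivAt z _ := hasDerivAt_const z v
  holder x _ y _ := by rw [sub_self, norm_zero]; positivity
  norm_le _ _ := (one_mul _).ge
  norm_deriv_le _ _ := by rw [norm_zero]; positivity

/-- The constant discs. -/
noncomputable def constDisc : Cn m →L[ℝ] HolDisc m α :=
  primitiveCLM hα hα1 (fun v _ => v) (fun _ _ => 0) 1 isHolderPrimitive_const (fun _ _ _ => rfl)
    fun _ _ _ => rfl

theorem isHolderPrimitive_lin :
    IsHolderPrimitive α 1 (fun z => z • (EuclideanSpace.single 0 1 : Cn m))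
      (fun _ => EuclideanSpace.single 0 1) where
  nonneg := zero_le_one
  continuousOn := by fun_prop
  hasDerivAt z _ := by simpa using (hasDerivAt_id z).smul_const (EuclideanSpace.single 0 1 : Cn m)
  holder x _ y _ := by rw [sub_self, norm_zero]; positivity
  norm_le x hx := by rw [norm_smul]; simpa using hx
  norm_deriv_le _ _ := by simp

/-- The linear disc in the direction of the first coordinate. -/
noncomputable def linDisc : HolDisc m α :=
  ofPrimitive isHolderPrimitive_lin hα hα1

theorem ext_linDisc {z : ℂ} (hz : z ∈ cDisc) :
    (linDisc hα hα1 : HolDisc m α).ext z = z • EuclideanSpace.single 0 1 :=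
  ext_ofPrimitive isHolderPrimitive_lin hα hα1 hz

theorem ext_constDisc (v : Cn m) {z : ℂ} (hz : z ∈ cDisc) :
    (constDisc hα hα1 v : HolDisc m α).ext z = v :=
  ext_ofPrimitive (isHolderPrimitive_const v) hα hα1 hz

theorem circleDeriv_linDisc (z : Circle) :
    circleDeriv (linDisc hα hα1 : HolDisc m α) z =
      (Complex.I * z : ℂ) • EuclideanSpace.single 0 1 :=
  isHolderPrimitive_lin.circleDeriv_eq hα z

theorem circleDeriv_constDisc (v : Cn m) (z : Circle) :
    circleDeriv (constDisc hα hα1 v : HolDisc m α) z = 0 :=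
  deriv_const 0 v

/-- The inclusion of `ℝᵐ` as the last coordinates of `ℂᵐ⁺¹`. -/
noncomputable def inclReal (m : ℕ) : Rm m →L[ℝ] Cn m :=
  LinearMap.toContinuousLinearMap
    { toFun := fun t => WithLp.toLp 2 (Fin.cons 0 fun j => (t j : ℂ))
      map_add' := fun s t => by
        ext k
        refine Fin.cases ?_ (fun j => ?_) k <;> simp
      map_smul' := fun c t => by
        ext k
        refine Fin.cases ?_ (fun j => ?_) k <;> simp }

@[simp]
theorem inclReal_zero (t : Rm m) : inclReal m t 0 = 0 := rfl

@[simp]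
theorem inclReal_succ (t : Rm m) (j : Fin m) : inclReal m t j.succ = t j := rfl

/-- The disc `ξ ↦ (√(1 - ‖t‖²) ξ, t)`. -/
noncomputable def baseDisc (t : Rm m) : HolDisc m α :=
  √(1 - ‖t‖ ^ 2) • linDisc hα hα1 + constDisc hα hα1 (inclReal m t)

theorem ext_baseDisc (t : Rm m) {z : ℂ} (hz : z ∈ cDisc) :
    (baseDisc hα hα1 t).ext z = ((√(1 - ‖t‖ ^ 2) : ℝ) * z : ℂ) • EuclideanSpace.single 0 1 +
      inclReal m t := by
  have h1 := (evalAt (m := m) (α := α) hz).map_add (√(1 - ‖t‖ ^ 2) • linDisc hα hα1)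
    (constDisc hα hα1 (inclReal m t))
  rw [map_smul] at h1
  refine h1.trans ?_
  change _ • (linDisc hα hα1 : HolDisc m α).ext z + (constDisc hα hα1 (inclReal m t)).ext z = _
  rw [ext_linDisc hα hα1 hz, ext_constDisc hα hα1 _ hz, mul_smul]
  rfl

theorem circleDeriv_baseDisc (t : Rm m) (z : Circle) :
    circleDeriv (baseDisc hα hα1 t) z =
      ((√(1 - ‖t‖ ^ 2) : ℝ) * (Complex.I * z) : ℂ) • EuclideanSpace.single 0 1 := by
  have h1 := congrFun (circleDeriv_add (√(1 - ‖t‖ ^ 2) • linDisc hα hα1 : HolDisc m α).2.1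
    (constDisc hα hα1 (inclReal m t)).2.1) z
  have h2 := congrFun (circleDeriv_smul (√(1 - ‖t‖ ^ 2)) (linDisc hα hα1 : HolDisc m α).2.1) z
  refine h1.trans ?_
  rw [Pi.add_apply]
  refine (congrArg₂ (· + ·) h2 (circleDeriv_constDisc hα hα1 (inclReal m t) z)).trans ?_
  rw [add_zero, Pi.smul_apply, mul_smul]
  exact congrArg _ (circleDeriv_linDisc hα hα1 z)

theorem contDiffOn_baseDisc :
    ContDiffOn ℝ 1 (baseDisc hα hα1 : Rm m → HolDisc m α) (ball 0 1) := by
  refine ContDiffOn.add (ContDiffOn.smul (ContDiffOn.sqrt ?_ fun t ht => ?_) contDiffOn_const)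
    (((constDisc hα hα1).comp (inclReal m)).contDiff.contDiffOn)
  · exact (contDiff_const.sub (contDiff_norm_sq ℝ)).contDiffOn
  · have := mem_ball_zero_iff.1 ht
    have h0 := norm_nonneg t
    nlinarith

end HolDisc

/-! ### The perturbed loop `f + φ ∘ f` and its smooth dependence on `φ` and `f`. -/

section Superposed

open HolDisc

variable {m : ℕ} {r : ℝ} {α : ℝ≥0} (hα : 0 < α) (hα1 : α < 1)

/-- The pairs of a perturbation and a disc with boundary in the tube. -/
def tubeDiscs (m : ℕ) (r : ℝ) (α : ℝ≥0) : Set (Perturbation m r × HolDisc m α) :=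
  {q | toC q.2 ∈ mapsToSet Circle (tube m r)}

theorem isOpen_tubeDiscs : IsOpen (tubeDiscs m r α) :=
  (isOpen_mapsToSet (isOpen_tube m r)).preimage (by fun_prop : Continuous
    fun q : Perturbation m r × HolDisc m α => toC q.2)

theorem contDiffOn_superposition_disc {W : Type*} [NormedAddCommGroup W] [NormedSpace ℝ W]
    {A : Perturbation m r → Cn m → W} {C : ℝ} (h : IsBoundedC1Family A (tube m r) C) :
    ContDiffOn ℝ 1 (fun q : Perturbation m r × HolDisc m α =>
      superposition (tube m r) (A q.1) (toC q.2)) (tubeDiscs m r α) :=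
  (h.contDiffOn_superposition (X := Circle) (isOpen_tube m r)).comp
    (contDiff_fst.prodMk (toC.contDiff.comp contDiff_snd)).contDiffOn
    fun _ hq => ⟨mem_univ _, hq⟩

/-- The derivative of the perturbation along the boundary of the disc. -/
noncomputable def derivAlong (q : Perturbation m r × HolDisc m α) :
    HolderSpace α (Cn m →L[ℝ] Cn m) :=
  HolderSpace.ofDeriv hα hα1.le (superposition (tube m r) (fderiv ℝ q.1) (toC q.2),
    pointwiseApply (superposition (tube m r) (fderiv ℝ (fderiv ℝ q.1)) (toC q.2))
      (HolderSpace.toC (angular hα q.2)))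

/-- The angular derivative of `f + φ ∘ f`. -/
noncomputable def perturbedAngular (q : Perturbation m r × HolDisc m α) : HolderSpace α (Cn m) :=
  angular hα q.2 +
    HolderSpace.bilin hα (ContinuousLinearMap.id ℝ _) (derivAlong hα hα1 q) (angular hα q.2)

/-- The map `f + φ ∘ f` on the circle. -/
noncomputable def perturbedValue (q : Perturbation m r × HolDisc m α) : HolderSpace α (Cn m) :=
  HolderSpace.ofDeriv hα hα1.le (toC q.2 + superposition (tube m r) q.1 (toC q.2),
    HolderSpace.toC (perturbedAngular hα hα1 q))

/-- Since `ofDeriv` is bounded and linear, it suffices that `Dφ ∘ f` and `(D²φ ∘ f) f'` depend on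
`(φ, f)` in a `C¹` way in the sup norm. No composition in a Hölder norm has to be differentiated. -/
theorem contDiffOn_derivAlong : ContDiffOn ℝ 1
    (derivAlong hα hα1 : Perturbation m r × HolDisc m α → _) (tubeDiscs m r α) := by
  have h1 := contDiffOn_superposition_disc (α := α)
    (CkSpace.isBoundedC1Family_fderiv (k := 3) (F := Cn m) (isOpen_tube m r) (by norm_num))
  have h2 := contDiffOn_superposition_disc (α := α)
    (CkSpace.isBoundedC1Family_fderiv_fderiv (k := 3) (F := Cn m) (isOpen_tube m r) le_rfl)
  have h3 : ContDiff ℝ 1 fun q : Perturbation m r × HolDisc m α =>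
      HolderSpace.toC (angular hα q.2) := by fun_prop
  exact (HolderSpace.ofDeriv hα hα1.le).contDiff.comp_contDiffOn
    (h1.prodMk ((pointwiseApply.contDiff.comp_contDiffOn h2).clm_apply h3.contDiffOn))

theorem contDiffOn_perturbedAngular : ContDiffOn ℝ 1
    (perturbedAngular hα hα1 : Perturbation m r × HolDisc m α → _) (tubeDiscs m r α) := by
  have h3 : ContDiff ℝ 1 fun q : Perturbation m r × HolDisc m α => angular hα q.2 := by fun_prop
  exact h3.contDiffOn.add (((HolderSpace.bilin hα (ContinuousLinearMap.id ℝ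
    (Cn m →L[ℝ] Cn m))).contDiff.comp_contDiffOn (contDiffOn_derivAlong hα hα1)).clm_apply
      h3.contDiffOn)

theorem contDiffOn_perturbedValue : ContDiffOn ℝ 1
    (perturbedValue hα hα1 : Perturbation m r × HolDisc m α → _) (tubeDiscs m r α) := by
  have h1 := contDiffOn_superposition_disc (α := α)
    (CkSpace.isBoundedC1Family_coe (k := 3) (F := Cn m) (isOpen_tube m r) (by norm_num))
  have h3 : ContDiff ℝ 1 fun q : Perturbation m r × HolDisc m α => toC q.2 := by fun_prop
  exact (HolderSpace.ofDeriv hα hα1.le).contDiff.comp_contDiffOn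
    ((h3.contDiffOn.add h1).prodMk (HolderSpace.toC.contDiff.comp_contDiffOn
      (contDiffOn_perturbedAngular hα hα1)))

variable {q : Perturbation m r × HolDisc m α} (hq : q ∈ tubeDiscs m r α)

include hq

/-- By the chain rule the second entry in `derivAlong` is the angular derivative of the first, so
integrating it recovers the first. -/
theorem derivAlong_apply (z : Circle) : derivAlong hα hα1 q z = fderiv ℝ q.1 (q.2 z) := by
  have hc1 := q.1.contDiffOn_fderiv (isOpen_tube m r) (j := 1) (by norm_num)
  have hc2 := q.1.contDiffOn_fderiv_fderiv (isOpen_tube m r) (j := 1) (by norm_num)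
  refine (HolderSpace.ofDeriv_eq hα hα1.le (fun θ => ?_) z).trans
    (superposition_apply hc1.continuousOn hq z)
  simp only [superposition_apply hc1.continuousOn hq, pointwiseApply_apply,
    superposition_apply hc2.continuousOn hq]
  have hd : DifferentiableAt ℝ (fderiv ℝ q.1) (q.2 (Circle.exp θ)) :=
    (hc1.differentiableOn one_ne_zero).differentiableAt
      ((isOpen_tube m r).mem_nhds (hq (mem_univ _)))
  exact hd.hasFDerivAt.comp_hasDerivAt θ (q.2.hasDerivAt_circle θ)

theorem perturbedAngular_apply (z : Circle) :
    perturbedAngular hα hα1 q z = circleDeriv q.2 z + fderiv ℝ q.1 (q.2 z) (circleDeriv q.2 z) := by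
  rw [← derivAlong_apply hα hα1 hq]
  rfl

theorem hasDerivAt_perturbed (θ : ℝ) :
    HasDerivAt (fun θ : ℝ => q.2 (Circle.exp θ) + q.1 (q.2 (Circle.exp θ)))
      (perturbedAngular hα hα1 q (Circle.exp θ)) θ := by
  rw [perturbedAngular_apply hα hα1 hq]
  have hd : DifferentiableAt ℝ q.1 (q.2 (Circle.exp θ)) :=
    (q.1.2.2.1.differentiableOn (by norm_num)).differentiableAt
      ((isOpen_tube m r).mem_nhds (hq (mem_univ _)))
  exact (q.2.hasDerivAt_circle θ).add (hd.hasFDerivAt.comp_hasDerivAt θ (q.2.hasDerivAt_circle θ))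

theorem perturbedValue_apply (z : Circle) : perturbedValue hα hα1 q z = q.2 z + q.1 (q.2 z) := by
  have hc : ContinuousOn q.1 (tube m r) := q.1.2.2.1.continuousOn
  refine (HolderSpace.ofDeriv_eq hα hα1.le (fun θ => ?_) z).trans ?_
  · simp only [ContinuousMap.add_apply, superposition_apply hc hq]
    exact hasDerivAt_perturbed hα hα1 hq θ
  · rw [ContinuousMap.add_apply, superposition_apply hc hq]
    rfl

end Superposed

/-! ### The defining functions of the sphere along a loop. -/

section Defect

variable {m : ℕ} {α : ℝ≥0} (hα : 0 < α)

/-- The real inner product of `ℂᵐ⁺¹`. -/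
noncomputable def realDot (m : ℕ) : Cn m →L[ℝ] Cn m →L[ℝ] ℝ :=
  ∑ k, (innerSL ℝ (E := ℂ)).bilinearComp ((EuclideanSpace.proj k : Cn m →L[ℂ] ℂ).restrictScalars ℝ)
    ((EuclideanSpace.proj k : Cn m →L[ℂ] ℂ).restrictScalars ℝ)

theorem realDot_apply (z w : Cn m) : realDot m z w = ∑ k, inner ℝ (z k) (w k) := by
  simp [realDot]

theorem realDot_self (z : Cn m) : realDot m z z = ‖z‖ ^ 2 := by
  rw [realDot_apply, EuclideanSpace.norm_sq_eq]
  exact Finset.sum_congr rfl fun k _ => real_inner_self_eq_norm_sq _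

/-- The imaginary part of a coordinate. -/
noncomputable def imCoord (k : Fin (m + 1)) : Cn m →L[ℝ] ℝ :=
  Complex.imCLM ∘L (EuclideanSpace.proj k : Cn m →L[ℂ] ℂ).restrictScalars ℝ

/-- The mean of a Hölder function, as a constant Hölder function. -/
noncomputable def meanCLM : HolderSpace α ℝ →L[ℝ] HolderSpace α ℝ :=
  HolderSpace.const hα ∘L circleMean ∘L HolderSpace.toC

/-- The derivatives plus the means of the defining functions of the sphere, for a loop with given
value and derivative. -/
noncomputable def defect (p : HolderSpace α (Cn m) × HolderSpace α (Cn m)) :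
    Fin (m + 1) → HolderSpace α ℝ :=
  Fin.cases
    ((2 : ℝ) • HolderSpace.bilin hα (realDot m) p.1 p.2 +
      (meanCLM hα (HolderSpace.bilin hα (realDot m) p.1 p.1) - HolderSpace.const hα 1))
    fun j => HolderSpace.map hα (imCoord j.succ) p.2 +
      meanCLM hα (HolderSpace.map hα (imCoord j.succ) p.1)

theorem defect_zero_apply (p : HolderSpace α (Cn m) × HolderSpace α (Cn m)) (z : Circle) :
    defect hα p 0 z = 2 * realDot m (p.1 z) (p.2 z) +
      (circleMean (HolderSpace.toC (HolderSpace.bilin hα (realDot m) p.1 p.1)) - 1) := rfl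

theorem defect_succ_apply (p : HolderSpace α (Cn m) × HolderSpace α (Cn m)) (j : Fin m)
    (z : Circle) : defect hα p j.succ z = (p.2 z j.succ).im +
      circleMean (HolderSpace.toC (HolderSpace.map hα (imCoord j.succ) p.1)) := rfl

theorem contDiff_defect : ContDiff ℝ 1 (defect (m := m) hα) := by
  refine contDiff_pi.2 fun k => Fin.cases ?_ (fun j => ?_) k
  · change ContDiff ℝ 1 fun p : HolderSpace α (Cn m) × HolderSpace α (Cn m) =>
      (2 : ℝ) • HolderSpace.bilin hα (realDot m) p.1 p.2 +
      (meanCLM hα (HolderSpace.bilin hα (realDot m) p.1 p.1) - HolderSpace.const hα 1)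
    fun_prop
  · change ContDiff ℝ 1 fun p : HolderSpace α (Cn m) × HolderSpace α (Cn m) =>
      HolderSpace.map hα (imCoord j.succ) p.2 +
      meanCLM hα (HolderSpace.map hα (imCoord j.succ) p.1)
    fun_prop

theorem circleMean_const {V : Type*} [NormedAddCommGroup V] [NormedSpace ℝ V] [CompleteSpace V]
    {v : C(Circle, V)} {c : V} (h : ∀ z, v z = c) : circleMean v = c := by
  rw [circleMean_apply]
  simp only [h, intervalIntegral.integral_const, sub_zero]
  rw [smul_smul, inv_mul_cancel₀ Real.two_pi_pos.ne', one_smul]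

/-- A function on the circle whose derivative is minus its mean vanishes. -/
theorem eq_zero_of_hasDerivAt_add_mean {u v : C(Circle, ℝ)}
    (h : ∀ θ : ℝ, HasDerivAt (fun θ : ℝ => u (Circle.exp θ)) (v (Circle.exp θ)) θ)
    (h0 : ∀ z, v z + circleMean u = 0) (z : Circle) : u z = 0 := by
  -- By hypothesis `v` is constant, equal to minus the mean of `u`. As an angular derivative it has
  -- mean zero, so it vanishes; hence `u` is constant, with mean zero.
  have h1 : circleMean v = -circleMean u :=
    circleMean_const fun z => eq_neg_of_add_eq_zero_left (h0 z)
  rw [circleMean_eq_zero_of_hasDerivAt h, eq_comm, neg_eq_zero] at h1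
  have h2 : ∀ θ : ℝ, HasDerivAt (fun θ : ℝ => u (Circle.exp θ)) 0 θ := fun θ => by
    have := h θ
    rwa [show v (Circle.exp θ) = 0 by simpa [h1] using h0 (Circle.exp θ)] at this
  have h3 : ∀ w, u w = u 1 := fun w => by
    have := is_const_of_deriv_eq_zero (fun θ => (h2 θ).differentiableAt) (fun θ => (h2 θ).deriv)
      (Complex.arg w) 0
    simpa using this
  rw [h3 z, ← circleMean_const h3, h1]

/-- A loop whose defect vanishes lies on the sphere. -/
theorem mem_realSphere_of_defect_eq_zero {p : HolderSpace α (Cn m) × HolderSpace α (Cn m)}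
    (hp : ∀ θ : ℝ, HasDerivAt (fun θ : ℝ => p.1 (Circle.exp θ)) (p.2 (Circle.exp θ)) θ)
    (h0 : defect hα p = 0) (z : Circle) : p.1 z ∈ realSphere m := by
  have h1 : ∀ k w, defect hα p k w = 0 := fun k w => by rw [h0]; rfl
  constructor
  · have h2 : HolderSpace.bilin hα (realDot m) p.1 p.1 z - 1 = 0 := by
      refine eq_zero_of_hasDerivAt_add_mean
        (u := HolderSpace.toC (HolderSpace.bilin hα (realDot m) p.1 p.1) - 1)
        (v := HolderSpace.toC ((2 : ℝ) • HolderSpace.bilin hα (realDot m) p.1 p.2)) (fun θ => ?_)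
        (fun w => ?_) z
      · have h3 := (((realDot m).hasFDerivAt.comp_hasDerivAt θ (hp θ)).clm_apply (hp θ)).sub_const 1
        refine h3.congr_deriv ?_
        change _ = 2 * realDot m (p.1 (Circle.exp θ)) (p.2 (Circle.exp θ))
        rw [two_mul]
        congr 1
        rw [realDot_apply, realDot_apply]
        exact Finset.sum_congr rfl fun k _ => real_inner_comm _ _
      · rw [map_sub, circleMean_const (v := (1 : C(Circle, ℝ))) (c := 1) fun _ => rfl]
        exact h1 0 w
    rw [HolderSpace.bilin_apply, realDot_self, sub_eq_zero] at h2
    exact (pow_eq_one_iff_of_nonneg (norm_nonneg _) two_ne_zero).1 h2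
  · intro j
    refine eq_zero_of_hasDerivAt_add_mean
      (u := HolderSpace.toC (HolderSpace.map hα (imCoord j.succ) p.1))
      (v := HolderSpace.toC (HolderSpace.map hα (imCoord j.succ) p.2)) (fun θ => ?_)
      (fun w => h1 j.succ w) z
    exact (imCoord j.succ).hasFDerivAt.comp_hasDerivAt θ (hp θ)

end Defect

/-! ### The standard discs are attached to the sphere. -/

namespace HolDisc

variable {m : ℕ} {α : ℝ≥0} (hα : 0 < α) (hα1 : α < 1)

theorem norm_sq_add_norm_sq {t : Rm m} (ht : t ∈ ball (0 : Rm m) 1) :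
    √(1 - ‖t‖ ^ 2) ^ 2 + ‖t‖ ^ 2 = 1 := by
  have h1 := mem_ball_zero_iff.1 ht
  have h0 := norm_nonneg t
  rw [Real.sq_sqrt (by nlinarith)]
  ring

theorem sqrt_one_sub_pos {t : Rm m} (ht : t ∈ ball (0 : Rm m) 1) : 0 < √(1 - ‖t‖ ^ 2) := by
  have h1 := mem_ball_zero_iff.1 ht
  have h0 := norm_nonneg t
  exact Real.sqrt_pos.2 (by nlinarith)

theorem ext_baseDisc_zero (t : Rm m) {z : ℂ} (hz : z ∈ cDisc) :
    (baseDisc hα hα1 t).ext z 0 = (√(1 - ‖t‖ ^ 2) : ℝ) * z := by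
  rw [ext_baseDisc hα hα1 t hz]
  simp

theorem ext_baseDisc_succ (t : Rm m) {z : ℂ} (hz : z ∈ cDisc) (j : Fin m) :
    (baseDisc hα hα1 t).ext z j.succ = t j := by
  rw [ext_baseDisc hα hα1 t hz]
  simp

theorem baseDisc_zero (t : Rm m) (z : Circle) :
    baseDisc hα hα1 t z 0 = (√(1 - ‖t‖ ^ 2) : ℝ) * z := by
  rw [← ext_coe, ext_baseDisc_zero hα hα1 t z.coe_mem_cDisc]

theorem baseDisc_succ (t : Rm m) (z : Circle) (j : Fin m) : baseDisc hα hα1 t z j.succ = t j := by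
  rw [← ext_coe, ext_baseDisc_succ hα hα1 t z.coe_mem_cDisc]

theorem circleDeriv_baseDisc_zero (t : Rm m) (z : Circle) :
    circleDeriv (baseDisc hα hα1 t) z 0 = (√(1 - ‖t‖ ^ 2) : ℝ) * (Complex.I * z) := by
  rw [circleDeriv_baseDisc]
  simp

theorem circleDeriv_baseDisc_succ (t : Rm m) (z : Circle) (j : Fin m) :
    circleDeriv (baseDisc hα hα1 t) z j.succ = 0 := by
  rw [circleDeriv_baseDisc]
  simp

theorem realDot_baseDisc {t : Rm m} (ht : t ∈ ball (0 : Rm m) 1) (z : Circle) :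
    realDot m (baseDisc hα hα1 t z) (baseDisc hα hα1 t z) = 1 := by
  refine Eq.trans ?_ (norm_sq_add_norm_sq ht)
  rw [realDot_apply, Fin.sum_univ_succ, baseDisc_zero,
    real_inner_self_eq_norm_sq, norm_mul, Circle.norm_coe, mul_one, Complex.norm_real,
    Real.norm_of_nonneg (Real.sqrt_nonneg _), EuclideanSpace.norm_sq_eq t]
  refine congrArg (_ + ·) (Finset.sum_congr rfl fun j _ => ?_)
  rw [baseDisc_succ, real_inner_self_eq_norm_sq, Complex.norm_real]

theorem realDot_baseDisc_circleDeriv (t : Rm m) (z : Circle) :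
    realDot m (baseDisc hα hα1 t z) (circleDeriv (baseDisc hα hα1 t) z) = 0 := by
  rw [realDot_apply, Fin.sum_univ_succ, baseDisc_zero, circleDeriv_baseDisc_zero]
  simp only [circleDeriv_baseDisc_succ, inner_zero_right, Finset.sum_const_zero, add_zero]
  simp [Complex.inner]
  ring

theorem baseDisc_mem_realSphere {t : Rm m} (ht : t ∈ ball (0 : Rm m) 1) (z : Circle) :
    baseDisc hα hα1 t z ∈ realSphere m := by
  refine ⟨?_, fun j => ?_⟩
  · have := realDot_baseDisc hα hα1 ht z
    rw [realDot_self] at this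
    exact (pow_eq_one_iff_of_nonneg (norm_nonneg _) two_ne_zero).1 this
  · rw [baseDisc_succ, Complex.ofReal_im]

theorem realSphere_subset_tube {r : ℝ} (hr : 0 < r) : realSphere m ⊆ tube m r := fun z hz => by
  change infDist z (realSphere m) < r
  rwa [infDist_zero_of_mem hz]

/-- The boundary values of a disc, as a Hölder function. -/
noncomputable def holderValue : HolDisc m α →L[ℝ] HolderSpace α (Cn m) :=
  HolderSpace.ofDeriv hα hα1.le ∘L (toC.prod (HolderSpace.toC ∘L angular hα))

theorem holderValue_apply (f : HolDisc m α) (z : Circle) : holderValue hα hα1 f z = f z :=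
  HolderSpace.ofDeriv_eq hα hα1.le (fun θ => f.hasDerivAt_circle θ) z

end HolDisc

/-! ### Linearization of the defect at a standard disc. -/

section DefectDeriv

variable {m : ℕ} {α : ℝ≥0} (hα : 0 < α)

/-- The directional derivative of the defect. -/
noncomputable def defectDeriv (a e : HolderSpace α (Cn m) × HolderSpace α (Cn m)) :
    Fin (m + 1) → HolderSpace α ℝ :=
  Fin.cases
    ((2 : ℝ) • (HolderSpace.bilin hα (realDot m) a.1 e.2 + HolderSpace.bilin hα (realDot m) e.1 a.2) +
      meanCLM hα (HolderSpace.bilin hα (realDot m) a.1 e.1 +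
        HolderSpace.bilin hα (realDot m) e.1 a.1))
    fun j => HolderSpace.map hα (imCoord j.succ) e.2 +
      meanCLM hα (HolderSpace.map hα (imCoord j.succ) e.1)

theorem hasDerivAt_bilin_line {U V W : Type*} [NormedAddCommGroup U] [NormedSpace ℝ U]
    [NormedAddCommGroup V] [NormedSpace ℝ V] [NormedAddCommGroup W] [NormedSpace ℝ W]
    (B : U →L[ℝ] V →L[ℝ] W) (a e : U) (b f : V) :
    HasDerivAt (fun ε : ℝ => B (a + ε • e) (b + ε • f)) (B a f + B e b) 0 := by
  have h1 : HasDerivAt (fun ε : ℝ => a + ε • e) e 0 := by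
    simpa using ((hasDerivAt_id (0 : ℝ)).smul_const e).const_add a
  have h2 : HasDerivAt (fun ε : ℝ => b + ε • f) f 0 := by
    simpa using ((hasDerivAt_id (0 : ℝ)).smul_const f).const_add b
  refine ((B.hasFDerivAt.comp_hasDerivAt (0 : ℝ) h1).clm_apply h2).congr_deriv ?_
  simp [add_comm]

theorem hasDerivAt_defect_line (a e : HolderSpace α (Cn m) × HolderSpace α (Cn m)) :
    HasDerivAt (fun ε : ℝ => defect hα (a + ε • e)) (defectDeriv hα a e) 0 := by
  have hl : ∀ (L : HolderSpace α (Cn m) →L[ℝ] HolderSpace α ℝ) (b f : HolderSpace α (Cn m)),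
      HasDerivAt (fun ε : ℝ => L (b + ε • f)) (L f) 0 := fun L b f => by
    have h2 : HasDerivAt (fun ε : ℝ => b + ε • f) f 0 := by
      simpa using ((hasDerivAt_id (0 : ℝ)).smul_const f).const_add b
    exact L.hasFDerivAt.comp_hasDerivAt (0 : ℝ) h2
  refine hasDerivAt_pi.2 fun k => Fin.cases ?_ (fun j => ?_) k
  · exact ((hasDerivAt_bilin_line _ a.1 e.1 a.2 e.2).const_smul (2 : ℝ)).add
      (((meanCLM hα).hasFDerivAt.comp_hasDerivAt (0 : ℝ)
        (hasDerivAt_bilin_line _ a.1 e.1 a.1 e.1)).sub_const _)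
  · exact (hl _ a.2 e.2).add ((meanCLM hα).hasFDerivAt.comp_hasDerivAt (0 : ℝ) (hl _ a.1 e.1))

end DefectDeriv

namespace HolderSpace

variable {α : ℝ≥0} (hα : 0 < α) (hα1 : α < 1)

theorem schwarz_zero {z : ℂ} (hz : z ∈ cDisc) : schwarz hα hα1 0 z = 0 := by
  have := (isHolderPrimitive_schwarz hα hα1 0).norm_le z hz
  rwa [norm_zero, mul_zero, norm_le_zero_iff] at this

theorem schwarzDeriv_zero {z : ℂ} (hz : z ∈ cDisc) : schwarzDeriv hα hα1 0 z = 0 := by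
  have := (isHolderPrimitive_schwarz hα hα1 0).norm_deriv_le z hz
  rwa [norm_zero, mul_zero, norm_le_zero_iff] at this

/-- The mean value property of the Schwarz primitive. -/
theorem circleMean_re_schwarz (u : HolderSpace α ℝ) {v : C(Circle, ℝ)}
    (hv : ∀ z : Circle, v z = (schwarz hα hα1 u z).re) : circleMean v = circleMean (toC u) := by
  have H := isHolderPrimitive_schwarz hα hα1 u
  have hd : DiffContOnCl ℂ (schwarz hα hα1 u) (ball 0 |1|) := by
    rw [abs_one]
    refine ⟨fun z hz => (H.hasDerivAt z hz).differentiableAt.differentiableWithinAt, ?_⟩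
    rw [closure_ball_eq_cDisc]
    exact H.continuousOn
  have h1 := hd.circleAverage
  have h2 := Complex.reCLM.circleAverage_comp_comm
    ((H.continuousOn.mono sphere_subset_closedBall).circleIntegrable (zero_le_one' ℝ))
  rw [h1, schwarz_zero_eq] at h2
  refine Eq.trans ?_ (h2.trans (Complex.ofReal_re _))
  rw [Real.circleAverage, circleMean_apply]
  congr 2
  funext θ
  have : circleMap 0 1 θ = (Circle.exp θ : ℂ) := by simp [circleMap]
  rw [hv, ← this]
  rfl

end HolderSpace

section Linearization

open HolDisc HolderSpace

variable {m : ℕ} {r : ℝ} {α : ℝ≥0} (hα : 0 < α) (hα1 : α < 1)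

/-- The pair of the value and the angular derivative. -/
noncomputable def jet : HolDisc m α →L[ℝ] HolderSpace α (Cn m) × HolderSpace α (Cn m) :=
  (holderValue hα hα1).prod (angular hα)

theorem defect_jet_baseDisc {t : Rm m} (ht : t ∈ ball (0 : Rm m) 1) :
    defect hα (jet hα hα1 (baseDisc hα hα1 t)) = 0 := by
  funext k
  refine Fin.cases ?_ (fun j => ?_) k
  · refine HolderSpace.ext fun z => ?_
    rw [defect_zero_apply, circleMean_const (c := 1) fun z => ?_]
    · change 2 * realDot m (holderValue hα hα1 _ z) (circleDeriv (baseDisc hα hα1 t) z) + _ = 0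
      rw [holderValue_apply, realDot_baseDisc_circleDeriv]
      norm_num
    · change realDot m (holderValue hα hα1 _ z) (holderValue hα hα1 _ z) = 1
      rw [holderValue_apply, realDot_baseDisc hα hα1 ht]
  · refine HolderSpace.ext fun z => ?_
    rw [defect_succ_apply, circleMean_const (c := 0) fun z => ?_]
    · change (circleDeriv (baseDisc hα hα1 t) z j.succ).im + 0 = 0
      rw [circleDeriv_baseDisc_succ, Complex.zero_im, add_zero]
    · change (holderValue hα hα1 (baseDisc hα hα1 t) z j.succ).im = 0
      rw [holderValue_apply, baseDisc_succ, Complex.ofReal_im]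

/-- The imaginary part of `i S(w_j)` is `Re S(w_j)`. Its angular derivative is `w_j` minus the mean
of `w_j`, and its mean is the value of `S(w_j)` at the centre, which is the mean of `w_j`; the sum
is `w_j`. -/
theorem defectDeriv_succ (t : Rm m) (w : Fin (m + 1) → HolderSpace α ℝ) (j : Fin m) :
    defectDeriv hα (jet hα hα1 (baseDisc hα hα1 t)) (jet hα hα1 (ofBoundary hα hα1 w)) j.succ =
      w j.succ := by
  refine HolderSpace.ext fun z => ?_
  change (circleDeriv (ofBoundary hα hα1 w : HolDisc m α) z j.succ).im +
    circleMean (toC (HolderSpace.map hα (imCoord j.succ) (holderValue hα hα1 _))) = _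
  rw [circleMean_re_schwarz hα hα1 (w j.succ) fun z => ?_]
  · have h1 := re_mul_schwarzDeriv hα hα1 (w j.succ) z
    rw [circleDeriv_ofBoundary, ← eq_sub_iff_add_eq, ← h1]
    simp [Complex.mul_re, Complex.mul_im]
    try ring
  · change (holderValue hα hα1 (ofBoundary hα hα1 w : HolDisc m α) z j.succ).im = _
    rw [holderValue_apply, ofBoundary_coe]
    simp

/-- With `s = √(1 - ‖t‖²)` the first components are `s z` and `z S(w_0)`, and `|z| = 1`, so `‖·‖²`
has first variation `2 s Re S(w_0)`; its angular derivative plus its mean is `2 s w_0`. Assuming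
that the other entries vanish is enough, because the linearization is only used as a triangular
operator. -/
theorem defectDeriv_zero {t : Rm m} {w : Fin (m + 1) → HolderSpace α ℝ}
    (hw : ∀ j : Fin m, w j.succ = 0) :
    defectDeriv hα (jet hα hα1 (baseDisc hα hα1 t)) (jet hα hα1 (ofBoundary hα hα1 w)) 0 =
      (2 * √(1 - ‖t‖ ^ 2)) • w 0 := by
  set s := √(1 - ‖t‖ ^ 2) with hs
  have hz : ∀ z : Circle, (z : ℂ).re * (z : ℂ).re + (z : ℂ).im * (z : ℂ).im = 1 := fun z => by
    rw [← Complex.normSq_apply, Circle.normSq_coe]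
  have h1 : ∀ (z : Circle) (v : Cn m),
      realDot m v (ofBoundary hα hα1 w z) = inner ℝ (v 0) (z * schwarz hα hα1 (w 0) z) := by
    intro z v
    rw [realDot_apply, Fin.sum_univ_succ]
    simp [ofBoundary_coe, hw, schwarz_zero hα hα1 z.coe_mem_cDisc]
  have h1' : ∀ (z : Circle) (v : Cn m),
      realDot m (ofBoundary hα hα1 w z) v = inner ℝ (z * schwarz hα hα1 (w 0) z) (v 0) := by
    intro z v
    rw [realDot_apply, Fin.sum_univ_succ]
    simp [ofBoundary_coe, hw, schwarz_zero hα hα1 z.coe_mem_cDisc]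
  have h2 : ∀ (z : Circle) (v : Cn m), realDot m v (circleDeriv (ofBoundary hα hα1 w) z) =
      inner ℝ (v 0) (Complex.I * z * (schwarz hα hα1 (w 0) z + z * schwarzDeriv hα hα1 (w 0) z)) := by
    intro z v
    rw [realDot_apply, Fin.sum_univ_succ]
    simp [circleDeriv_ofBoundary, hw, schwarz_zero hα hα1 z.coe_mem_cDisc,
      schwarzDeriv_zero hα hα1 z.coe_mem_cDisc]
  have h3 : circleMean (toC (HolderSpace.bilin hα (realDot m)
      (holderValue hα hα1 (baseDisc hα hα1 t)) (holderValue hα hα1 (ofBoundary hα hα1 w)) +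
      HolderSpace.bilin hα (realDot m) (holderValue hα hα1 (ofBoundary hα hα1 w))
        (holderValue hα hα1 (baseDisc hα hα1 t)))) = 2 * s * circleMean (toC (w 0)) := by
    have e : toC (HolderSpace.bilin hα (realDot m)
      (holderValue hα hα1 (baseDisc hα hα1 t)) (holderValue hα hα1 (ofBoundary hα hα1 w)) +
      HolderSpace.bilin hα (realDot m) (holderValue hα hα1 (ofBoundary hα hα1 w))
        (holderValue hα hα1 (baseDisc hα hα1 t))) = (2 * s) •
        (⟨fun z => (schwarz hα hα1 (w 0) z).re, Complex.continuous_re.comp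
          ((isHolderPrimitive_schwarz hα hα1 (w 0)).continuousOn.comp_continuous (by fun_prop)
            fun z : Circle => z.coe_mem_cDisc)⟩ : C(Circle, ℝ)) := by
      ext z
      change realDot m (holderValue hα hα1 _ z) (holderValue hα hα1 _ z) +
        realDot m (holderValue hα hα1 _ z) (holderValue hα hα1 _ z) =
        2 * s * (schwarz hα hα1 (w 0) z).re
      rw [holderValue_apply, holderValue_apply, h1, h1', baseDisc_zero]
      simp only [Complex.inner, map_mul, Complex.conj_ofReal, Complex.mul_re, Complex.mul_im,
        Complex.conj_re, Complex.conj_im, Complex.ofReal_re, Complex.ofReal_im]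
      linear_combination 2 * s * (schwarz hα hα1 (w 0) z).re * hz z
    rw [e, map_smul, circleMean_re_schwarz hα hα1 (w 0) fun _ => rfl, smul_eq_mul]
  refine HolderSpace.ext fun z => ?_
  change 2 * (realDot m (holderValue hα hα1 _ z) (circleDeriv (ofBoundary hα hα1 w) z) +
    realDot m (holderValue hα hα1 _ z) (circleDeriv (baseDisc hα hα1 t) z)) + circleMean (HolderSpace.toC _) =
    2 * s * w 0 z
  refine (congrArg (fun x => 2 * (realDot m (holderValue hα hα1 (baseDisc hα hα1 t) z)
    (circleDeriv (ofBoundary hα hα1 w) z) + realDot m (holderValue hα hα1 (ofBoundary hα hα1 w) z)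
      (circleDeriv (baseDisc hα hα1 t) z)) + x) h3).trans ?_
  rw [holderValue_apply, holderValue_apply, h2, h1', baseDisc_zero, circleDeriv_baseDisc_zero,
    ← hs]
  have h4 := re_mul_schwarzDeriv hα hα1 (w 0) z
  set p := schwarzDeriv hα hα1 (w 0) z
  simp only [Complex.mul_re, Complex.mul_im, Complex.I_re, Complex.I_im] at h4
  simp only [Complex.inner, map_mul, Complex.conj_ofReal, Complex.mul_re, Complex.mul_im,
    Complex.conj_re, Complex.conj_im, Complex.ofReal_re, Complex.ofReal_im, Complex.I_re,
    Complex.I_im, Complex.add_re, Complex.add_im]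
  linear_combination -2 * s * ((z : ℂ).re * p.im + (z : ℂ).im * p.re) * hz z + 2 * s * h4

end Linearization

/-! ### Gluing of local solutions -/

/-- Two local solutions agree on the overlap of their domains. The overlap is convex, hence
connected. By local uniqueness agreement is equivalent to the graph of one solution lying in the
open set `O` of the other, so it is an open condition; disagreement is open by continuity. Both
solutions vanish where the second parameter is `0`. -/
theorem exists_contDiffOn_of_local {T Φ W : Type*} [NormedAddCommGroup T] [NormedSpace ℝ T]
    [NormedAddCommGroup Φ] [NormedSpace ℝ Φ] [NormedAddCommGroup W] [NormedSpace ℝ W]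
    {D : Set T} {Good : T × Φ → W → Prop}
    (hloc : ∀ t : D, ∃ ρ > 0, ∃ (g : T × Φ → W) (O : Set ((T × Φ) × W)), IsOpen O ∧
      ∀ p ∈ ball (t : T) ρ ×ˢ ball (0 : Φ) ρ, p.1 ∈ D ∧ g (p.1, 0) = 0 ∧ ContDiffAt ℝ 1 g p ∧
        Good p (g p) ∧ (p, g p) ∈ O ∧ ∀ w, (p, w) ∈ O → Good p w → w = g p) :
    ∃ (Ω : Set (T × Φ)) (g : T × Φ → W), IsOpen Ω ∧ Ω ⊆ D ×ˢ univ ∧ D ×ˢ {0} ⊆ Ω ∧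
      ContDiffOn ℝ 1 g Ω ∧ (∀ t ∈ D, g (t, 0) = 0) ∧ ∀ p ∈ Ω, Good p (g p) := by
  classical
  choose ρ hρ g O hO h using hloc
  set B : D → Set (T × Φ) := fun t => ball (t : T) (ρ t) ×ˢ ball (0 : Φ) (ρ t) with hB
  have hBo : ∀ t, IsOpen (B t) := fun t => isOpen_ball.prod isOpen_ball
  have hmem : ∀ t, ((t : T), (0 : Φ)) ∈ B t := fun t =>
    ⟨mem_ball_self (hρ t), mem_ball_self (hρ t)⟩
  have hg : ∀ t, ∀ p ∈ B t, ContinuousAt (g t) p := fun t p hp => (h t p hp).2.2.1.continuousAt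
  have hagree : ∀ t t', EqOn (g t) (g t') (B t ∩ B t') := by
    intro t t' p hp
    set C := B t ∩ B t' with hC
    have hCo : IsOpen C := (hBo t).inter (hBo t')
    have hCc : IsPreconnected C := (((convex_ball (t : T) (ρ t)).prod (convex_ball _ _)).inter
      ((convex_ball (t' : T) (ρ t')).prod (convex_ball _ _))).isPreconnected
    have hc1 : ContinuousOn (g t) C := fun q hq => (hg t q hq.1).continuousWithinAt
    have hc2 : ContinuousOn (g t') C := fun q hq => (hg t' q hq.2).continuousWithinAt
    have hu : IsOpen (C ∩ (fun q => (q, g t' q)) ⁻¹' O t) :=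
      (continuousOn_id.prodMk hc2).isOpen_inter_preimage hCo (hO t)
    have hv : IsOpen (C ∩ (fun q => g t q - g t' q) ⁻¹' {0}ᶜ) :=
      (hc1.sub hc2).isOpen_inter_preimage hCo isOpen_compl_singleton
    have hu' : ∀ q ∈ C, (q, g t' q) ∈ O t ↔ g t q = g t' q := fun q hq =>
      ⟨fun hqO => ((h t q hq.1).2.2.2.2.2 _ hqO (h t' q hq.2).2.2.2.1).symm,
        fun he => he ▸ (h t q hq.1).2.2.2.2.1⟩
    refine (hu' p hp).1 (hCc.subset_left_of_subset_union hu hv ?_ ?_ ?_ hp).2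
    · refine Set.disjoint_left.2 fun q hq hq' => hq'.2 ?_
      exact sub_eq_zero.2 ((hu' q hq.1).1 hq.2)
    · intro q hq
      by_cases he : g t q = g t' q
      · exact Or.inl ⟨hq, (hu' q hq).2 he⟩
      · exact Or.inr ⟨hq, fun h0 => he (sub_eq_zero.1 h0)⟩
    -- The second factors of both domains are centred at `0`, so a point of the overlap can be moved
    -- to second coordinate `0` without leaving it.
    · have h0 : (p.1, (0 : Φ)) ∈ C :=
        ⟨⟨hp.1.1, mem_ball_self (hρ t)⟩, ⟨hp.2.1, mem_ball_self (hρ t')⟩⟩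
      refine ⟨_, h0, h0, (hu' _ h0).2 ?_⟩
      rw [(h t _ h0.1).2.1, (h t' _ h0.2).2.1]
  set G : T × Φ → W := fun p => if hp : ∃ t, p ∈ B t then g hp.choose p else 0 with hG
  have hGg : ∀ t, EqOn G (g t) (B t) := fun t p hp => by
    have hex : ∃ t, p ∈ B t := ⟨t, hp⟩
    simp only [hG, dif_pos hex]
    exact hagree _ _ ⟨hex.choose_spec, hp⟩
  refine ⟨⋃ t, B t, G, isOpen_iUnion hBo, ?_, ?_, ?_, ?_, ?_⟩
  · exact iUnion_subset fun t p hp => ⟨(h t p hp).1, mem_univ _⟩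
  · rintro ⟨t, φ⟩ ⟨ht, hφ⟩
    obtain rfl : φ = 0 := hφ
    exact mem_iUnion.2 ⟨⟨t, ht⟩, hmem ⟨t, ht⟩⟩
  · intro p hp
    obtain ⟨t, ht⟩ := mem_iUnion.1 hp
    refine ((h t p ht).2.2.1.congr_of_eventuallyEq ?_).contDiffWithinAt
    filter_upwards [(hBo t).mem_nhds ht] with q hq using hGg t hq
  · intro t ht
    rw [hGg ⟨t, ht⟩ (hmem ⟨t, ht⟩), (h ⟨t, ht⟩ _ (hmem ⟨t, ht⟩)).2.1]
  · intro p hp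
    obtain ⟨t, ht⟩ := mem_iUnion.1 hp
    rw [hGg t ht]
    exact (h t p ht).2.2.2.1

/-! ### The attachment equation and its solution by the implicit function theorem. -/

section Attach

open HolDisc

variable {m : ℕ} {r : ℝ} {α : ℝ≥0} (hα : 0 < α) (hα1 : α < 1)

/-- The disc with parameter `t` and deviation `w` from the unperturbed disc. -/
noncomputable def trialDisc (t : Rm m) (w : Fin (m + 1) → HolderSpace α ℝ) : HolDisc m α :=
  baseDisc hα hα1 t + ofBoundary hα hα1 w

/-- The perturbation and the disc given by parameters and a deviation. -/
noncomputable def trialPair (x : (Rm m × Perturbation m r) × (Fin (m + 1) → HolderSpace α ℝ)) :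
    Perturbation m r × HolDisc m α :=
  (x.1.2, trialDisc hα hα1 x.1.1 x.2)

/-- The parameters and deviations that give a disc with boundary in the tube and with positive
derivative of the first component at the centre. -/
def trialDomain : Set ((Rm m × Perturbation m r) × (Fin (m + 1) → HolderSpace α ℝ)) :=
  ((ball 0 1 ×ˢ univ) ×ˢ univ) ∩ {x | trialPair hα hα1 x ∈ tubeDiscs m r α ∧
    0 < √(1 - ‖x.1.1‖ ^ 2) + circleMean (HolderSpace.toC (x.2 0))}

/-- The defect of the boundary of the disc after the perturbation. -/
noncomputable def attachMap (x : (Rm m × Perturbation m r) × (Fin (m + 1) → HolderSpace α ℝ)) :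
    Fin (m + 1) → HolderSpace α ℝ :=
  defect hα (perturbedValue hα hα1 (trialPair hα hα1 x), perturbedAngular hα hα1 (trialPair hα hα1 x))

theorem contDiffOn_trialPair : ContDiffOn ℝ 1 (trialPair hα hα1 :
    (Rm m × Perturbation m r) × (Fin (m + 1) → HolderSpace α ℝ) → _)
      ((ball 0 1 ×ˢ univ) ×ˢ univ) := by
  refine contDiff_fst.snd.contDiffOn.prodMk (ContDiffOn.add ?_ ?_)
  · exact (contDiffOn_baseDisc hα hα1).comp contDiff_fst.fst.contDiffOn fun x hx => hx.1.1
  · exact ((ofBoundary hα hα1).contDiff.comp contDiff_snd).contDiffOn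

theorem isOpen_trialDomain : IsOpen (trialDomain (m := m) (r := r) hα hα1) := by
  have hX : IsOpen ((ball (0 : Rm m) 1 ×ˢ (univ : Set (Perturbation m r))) ×ˢ
      (univ : Set (Fin (m + 1) → HolderSpace α ℝ))) :=
    (isOpen_ball.prod isOpen_univ).prod isOpen_univ
  have h1 := (contDiffOn_trialPair (m := m) (r := r) hα hα1).continuousOn.isOpen_inter_preimage hX
    isOpen_tubeDiscs
  have h2 : IsOpen {x : (Rm m × Perturbation m r) × (Fin (m + 1) → HolderSpace α ℝ) |
      0 < √(1 - ‖x.1.1‖ ^ 2) + circleMean (HolderSpace.toC (x.2 0))} :=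
    isOpen_lt continuous_const (by fun_prop)
  have h3 := h1.inter h2
  rw [inter_assoc] at h3
  exact h3

theorem contDiffOn_attachMap :
    ContDiffOn ℝ 1 (attachMap (m := m) (r := r) hα hα1) (trialDomain hα hα1) := by
  have h := (contDiffOn_trialPair (m := m) (r := r) hα hα1).mono
    (inter_subset_left : trialDomain hα hα1 ⊆ _)
  exact (contDiff_defect hα).comp_contDiffOn
    (((contDiffOn_perturbedValue hα hα1).comp h fun x hx => hx.2.1).prodMk
      ((contDiffOn_perturbedAngular hα hα1).comp h fun x hx => hx.2.1))

theorem zero_mem_trialDomain (hr : 0 < r) {t : Rm m} (ht : t ∈ ball (0 : Rm m) 1) :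
    ((t, (0 : Perturbation m r)), (0 : Fin (m + 1) → HolderSpace α ℝ)) ∈ trialDomain hα hα1 := by
  refine ⟨⟨⟨ht, mem_univ _⟩, mem_univ _⟩, fun z _ => ?_, ?_⟩
  · change trialDisc hα hα1 t 0 z ∈ _
    rw [trialDisc, map_zero, add_zero]
    exact realSphere_subset_tube hr (baseDisc_mem_realSphere hα hα1 ht z)
  · simpa using sqrt_one_sub_pos ht

theorem attachMap_zero {t : Rm m} {w : Fin (m + 1) → HolderSpace α ℝ}
    (h : ((t, (0 : Perturbation m r)), w) ∈ trialDomain hα hα1) :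
    attachMap hα hα1 ((t, (0 : Perturbation m r)), w) =
      defect hα (jet hα hα1 (trialDisc hα hα1 t w)) := by
  have h0 : fderiv ℝ ((0 : Perturbation m r) : Cn m → Cn m) = 0 := fderiv_zero
  rw [attachMap]
  congr 1
  refine Prod.ext (HolderSpace.ext fun z => ?_) (HolderSpace.ext fun z => ?_)
  · rw [perturbedValue_apply hα hα1 h.2.1]
    refine Eq.trans ?_ (holderValue_apply hα hα1 _ z).symm
    exact add_zero _
  · rw [perturbedAngular_apply hα hα1 h.2.1]
    change _ + fderiv ℝ ((0 : Perturbation m r) : Cn m → Cn m) _ _ = _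
    rw [h0]
    exact add_zero _

theorem attachMap_base (hr : 0 < r) {t : Rm m} (ht : t ∈ ball (0 : Rm m) 1) :
    attachMap hα hα1 ((t, (0 : Perturbation m r)), 0) = 0 := by
  rw [attachMap_zero hα hα1 (zero_mem_trialDomain hα hα1 hr ht), trialDisc, map_zero, add_zero,
    defect_jet_baseDisc hα hα1 ht]

theorem contDiffAt_attachMap (hr : 0 < r) {t : Rm m} (ht : t ∈ ball (0 : Rm m) 1) :
    ContDiffAt ℝ 1 (attachMap hα hα1) ((t, (0 : Perturbation m r)), 0) :=
  (contDiffOn_attachMap hα hα1).contDiffAt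
    ((isOpen_trialDomain hα hα1).mem_nhds (zero_mem_trialDomain hα hα1 hr ht))

/-- The derivative is computed along the line `ε ↦ ε • w` with `φ = 0`, where the map is just the
defect along an affine line of jets. -/
theorem fderiv_attachMap_inr (hr : 0 < r) {t : Rm m} (ht : t ∈ ball (0 : Rm m) 1)
    (w : Fin (m + 1) → HolderSpace α ℝ) :
    (fderiv ℝ (attachMap hα hα1) ((t, (0 : Perturbation m r)), 0) ∘L
      .inr ℝ (Rm m × Perturbation m r) (Fin (m + 1) → HolderSpace α ℝ)) w =
      defectDeriv hα (jet hα hα1 (baseDisc hα hα1 t)) (jet hα hα1 (ofBoundary hα hα1 w)) := by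
  have hline : HasDerivAt (fun ε : ℝ => ((t, (0 : Perturbation m r)), ε • w))
      (((0 : Rm m), (0 : Perturbation m r)), w) 0 := by
    refine (hasDerivAt_const (0 : ℝ) (t, (0 : Perturbation m r))).prodMk ?_
    simpa using (hasDerivAt_id (0 : ℝ)).smul_const w
  have h0 : ((t, (0 : Perturbation m r)), (0 : ℝ) • w) = ((t, 0), 0) := by rw [zero_smul]
  have h1 := ((contDiffAt_attachMap hα hα1 hr ht).differentiableAt one_ne_zero).hasFDerivAt
  rw [← h0] at h1
  have h2 := h1.comp_hasDerivAt (0 : ℝ) hline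
  rw [h0] at h2
  refine h2.unique ?_
  refine (hasDerivAt_defect_line hα (jet hα hα1 (baseDisc hα hα1 t))
    (jet hα hα1 (ofBoundary hα hα1 w))).congr_of_eventuallyEq ?_
  have h3 : ∀ᶠ ε : ℝ in 𝓝 0, ((t, (0 : Perturbation m r)), ε • w) ∈ trialDomain hα hα1 :=
    hline.continuousAt.eventually_mem (by
      rw [h0]
      exact (isOpen_trialDomain hα hα1).mem_nhds (zero_mem_trialDomain hα hα1 hr ht))
  filter_upwards [h3] with ε hε
  rw [Function.comp_apply, attachMap_zero hα hα1 hε, trialDisc, map_smul, map_add, map_smul]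

/-- The operator is triangular, with the identity in the last slots and a positive multiple of the
identity in the first, hence bijective; the inverse is bounded because the Hölder spaces are
complete. -/
theorem isInvertible_fderiv_attachMap (hr : 0 < r) {t : Rm m} (ht : t ∈ ball (0 : Rm m) 1) :
    (fderiv ℝ (attachMap hα hα1) ((t, (0 : Perturbation m r)), 0) ∘L
      .inr ℝ (Rm m × Perturbation m r) (Fin (m + 1) → HolderSpace α ℝ)).IsInvertible := by
  set A := fderiv ℝ (attachMap hα hα1) ((t, (0 : Perturbation m r)), 0) ∘L
      .inr ℝ (Rm m × Perturbation m r) (Fin (m + 1) → HolderSpace α ℝ) with hA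
  have hs := sqrt_one_sub_pos ht
  have hsucc : ∀ w (j : Fin m), A w j.succ = w j.succ := fun w j => by
    rw [hA, fderiv_attachMap_inr hα hα1 hr ht, defectDeriv_succ]
  have hzero : ∀ w, (∀ j : Fin m, w j.succ = 0) → A w 0 = (2 * √(1 - ‖t‖ ^ 2)) • w 0 :=
    fun w hw => by rw [hA, fderiv_attachMap_inr hα hα1 hr ht, defectDeriv_zero hα hα1 hw]
  have hker : LinearMap.ker A.toLinearMap = ⊥ := by
    refine LinearMap.ker_eq_bot'.2 fun w hw => ?_
    have hw' : A w = 0 := hw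
    have h1 : ∀ j : Fin m, w j.succ = 0 := fun j =>
      (hsucc w j).symm.trans (by rw [hw']; rfl)
    have h2 := hzero w h1
    rw [hw', Pi.zero_apply, eq_comm, smul_eq_zero] at h2
    funext k
    refine Fin.cases ?_ (fun j => h1 j) k
    exact h2.resolve_left (by positivity)
  have hrange : LinearMap.range A.toLinearMap = ⊤ := by
    refine LinearMap.range_eq_top.2 fun g => ?_
    -- The last entries of a preimage must be those of `g`; `u` corrects what they contribute to the
    -- first slot.
    set u : HolderSpace α ℝ := (2 * √(1 - ‖t‖ ^ 2))⁻¹ • (g 0 - A (Fin.cons 0 fun j => g j.succ) 0)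
    refine ⟨(Fin.cons 0 fun j => g j.succ) + Fin.cons u fun _ => 0, ?_⟩
    change A _ = g
    rw [map_add]
    funext k
    refine Fin.cases ?_ (fun j => ?_) k
    · rw [Pi.add_apply, hzero (Fin.cons u fun _ => 0) fun j => rfl, Fin.cons_zero,
        smul_inv_smul₀ (by positivity)]
      abel
    · rw [Pi.add_apply, hsucc, hsucc, Fin.cons_succ, Fin.cons_succ, add_zero]
  exact ⟨ContinuousLinearEquiv.ofBijective A hker hrange, ContinuousLinearEquiv.coe_ofBijective A _ _⟩

/-- This puts the implicit function in the form needed for gluing: `O` is a neighbourhood in which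
the zeros of `attachMap` are exactly the graph of `g`, and all open conditions are met on one
product of balls. -/
theorem exists_local_solution (hr : 0 < r) {t : Rm m} (ht : t ∈ ball (0 : Rm m) 1) :
    ∃ ρ > 0, ∃ (g : Rm m × Perturbation m r → (Fin (m + 1) → HolderSpace α ℝ))
      (O : Set ((Rm m × Perturbation m r) × (Fin (m + 1) → HolderSpace α ℝ))), IsOpen O ∧
      ∀ p ∈ ball t ρ ×ˢ ball (0 : Perturbation m r) ρ, p.1 ∈ ball (0 : Rm m) 1 ∧ g (p.1, 0) = 0 ∧
        ContDiffAt ℝ 1 g p ∧ ((p, g p) ∈ trialDomain hα hα1 ∧ attachMap hα hα1 (p, g p) = 0) ∧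
        (p, g p) ∈ O ∧ ∀ w, (p, w) ∈ O →
          ((p, w) ∈ trialDomain hα hα1 ∧ attachMap hα hα1 (p, w) = 0) → w = g p := by
  have cdf := contDiffAt_attachMap hα hα1 hr ht
  have hi := isInvertible_fderiv_attachMap hα hα1 hr ht
  set g := cdf.implicitFunction one_ne_zero hi with hg
  have hg0 : g (t, 0) = 0 := cdf.implicitFunction_apply_self one_ne_zero hi
  have h1 := cdf.eventually_apply_implicitFunction one_ne_zero hi
  have h2 := cdf.eventually_apply_eq_iff_implicitFunction one_ne_zero hi
  have h3 := cdf.contDiffAt_implicitFunction one_ne_zero hi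
  rw [attachMap_base hα hα1 hr ht] at h1 h2
  rw [← hg] at h1 h2 h3
  obtain ⟨O, hO2, hO, huO⟩ := _root_.eventually_nhds_iff.1 h2
  have hc : ContinuousAt (fun p => (p, g p)) (t, (0 : Perturbation m r)) :=
    continuousAt_id.prodMk h3.continuousAt
  have h4 := hc.eventually_mem (s := O) (by rw [hg0]; exact hO.mem_nhds huO)
  have h5 := hc.eventually_mem (s := trialDomain hα hα1) (by
    rw [hg0]
    exact (isOpen_trialDomain hα hα1).mem_nhds (zero_mem_trialDomain hα hα1 hr ht))
  have hc6 : Continuous (fun p : Rm m × Perturbation m r =>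
    ((p.1, (0 : Perturbation m r)), (0 : Fin (m + 1) → HolderSpace α ℝ))) := by fun_prop
  -- The zero deviation solves the equation at `φ = 0` for every nearby parameter; since it lies in
  -- `O`, uniqueness forces `g` to vanish there.
  have h6 := (hc6.continuousAt (x := (t, 0))).eventually_mem (hO.mem_nhds huO)
  have h7 := h3.eventually (by simp)
  have h8 : ∀ᶠ p : Rm m × Perturbation m r in 𝓝 (t, 0), p.1 ∈ ball (0 : Rm m) 1 :=
    continuous_fst.continuousAt.eventually_mem (isOpen_ball.mem_nhds ht)
  obtain ⟨ρ, hρ, h⟩ := Metric.eventually_nhds_iff_ball.1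
    (h1.and (h4.and (h5.and (h6.and (h7.and h8)))))
  rw [← ball_prod_same] at h
  refine ⟨ρ, hρ, g, O, hO, fun p hp => ?_⟩
  obtain ⟨a1, a4, a5, a6, a7, a8⟩ := h p hp
  exact ⟨a8, (hO2 _ a6).1 (attachMap_base hα hα1 hr a8), a7, ⟨a5, a1⟩, a4,
    fun w hw hw' => ((hO2 _ hw).1 hw'.2).symm⟩

theorem ext_trialDisc (t : Rm m) (w : Fin (m + 1) → HolderSpace α ℝ) {z : ℂ} (hz : z ∈ cDisc) :
    (trialDisc hα hα1 t w).ext z = (baseDisc hα hα1 t).ext z + (ofBoundary hα hα1 w).ext z :=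
  (evalAt hz).map_add _ _

/-- The first component is `z (√(1 - ‖t‖²) + S(w_0)(z))`. It vanishes at `0`, and its derivative
there is the real number whose positivity is part of `trialDomain`. Attachment is the vanishing of
the defect. -/
theorem isNormalizedAttached_trialDisc {p : Rm m × Perturbation m r}
    {w : Fin (m + 1) → HolderSpace α ℝ} (hd : (p, w) ∈ trialDomain hα hα1)
    (h0 : attachMap hα hα1 (p, w) = 0) :
    IsNormalizedAttached (perturbedSphere p.2) (trialDisc hα hα1 p.1 w) := by
  have hball : (0 : ℂ) ∈ ball (0 : ℂ) 1 := mem_ball_self one_pos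
  have hzero : (0 : ℂ) ∈ cDisc := ball_subset_closedBall hball
  have hext : ∀ z ∈ cDisc, (trialDisc hα hα1 p.1 w).ext z 0 =
      (√(1 - ‖p.1‖ ^ 2) : ℝ) * z + z * HolderSpace.schwarz hα hα1 (w 0) z := fun z hz => by
    rw [ext_trialDisc hα hα1 p.1 w hz, PiLp.add_apply, ext_baseDisc_zero hα hα1 p.1 hz,
      ext_ofBoundary hα hα1 w hz]
    simp
  have hder : HasDerivAt (fun z => (trialDisc hα hα1 p.1 w).ext z 0)
      ((√(1 - ‖p.1‖ ^ 2) + circleMean (HolderSpace.toC (w 0)) : ℝ) : ℂ) 0 := by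
    have h1 := (HolderSpace.isHolderPrimitive_schwarz hα hα1 (w 0)).hasDerivAt 0 hball
    have h2 := ((hasDerivAt_id (0 : ℂ)).const_mul ((√(1 - ‖p.1‖ ^ 2) : ℝ) : ℂ)).add
      ((hasDerivAt_id (0 : ℂ)).mul h1)
    refine (h2.congr_deriv ?_).congr_of_eventuallyEq ?_
    · simp [HolderSpace.schwarz_zero_eq]
    · filter_upwards [isOpen_ball.mem_nhds hball] with z hz
      exact hext z (ball_subset_closedBall hz)
  refine ⟨fun z => ⟨hd.2.1 (mem_univ z), ?_⟩, ?_, ?_, ?_⟩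
  · have h1 := mem_realSphere_of_defect_eq_zero hα (fun θ => ?_) h0 z
    · rwa [perturbedValue_apply hα hα1 hd.2.1] at h1
    · simp only [perturbedValue_apply hα hα1 hd.2.1]
      exact hasDerivAt_perturbed hα hα1 hd.2.1 θ
  · rw [hext 0 hzero]
    simp
  · rw [hder.deriv, Complex.ofReal_im]
  · rw [hder.deriv, Complex.ofReal_re]
    exact hd.2.2

/-- The deviation at the centre is `i` times a real mean, so it does not affect the real part. -/
theorem re_ext_trialDisc (t : Rm m) (w : Fin (m + 1) → HolderSpace α ℝ) (j : Fin m) :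
    ((trialDisc hα hα1 t w).ext 0 j.succ).re = t j := by
  have hzero : (0 : ℂ) ∈ cDisc := mem_closedBall_self zero_le_one
  rw [ext_trialDisc hα hα1 t w hzero, PiLp.add_apply, ext_baseDisc_succ hα hα1 t hzero,
    ext_ofBoundary hα hα1 w hzero, HolderSpace.schwarz_zero_eq]
  simp

end Attach

theorem exists_isDiscFamily (m : ℕ) {α : ℝ≥0} (hα : 0 < α) (hα1 : α < 1) {r : ℝ} (hr : 0 < r) :
    ∃ (Ω : Set (Rm m × Perturbation m r)) (F : Rm m × Perturbation m r → HolDisc m α),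
      IsDiscFamily Ω F ∧ ∀ p ∈ Ω, ∀ j : Fin m, ((F p).ext 0 j.succ).re = p.1 j := by
  obtain ⟨Ω, g, hΩ, hsub, hbase, hg, hg0, hgood⟩ := exists_contDiffOn_of_local
    (Good := fun (p : Rm m × Perturbation m r) (w : Fin (m + 1) → HolderSpace α ℝ) =>
      (p, w) ∈ trialDomain hα hα1 ∧ attachMap hα hα1 (p, w) = 0)
    fun t : ball (0 : Rm m) 1 => exists_local_solution hα hα1 hr t.2
  refine ⟨Ω, fun p => trialDisc hα hα1 p.1 (g p), ⟨hΩ, hsub, hbase, ?_, ?_, ?_⟩, ?_⟩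
  · exact contDiff_snd.comp_contDiffOn ((contDiffOn_trialPair hα hα1).comp
      (contDiffOn_id.prodMk hg) fun p hp => ⟨hsub hp, mem_univ _⟩)
  · intro t ht z
    simp only [hg0 t ht, trialDisc, map_zero, add_zero]
    exact ⟨HolDisc.baseDisc_zero hα hα1 t z, fun j => HolDisc.baseDisc_succ hα hα1 t z j⟩
  · intro p hp
    exact isNormalizedAttached_trialDisc hα hα1 (hgood p hp).1 (hgood p hp).2
  · intro p _ j
    exact re_ext_trialDisc hα hα1 p.1 (g p) j

/-! ### Functions on convex sets that expand distances -/

section Expanding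

variable {E F : Type*} [NormedAddCommGroup E] [NormedSpace ℝ E] [NormedAddCommGroup F]
  [NormedSpace ℝ F] {g : E → F} {X : Set E} {c : ℝ}

/-- The derivative of a function that expands distances by `c` on a convex set with interior points
expands by `c`, also at the boundary points. -/
theorem mul_norm_le_norm_of_hasFDerivWithinAt (hX : Convex ℝ X) (hi : (interior X).Nonempty)
    (hg : ∀ x ∈ X, ∀ y ∈ X, c * ‖x - y‖ ≤ ‖g x - g y‖) {x : E} (hx : x ∈ X) {A : E →L[ℝ] F}
    (hA : HasFDerivWithinAt g A X x) (v : E) : c * ‖v‖ ≤ ‖A v‖ := by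
  obtain ⟨q, hq⟩ := hi
  have hq' := interior_subset hq
  -- At a boundary point only directions into `X` are available. With `q` interior, `η • v` is the
  -- difference of the two such directions `q + η • v - x` and `q - x`, and the expansion is applied
  -- to the two segments at equal times.
  obtain ⟨η, hη, hηX⟩ : ∃ η : ℝ, 0 < η ∧ q + η • v ∈ X := by
    have h1 : ContinuousAt (fun η : ℝ => q + η • v) 0 := by fun_prop
    have h2 : ∀ᶠ η : ℝ in 𝓝[>] 0, q + η • v ∈ X :=
      nhdsWithin_le_nhds (h1.eventually_mem (by simpa using mem_interior_iff_mem_nhds.1 hq))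
    obtain ⟨η, h3, h4⟩ := (h2.and self_mem_nhdsWithin).exists
    exact ⟨η, h4, h3⟩
  have hpath : ∀ y ∈ X, HasDerivWithinAt (fun τ : ℝ => g (x + τ • (y - x))) (A (y - x))
      (Ioo 0 1) 0 := by
    intro y hy
    have h1 : HasDerivWithinAt (fun τ : ℝ => x + τ • (y - x)) (y - x) (Ioo 0 1) 0 := by
      simpa using (((hasDerivAt_id (0 : ℝ)).smul_const (y - x)).const_add x).hasDerivWithinAt
    have hA' : HasFDerivWithinAt g A X (x + (0 : ℝ) • (y - x)) := by simpa using hA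
    exact hA'.comp_hasDerivWithinAt (0 : ℝ) h1 fun τ hτ =>
      hX.add_smul_sub_mem hx hy ⟨hτ.1.le, hτ.2.le⟩
  have h1 := (hpath _ hηX).sub (hpath _ hq')
  rw [hasDerivWithinAt_iff_tendsto_slope' (by simp)] at h1
  have h2 : A (q + η • v - x) - A (q - x) = η • A v := by
    rw [← map_sub, ← map_smul]
    congr 1
    abel
  rw [h2] at h1
  have := left_nhdsWithin_Ioo_neBot (zero_lt_one' ℝ)
  have h3 : c * ‖η • v‖ ≤ ‖η • A v‖ := by
    refine ge_of_tendsto h1.norm ?_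
    filter_upwards [self_mem_nhdsWithin] with τ hτ
    have h4 := hg _ (hX.add_smul_sub_mem hx hηX ⟨hτ.1.le, hτ.2.le⟩) _
      (hX.add_smul_sub_mem hx hq' ⟨hτ.1.le, hτ.2.le⟩)
    have h5 : x + τ • (q + η • v - x) - (x + τ • (q - x)) = τ • (η • v) := by
      rw [add_sub_add_left_eq_sub, ← smul_sub]
      congr 1
      abel
    rw [h5, norm_smul, Real.norm_of_nonneg hτ.1.le] at h4
    simp only [slope, Pi.sub_apply, zero_smul, add_zero, sub_self, vsub_eq_sub, sub_zero, norm_smul,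
      norm_inv, Real.norm_of_nonneg hτ.1.le]
    rw [le_inv_mul_iff₀ hτ.1]
    rw [norm_smul] at h4
    linarith
  rw [norm_smul, norm_smul, mul_left_comm] at h3
  exact le_of_mul_le_mul_left h3 (norm_pos_iff.2 hη.ne')

/-- Expansion is inherited by the derivative, which is therefore injective. It also makes the
restriction antilipschitz, and an antilipschitz, uniformly continuous map is a uniform embedding. -/
theorem isC1Embedding_of_expanding (hc : 0 < c) (hX : Convex ℝ X) (hi : (interior X).Nonempty)
    (hg : ∀ x ∈ X, ∀ y ∈ X, c * ‖x - y‖ ≤ ‖g x - g y‖) (hd : ContDiffOn ℝ 1 g X)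
    (hu : UniformContinuousOn g X) : IsC1Embedding g X where
  contDiffOn := hd
  immersion x hx := (injective_iff_map_eq_zero _).2 fun v hv => by
    have h1 := mul_norm_le_norm_of_hasFDerivWithinAt hX hi hg hx
      ((hd.differentiableOn one_ne_zero x hx).hasFDerivWithinAt) v
    rw [hv, norm_zero] at h1
    exact norm_le_zero_iff.1 (nonpos_of_mul_nonpos_right h1 hc)
  isEmbedding := by
    have h1 : AntilipschitzWith (c⁻¹).toNNReal (X.domRestrict g) :=
      AntilipschitzWith.of_le_mul_dist fun x y => by
        rw [Real.coe_toNNReal _ (by positivity), Subtype.dist_eq, dist_eq_norm, dist_eq_norm,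
          le_inv_mul_iff₀ hc]
        exact hg x x.2 y y.2
    exact (h1.isUniformEmbedding (uniformContinuousOn_iff_restrict.1 hu)).isEmbedding

end Expanding

/-! ### Evaluation of families of discs -/

section Evaluation

variable {m : ℕ} {α : ℝ≥0}

theorem exists_convex_cDisc_inter_ball : ∀ x ∈ cDisc, ∃ ε > 0, Convex ℝ (cDisc ∩ ball x ε) :=
  fun x _ => ⟨1, one_pos, (convex_closedBall _ _).inter (convex_ball x 1)⟩

theorem contDiffOn_ext_eval :
    ContDiffOn ℝ 1 (fun q : HolDisc m α × ℂ => q.1.ext q.2) (univ ×ˢ cDisc) :=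
  HolDisc.isBoundedC1Family_ext.contDiffOn_eval uniqueDiffOn_cDisc exists_convex_cDisc_inter_ball

/-- The derivative of the evaluation of a family of discs. -/
theorem exists_hasFDerivWithinAt_ext {T : Type*} [NormedAddCommGroup T] [NormedSpace ℝ T]
    {H : T → HolDisc m α} {H' : T →L[ℝ] HolDisc m α} {p : ℂ × T} (hp : p.1 ∈ cDisc)
    (hH : HasFDerivAt H H' p.2) :
    ∃ L : ℂ × T →L[ℝ] Cn m, HasFDerivWithinAt (fun p : ℂ × T => (H p.2).ext p.1) L
      (cDisc ×ˢ univ) p ∧ ‖L‖ ≤ ‖H p.2‖ + ‖H'‖ := by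
  have B := HolDisc.isBoundedC1Family_ext (m := m) (α := α)
  have h1 := B.hasFDerivWithinAt_eval exists_convex_cDisc_inter_ball (q := (H p.2, p.1)) hp
  have h2 : HasFDerivWithinAt (fun p : ℂ × T => (H p.2, p.1))
      ((H'.comp (.snd ℝ ℂ T)).prod (.fst ℝ ℂ T)) (cDisc ×ˢ univ) p :=
    ((hH.comp p hasFDerivAt_snd).prodMk hasFDerivAt_fst).hasFDerivWithinAt
  have h3 := HasFDerivWithinAt.comp (g := fun q : HolDisc m α × ℂ => q.1.ext q.2)
    (t := univ ×ˢ cDisc) p h1 h2 fun q hq => ⟨mem_univ _, hq.1⟩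
  refine ⟨_, h3, ?_⟩
  refine ContinuousLinearMap.opNorm_le_bound _ (by positivity) fun v => ?_
  change ‖B.evalAt p.1 (H' v.2) + fderivWithin ℝ (H p.2).ext cDisc p.1 v.1‖ ≤ _
  rw [B.evalAt_apply hp]
  have h3 := B.norm_le (H' v.2) p.1 hp
  have h4 := B.norm_fderivWithin_le (H p.2) p.1 hp
  rw [one_mul] at h3 h4
  have h5 : ‖v.1‖ ≤ ‖v‖ := norm_fst_le v
  have h6 : ‖v.2‖ ≤ ‖v‖ := norm_snd_le v
  calc _ ≤ ‖H' v.2‖ + ‖fderivWithin ℝ (H p.2).ext cDisc p.1 v.1‖ := norm_add_le_of_le h3 le_rfl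
    _ ≤ ‖H'‖ * ‖v.2‖ + ‖fderivWithin ℝ (H p.2).ext cDisc p.1‖ * ‖v.1‖ :=
      add_le_add (H'.le_opNorm _) (ContinuousLinearMap.le_opNorm _ _)
    _ ≤ ‖H'‖ * ‖v‖ + ‖H p.2‖ * ‖v‖ := by gcongr
    _ = _ := by ring

variable {t : ℝ} {f : CkSpace 1 (discTimesBall m t) (Cn m)} {H : Rm m → HolDisc m α}
  {H' : Rm m → Rm m →L[ℝ] HolDisc m α}

theorem norm_iteratedFDerivWithin_le_of_eqOn {g : ℂ × Rm m → Cn m}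
    (hH : ∀ s ∈ ball (0 : Rm m) t, HasFDerivAt H (H' s) s)
    (hg : EqOn g (fun p => (H p.2).ext p.1) (discTimesBall m t)) {a b : ℝ}
    (ha : ∀ s ∈ ball (0 : Rm m) t, ‖H s‖ ≤ a) (hb : ∀ s ∈ ball (0 : Rm m) t, ‖H' s‖ ≤ b) {j : ℕ}
    (hj : j ≤ 1) {p : ℂ × Rm m} (hp : p ∈ discTimesBall m t) :
    ‖iteratedFDerivWithin ℝ j g (discTimesBall m t) p‖ ≤ a + b := by
  have hU : UniqueDiffOn ℝ (discTimesBall m t) := uniqueDiffOn_cDisc.prod isOpen_ball.uniqueDiffOn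
  have ha' := ha p.2 hp.2
  have hb' := hb p.2 hp.2
  interval_cases j
  · rw [norm_iteratedFDerivWithin_zero, hg hp]
    have := HolDisc.norm_ext_le (H p.2) hp.1
    linarith [norm_nonneg (H' p.2)]
  · obtain ⟨L, hL, hLn⟩ := exists_hasFDerivWithinAt_ext hp.1 (hH p.2 hp.2)
    have hL' : HasFDerivWithinAt g L (discTimesBall m t) p := (hL.mono (prod_mono_right (subset_univ _))).congr hg (hg hp)
    rw [norm_iteratedFDerivWithin_one _ (hU p hp), hL'.fderivWithin (hU p hp)]
    linarith

theorem CkSpace.norm_le_of_eqOn (hH : ∀ s ∈ ball (0 : Rm m) t, HasFDerivAt H (H' s) s)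
    (hf : EqOn f (fun p => (H p.2).ext p.1) (discTimesBall m t)) {a b : ℝ} (ha0 : 0 ≤ a)
    (hb0 : 0 ≤ b) (ha : ∀ s ∈ ball (0 : Rm m) t, ‖H s‖ ≤ a)
    (hb : ∀ s ∈ ball (0 : Rm m) t, ‖H' s‖ ≤ b) : ‖f‖ ≤ 2 * (a + b) := by
  rw [CkSpace.norm_def, Finset.sum_range_succ, Finset.sum_range_one, two_mul]
  refine add_le_add ?_ ?_ <;>
  refine Real.iSup_le (fun p => ?_) (add_nonneg ha0 hb0)
  · exact norm_iteratedFDerivWithin_le_of_eqOn hH hf ha hb zero_le_one p.2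
  · exact norm_iteratedFDerivWithin_le_of_eqOn hH hf ha hb le_rfl p.2

end Evaluation

/-! ### Uniformity on compact sets of parameters -/

/-- Continuity at each `(s, φ₀)` gives the estimate near that point, and compactness of `k` makes
the neighbourhood of `φ₀` uniform. -/
theorem eventually_forall_norm_sub_lt {T Φ W : Type*} [TopologicalSpace T] [TopologicalSpace Φ]
    [SeminormedAddCommGroup W] {Ω : Set (T × Φ)} (hΩ : IsOpen Ω) {H : T × Φ → W}
    (hH : ContinuousOn H Ω) {k : Set T} (hk : IsCompact k) {φ₀ : Φ} (h0 : ∀ s ∈ k, (s, φ₀) ∈ Ω)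
    {ε : ℝ} (hε : 0 < ε) :
    ∀ᶠ φ in 𝓝 φ₀, ∀ s ∈ k, (s, φ) ∈ Ω ∧ ‖H (s, φ) - H (s, φ₀)‖ < ε := by
  refine hk.eventually_forall_of_forall_eventually fun s hs => ?_
  have h1 : ContinuousAt H (s, φ₀) := hH.continuousAt (hΩ.mem_nhds (h0 s hs))
  have hc1 : ContinuousAt (fun z : Φ × T => (z.2, z.1)) (φ₀, s) := by fun_prop
  have hc2 : ContinuousAt (fun z : Φ × T => (z.2, φ₀)) (φ₀, s) := by fun_prop
  have h2 : ContinuousAt (fun z : Φ × T => H (z.2, z.1) - H (z.2, φ₀)) (φ₀, s) :=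
    (ContinuousAt.comp (f := fun z : Φ × T => (z.2, z.1)) h1 hc1).sub
      (ContinuousAt.comp (f := fun z : Φ × T => (z.2, φ₀)) h1 hc2)
  have h3 : ∀ᶠ z : Φ × T in 𝓝 (φ₀, s), ‖H (z.2, z.1) - H (z.2, φ₀)‖ < ε :=
    h2.norm.eventually_lt_const (by simpa using hε)
  filter_upwards [h3, hc1.eventually_mem (hΩ.mem_nhds (h0 s hs))] with z hz1 hz2 using ⟨hz2, hz1⟩

/-! ### The standard family expands distances away from `‖t‖ = 1`. -/

section Unperturbed

variable {m : ℕ}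

/-- The difference of the roots times their sum is the difference of the squared norms, up to sign.
The sum is at least `2√(1 - t²)`, and the factor `‖s‖ + ‖s'‖` is at most `2`. -/
theorem abs_sqrt_sub_sqrt_mul_le {t : ℝ} (ht : t < 1) {s s' : Rm m}
    (hs : s ∈ closedBall (0 : Rm m) t) (hs' : s' ∈ closedBall (0 : Rm m) t) :
    |√(1 - ‖s‖ ^ 2) - √(1 - ‖s'‖ ^ 2)| * √(1 - t ^ 2) ≤ ‖s - s'‖ := by
  rw [mem_closedBall_zero_iff] at hs hs'
  have h0 := norm_nonneg s
  have h0' := norm_nonneg s'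
  have h1 : √(1 - t ^ 2) ≤ √(1 - ‖s‖ ^ 2) := Real.sqrt_le_sqrt (by nlinarith)
  have h1' : √(1 - t ^ 2) ≤ √(1 - ‖s'‖ ^ 2) := Real.sqrt_le_sqrt (by nlinarith)
  have h2 : √(1 - ‖s‖ ^ 2) ^ 2 = 1 - ‖s‖ ^ 2 := Real.sq_sqrt (by nlinarith)
  have h2' : √(1 - ‖s'‖ ^ 2) ^ 2 = 1 - ‖s'‖ ^ 2 := Real.sq_sqrt (by nlinarith)
  have h3 := abs_norm_sub_norm_le s s'
  have h4 : |√(1 - ‖s‖ ^ 2) - √(1 - ‖s'‖ ^ 2)| * (√(1 - ‖s‖ ^ 2) + √(1 - ‖s'‖ ^ 2)) =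
      |‖s‖ - ‖s'‖| * (‖s‖ + ‖s'‖) := by
    have e : (√(1 - ‖s‖ ^ 2) - √(1 - ‖s'‖ ^ 2)) * (√(1 - ‖s‖ ^ 2) + √(1 - ‖s'‖ ^ 2)) =
        -((‖s‖ - ‖s'‖) * (‖s‖ + ‖s'‖)) := by linear_combination h2 - h2'
    have e2 := congrArg abs e
    rwa [abs_neg, abs_mul, abs_mul, abs_of_nonneg (add_nonneg h0 h0'),
      abs_of_nonneg (add_nonneg (Real.sqrt_nonneg (1 - ‖s‖ ^ 2)) (Real.sqrt_nonneg _))] at e2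
  have h5 := abs_nonneg (√(1 - ‖s‖ ^ 2) - √(1 - ‖s'‖ ^ 2))
  have h6 : |‖s‖ - ‖s'‖| * (‖s‖ + ‖s'‖) ≤ ‖s - s'‖ * 2 :=
    mul_le_mul h3 (by linarith) (by positivity) (norm_nonneg _)
  have h7 : |√(1 - ‖s‖ ^ 2) - √(1 - ‖s'‖ ^ 2)| * (√(1 - t ^ 2) + √(1 - t ^ 2)) ≤
      |√(1 - ‖s‖ ^ 2) - √(1 - ‖s'‖ ^ 2)| * (√(1 - ‖s‖ ^ 2) + √(1 - ‖s'‖ ^ 2)) :=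
    mul_le_mul_of_nonneg_left (add_le_add h1 h1') h5
  linarith

theorem norm_le_of_apply_succ {v : Cn m} {s : Rm m} (h : ∀ j : Fin m, v j.succ = s j) :
    ‖s‖ ≤ ‖v‖ := by
  refine (sq_le_sq₀ (norm_nonneg s) (norm_nonneg v)).1 ?_
  rw [EuclideanSpace.norm_sq_eq, EuclideanSpace.norm_sq_eq, Fin.sum_univ_succ]
  simp only [h, Complex.norm_real]
  exact le_add_of_nonneg_left (by positivity)

/-- The unperturbed family expands distances. -/
theorem exists_expanding_baseDisc {α : ℝ≥0} (hα : 0 < α) (hα1 : α < 1) {t : ℝ} (ht0 : 0 < t)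
    (ht : t < 1) : ∃ κ : ℝ, 0 < κ ∧ ∀ p ∈ cDisc ×ˢ closedBall (0 : Rm m) t,
      ∀ q ∈ cDisc ×ˢ closedBall (0 : Rm m) t,
        ‖p - q‖ ≤ κ * ‖(HolDisc.baseDisc hα hα1 p.2).ext p.1 -
          (HolDisc.baseDisc hα hα1 q.2).ext q.1‖ := by
  set c := √(1 - t ^ 2) with hc
  have hc0 : 0 < c := Real.sqrt_pos.2 (by nlinarith)
  have hc1 : c ≤ 1 := Real.sqrt_le_one.2 (by nlinarith)
  -- With `v` the difference of the values, the last coordinates give `‖s - s'‖ ≤ ‖v‖`. The first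
  -- gives `c ‖ξ - η‖ ≤ ‖v‖ + d`, where `d` is the difference of the roots and `c d ≤ ‖v‖`. Hence
  -- `c² ‖ξ - η‖ ≤ (c + 1) ‖v‖`.
  refine ⟨(c + 1) / c ^ 2, by positivity, ?_⟩
  rintro ⟨ξ, s⟩ ⟨hξ, hs⟩ ⟨η, s'⟩ ⟨hη, hs'⟩
  simp only at hξ hs hη hs' ⊢
  set v := (HolDisc.baseDisc hα hα1 s).ext ξ - (HolDisc.baseDisc hα hα1 s').ext η with hv
  have hv0 : v 0 = (√(1 - ‖s‖ ^ 2) : ℝ) * ξ - (√(1 - ‖s'‖ ^ 2) : ℝ) * η := by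
    rw [hv, PiLp.sub_apply, HolDisc.ext_baseDisc_zero hα hα1 s hξ,
      HolDisc.ext_baseDisc_zero hα hα1 s' hη]
  have h1 : ‖s - s'‖ ≤ ‖v‖ := norm_le_of_apply_succ fun j => by
    rw [hv, PiLp.sub_apply, HolDisc.ext_baseDisc_succ hα hα1 s hξ,
      HolDisc.ext_baseDisc_succ hα hα1 s' hη]
    simp
  have h2 : ‖v 0‖ ≤ ‖v‖ := PiLp.norm_apply_le v 0
  have h3 := abs_sqrt_sub_sqrt_mul_le ht hs hs'
  rw [← hc] at h3
  have h4 : c ≤ √(1 - ‖s‖ ^ 2) := Real.sqrt_le_sqrt (by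
    have h5 := mem_closedBall_zero_iff.1 hs
    have h6 := norm_nonneg s
    nlinarith)
  have e : ((√(1 - ‖s‖ ^ 2) : ℝ) : ℂ) * (ξ - η) =
      v 0 - ((√(1 - ‖s‖ ^ 2) - √(1 - ‖s'‖ ^ 2) : ℝ) : ℂ) * η := by
    rw [hv0]
    push_cast
    ring
  have h5 : √(1 - ‖s‖ ^ 2) * ‖ξ - η‖ ≤ ‖v‖ + |√(1 - ‖s‖ ^ 2) - √(1 - ‖s'‖ ^ 2)| := by
    have h6 := congrArg norm e
    rw [norm_mul, Complex.norm_real, Real.norm_of_nonneg (Real.sqrt_nonneg _)] at h6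
    rw [h6]
    refine (norm_sub_le _ _).trans (add_le_add h2 ?_)
    rw [norm_mul, Complex.norm_real, Real.norm_eq_abs]
    exact mul_le_of_le_one_right (abs_nonneg _) (mem_closedBall_zero_iff.1 hη)
  have h6 : c * ‖ξ - η‖ ≤ ‖v‖ + |√(1 - ‖s‖ ^ 2) - √(1 - ‖s'‖ ^ 2)| :=
    (mul_le_mul_of_nonneg_right h4 (norm_nonneg _)).trans h5
  have hn := norm_nonneg v
  rw [div_mul_eq_mul_div, le_div_iff₀ (by positivity), Prod.mk_sub_mk, Prod.norm_mk, max_mul_of_nonneg _ _ (by positivity)]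
  refine max_le ?_ ?_
  · calc ‖ξ - η‖ * c ^ 2 = c * ‖ξ - η‖ * c := by ring
      _ ≤ (‖v‖ + |√(1 - ‖s‖ ^ 2) - √(1 - ‖s'‖ ^ 2)|) * c := by gcongr
      _ ≤ (c + 1) * ‖v‖ := by linarith
  · calc ‖s - s'‖ * c ^ 2 ≤ ‖v‖ * 1 := by
          gcongr
          nlinarith
      _ ≤ _ := by nlinarith

end Unperturbed

/-! ### Properties of an arbitrary disc family for small perturbations. -/

namespace IsDiscFamily

variable {m : ℕ} {r : ℝ} {α : ℝ≥0} {Ω : Set (Rm m × Perturbation m r)}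
  {F : Rm m × Perturbation m r → HolDisc m α}

theorem eq_baseDisc (h : IsDiscFamily Ω F) (hα : 0 < α) (hα1 : α < 1) {s : Rm m}
    (hs : s ∈ ball (0 : Rm m) 1) : F (s, 0) = HolDisc.baseDisc hα hα1 s := by
  refine Subtype.ext (funext fun z => ?_)
  obtain ⟨h1, h2⟩ := h.base s hs z
  ext k
  refine Fin.cases ?_ (fun j => ?_) k
  · exact h1.trans (HolDisc.baseDisc_zero hα hα1 s z).symm
  · exact (h2 j).trans (HolDisc.baseDisc_succ hα hα1 s z j).symm

/-- The partial derivative of the family in the parameters of the discs. -/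
theorem hasFDerivAt_fst (h : IsDiscFamily Ω F) {s : Rm m} {φ : Perturbation m r}
    (hs : (s, φ) ∈ Ω) : HasFDerivAt (fun s => F (s, φ))
      (fderiv ℝ F (s, φ) ∘L .inl ℝ (Rm m) (Perturbation m r)) s :=
  (((h.contDiffOn.differentiableOn one_ne_zero).differentiableAt
    (h.isOpen.mem_nhds hs)).hasFDerivAt).comp s (hasFDerivAt_prodMk_left s φ)

theorem continuousOn_fderiv_inl (h : IsDiscFamily Ω F) :
    ContinuousOn (fun p => fderiv ℝ F p ∘L .inl ℝ (Rm m) (Perturbation m r)) Ω :=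
  (h.contDiffOn.continuousOn_fderiv_of_isOpen h.isOpen le_rfl).clm_comp continuousOn_const

theorem contDiffOn_foliationMap (h : IsDiscFamily Ω F) {φ : Perturbation m r} {k : Set (Rm m)}
    (hk : ∀ s ∈ k, (s, φ) ∈ Ω) : ContDiffOn ℝ 1 (foliationMap F φ) (cDisc ×ˢ k) := by
  have h1 : ContDiffOn ℝ 1 (fun p : ℂ × Rm m => (F (p.2, φ), p.1)) (cDisc ×ˢ k) :=
    (h.contDiffOn.comp (contDiff_snd.prodMk contDiff_const).contDiffOn
      fun p hp => hk p.2 hp.2).prodMk contDiff_fst.contDiffOn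
  exact contDiffOn_ext_eval.comp h1 fun p hp => ⟨mem_univ _, hp.1⟩

theorem eventually_close (h : IsDiscFamily Ω F) {k : Set (Rm m)} (hk : IsCompact k)
    {φ₀ : Perturbation m r} (h0 : ∀ s ∈ k, (s, φ₀) ∈ Ω) {ε : ℝ} (hε : 0 < ε) :
    ∀ᶠ φ in 𝓝 φ₀, ∀ s ∈ k, (s, φ) ∈ Ω ∧ ‖F (s, φ) - F (s, φ₀)‖ < ε ∧
      ‖fderiv ℝ F (s, φ) ∘L .inl ℝ (Rm m) (Perturbation m r) -
        fderiv ℝ F (s, φ₀) ∘L .inl ℝ (Rm m) (Perturbation m r)‖ < ε := by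
  filter_upwards [eventually_forall_norm_sub_lt h.isOpen h.contDiffOn.continuousOn hk h0 hε,
    eventually_forall_norm_sub_lt h.isOpen h.continuousOn_fderiv_inl hk h0 hε] with φ h1 h2 s hs
  exact ⟨(h1 s hs).1, (h1 s hs).2, (h2 s hs).2⟩

/-- The difference of two of the maps is Lipschitz with a small constant. -/
theorem norm_foliationMap_sub_sub_le (h : IsDiscFamily Ω F) {k : Set (Rm m)} (hk : Convex ℝ k)
    {φ φ₀ : Perturbation m r} {ε : ℝ} (h0 : ∀ s ∈ k, (s, φ₀) ∈ Ω)
    (hφ : ∀ s ∈ k, (s, φ) ∈ Ω ∧ ‖F (s, φ) - F (s, φ₀)‖ < ε ∧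
      ‖fderiv ℝ F (s, φ) ∘L .inl ℝ (Rm m) (Perturbation m r) -
        fderiv ℝ F (s, φ₀) ∘L .inl ℝ (Rm m) (Perturbation m r)‖ < ε) {p q : ℂ × Rm m}
    (hp : p ∈ cDisc ×ˢ k) (hq : q ∈ cDisc ×ˢ k) :
    ‖(foliationMap F φ p - foliationMap F φ₀ p) - (foliationMap F φ q - foliationMap F φ₀ q)‖ ≤
      2 * ε * ‖p - q‖ := by
  have hX : Convex ℝ (cDisc ×ˢ k) := (convex_closedBall _ _).prod hk
  have hd : ∀ x ∈ cDisc ×ˢ k, ∃ L : ℂ × Rm m →L[ℝ] Cn m, HasFDerivWithinAt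
      (fun p : ℂ × Rm m => (F (p.2, φ) - F (p.2, φ₀)).ext p.1) L (cDisc ×ˢ k) x ∧
        ‖L‖ ≤ 2 * ε := fun x hx => by
    obtain ⟨h1, h2, h3⟩ := hφ x.2 hx.2
    obtain ⟨L, hL, hLn⟩ := exists_hasFDerivWithinAt_ext hx.1
      ((h.hasFDerivAt_fst h1).sub (h.hasFDerivAt_fst (h0 x.2 hx.2)))
    refine ⟨L, hL.mono (prod_mono_right (subset_univ _)), hLn.trans ?_⟩
    rw [two_mul]
    exact add_le_add h2.le h3.le
  choose! L hL hLn using hd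
  have key := hX.norm_image_sub_le_of_norm_hasFDerivWithin_le hL hLn hq hp
  have e : ∀ x ∈ cDisc ×ˢ k, (F (x.2, φ) - F (x.2, φ₀)).ext x.1 =
      foliationMap F φ x - foliationMap F φ₀ x := fun x hx =>
    HolDisc.isBoundedC1Family_ext.sub _ _ hx.1
  rwa [e p hp, e q hq] at key

theorem isAnalyticDisc (h : IsDiscFamily Ω F) {φ : Perturbation m r} {s : Rm m}
    (hs : (s, φ) ∈ Ω) :
    IsAnalyticDisc (fun ξ => foliationMap F φ (ξ, s)) (perturbedSphere φ) where
  continuousOn := (F (s, φ)).isC1HolderHol_ext.contDiffOn.continuousOn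
  holo := (F (s, φ)).isC1HolderHol_ext.holo
  boundary z hz := by
    obtain ⟨w, rfl⟩ := HolDisc.exists_circle_of_mem_sphere hz
    change (F (s, φ)).ext w ∈ _
    rw [HolDisc.ext_coe]
    exact (h.normalized _ hs).attached w

theorem exists_ckSpace (h : IsDiscFamily Ω F) {φ : Perturbation m r} {t : ℝ}
    (hφ : ∀ s ∈ closedBall (0 : Rm m) t, (s, φ) ∈ Ω) :
    ∃ f : CkSpace 1 (discTimesBall m t) (Cn m), EqOn f (foliationMap F φ) (discTimesBall m t) := by
  classical
  have hball : ∀ s ∈ ball (0 : Rm m) t, (s, φ) ∈ Ω := fun s hs => hφ s (ball_subset_closedBall hs)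
  have hc : ContinuousOn (fun s : Rm m => (s, φ)) (closedBall 0 t) := by fun_prop
  obtain ⟨a, ha⟩ := (isCompact_closedBall (0 : Rm m) t).exists_bound_of_continuousOn
    (h.contDiffOn.continuousOn.comp hc hφ)
  obtain ⟨b, hb⟩ := (isCompact_closedBall (0 : Rm m) t).exists_bound_of_continuousOn
    (h.continuousOn_fderiv_inl.comp hc hφ)
  -- Elements of `CkSpace` must vanish off the domain, so the map is cut off there.
  have heq : EqOn ((discTimesBall m t).indicator (foliationMap F φ)) (foliationMap F φ)
    (discTimesBall m t) := fun p hp => indicator_of_mem hp _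
  refine ⟨⟨(discTimesBall m t).indicator (foliationMap F φ), fun p hp => indicator_of_notMem hp _,
    ((h.contDiffOn_foliationMap hball).congr heq), fun j hj => ⟨a + b, ?_⟩⟩, heq⟩
  rintro _ ⟨p, rfl⟩
  exact norm_iteratedFDerivWithin_le_of_eqOn (H := fun s => F (s, φ))
    (fun s hs => h.hasFDerivAt_fst (hball s hs)) heq (fun s hs => ha s (ball_subset_closedBall hs))
    (fun s hs => hb s (ball_subset_closedBall hs)) hj p.2

theorem exists_continuousOn_ckSpace (h : IsDiscFamily Ω F) {N : Set (Perturbation m r)}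
    (hN : IsOpen N) {t : ℝ} (hsub : closedBall (0 : Rm m) t ×ˢ N ⊆ Ω) :
    ∃ G : Perturbation m r → CkSpace 1 (discTimesBall m t) (Cn m), ContinuousOn G N ∧
      ∀ φ ∈ N, EqOn (G φ) (foliationMap F φ) (discTimesBall m t) := by
  have hex : ∀ φ ∈ N, ∃ f : CkSpace 1 (discTimesBall m t) (Cn m),
      EqOn f (foliationMap F φ) (discTimesBall m t) := fun φ hφ =>
    h.exists_ckSpace fun s hs => hsub ⟨hs, hφ⟩
  choose! G hG using hex
  refine ⟨G, fun φ₀ hφ₀ => ?_, hG⟩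
  refine ContinuousAt.continuousWithinAt (Metric.tendsto_nhds.2 fun ε hε => ?_)
  have h0 : ∀ s ∈ closedBall (0 : Rm m) t, (s, φ₀) ∈ Ω := fun s hs => hsub ⟨hs, hφ₀⟩
  filter_upwards [h.eventually_close (isCompact_closedBall (0 : Rm m) t) h0
    (show 0 < ε / 8 by positivity), hN.mem_nhds hφ₀] with φ h1 hφ
  have h2 : ‖G φ - G φ₀‖ ≤ 2 * (ε / 8 + ε / 8) := by
    refine CkSpace.norm_le_of_eqOn (H := fun s => F (s, φ) - F (s, φ₀))
      (fun s hs => (h.hasFDerivAt_fst (h1 s (ball_subset_closedBall hs)).1).sub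
        (h.hasFDerivAt_fst (h0 s (ball_subset_closedBall hs)))) (fun p hp => ?_)
      (by positivity) (by positivity) (fun s hs => (h1 s (ball_subset_closedBall hs)).2.1.le)
      (fun s hs => (h1 s (ball_subset_closedBall hs)).2.2.le)
    refine Eq.trans ?_ (HolDisc.isBoundedC1Family_ext.sub _ _ hp.1).symm
    exact congrArg₂ (· - ·) (hG φ hφ hp) (hG φ₀ hφ₀ hp)
  rw [dist_eq_norm]
  linarith

/-- Expansion of distances survives a perturbation with small Lipschitz constant. The standard
family expands by `1/κ`; closeness within `1/(4κ)` in value and in parameter derivative gives a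
difference with Lipschitz constant `1/(2κ)`, so the factor `1/(2κ)` remains. The estimates are made
on the closed ball, which supplies the compactness. -/
theorem exists_foliation (h : IsDiscFamily Ω F) (hα : 0 < α) (hα1 : α < 1) {t : ℝ} (ht0 : 0 < t)
    (ht : t < 1) :
    ∃ N : Set (Perturbation m r), IsOpen N ∧ 0 ∈ N ∧ closedBall (0 : Rm m) t ×ˢ N ⊆ Ω ∧
      ∀ φ ∈ N, IsC1Embedding (foliationMap F φ) (discTimesBall m t) := by
  have hball : closedBall (0 : Rm m) t ⊆ ball 0 1 := closedBall_subset_ball ht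
  obtain ⟨κ, hκ, hexp⟩ := exists_expanding_baseDisc (m := m) hα hα1 ht0 ht
  have h0 : ∀ s ∈ closedBall (0 : Rm m) t, (s, (0 : Perturbation m r)) ∈ Ω := fun s hs =>
    h.base_mem ⟨hball hs, rfl⟩
  have hev := h.eventually_close (isCompact_closedBall (0 : Rm m) t) h0
    (show 0 < 1 / (4 * κ) by positivity)
  -- The neighbourhood is the interior of the set of all `φ` that satisfy the closeness estimates in
  -- `hev`.
  refine ⟨interior _, isOpen_interior, mem_interior_iff_mem_nhds.2 hev, ?_, fun φ hφ => ?_⟩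
  · rintro ⟨s, φ⟩ ⟨hs, hφ⟩
    exact (interior_subset hφ s hs).1
  · have hφ' := interior_subset hφ
    have hΩ : ∀ s ∈ closedBall (0 : Rm m) t, (s, φ) ∈ Ω := fun s hs => (hφ' s hs).1
    have hsub : discTimesBall m t ⊆ cDisc ×ˢ closedBall (0 : Rm m) t :=
      prod_mono_right ball_subset_closedBall
    have hc := h.contDiffOn_foliationMap hΩ
    refine isC1Embedding_of_expanding (c := 1 / (2 * κ)) (by positivity)
      ((convex_closedBall _ _).prod (convex_ball _ _)) ?_ (fun p hp q hq => ?_) (hc.mono hsub) ?_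
    · exact ⟨(0, 0), mem_interior.2 ⟨ball 0 1 ×ˢ ball 0 t, prod_mono_left ball_subset_closedBall,
        isOpen_ball.prod isOpen_ball, mem_ball_self one_pos, mem_ball_self ht0⟩⟩
    · have h1 := hexp p (hsub hp) q (hsub hq)
      rw [← h.eq_baseDisc hα hα1 (hball (hsub hp).2), ← h.eq_baseDisc hα hα1 (hball (hsub hq).2)] at h1
      have h2 := h.norm_foliationMap_sub_sub_le (convex_closedBall (0 : Rm m) t) h0 hφ' (hsub hp)
        (hsub hq)
      have h3 : ‖foliationMap F 0 p - foliationMap F 0 q‖ ≤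
          ‖foliationMap F φ p - foliationMap F φ q‖ + 2 * (1 / (4 * κ)) * ‖p - q‖ := by
        have e : foliationMap F 0 p - foliationMap F 0 q =
            (foliationMap F φ p - foliationMap F φ q) -
              ((foliationMap F φ p - foliationMap F 0 p) -
                (foliationMap F φ q - foliationMap F 0 q)) := by abel
        rw [e]
        exact (norm_sub_le _ _).trans (add_le_add_right h2 _)
      have h4 : ‖p - q‖ ≤ κ * (‖foliationMap F φ p - foliationMap F φ q‖ +
          2 * (1 / (4 * κ)) * ‖p - q‖) := h1.trans (mul_le_mul_of_nonneg_left h3 hκ.le)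
      have h5 : κ * (2 * (1 / (4 * κ)) * ‖p - q‖) = ‖p - q‖ / 2 := by field_simp; norm_num
      rw [mul_add, h5] at h4
      rw [div_mul_eq_mul_div, one_mul, div_le_iff₀ (by positivity)]
      linarith
    · exact (((isCompact_closedBall (0 : ℂ) 1).prod
        (isCompact_closedBall (0 : Rm m) t)).uniformContinuousOn_of_continuous hc.continuousOn).mono
          hsub

end IsDiscFamily

theorem theorem3p3 (m : ℕ) (α : ℝ≥0) (hα0 : 0 < α) (hα1 : α < 1) (r : ℝ) (hr : 0 < r) :
    (∃ (Ω : Set (Rm m × Perturbation m r)) (F : Rm m × Perturbation m r → HolDisc m α),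
      IsDiscFamily Ω F ∧
        ∀ p ∈ Ω, ∀ j : Fin m, ((F p).ext 0 j.succ).re = p.1 j) ∧
    ∀ (Ω : Set (Rm m × Perturbation m r)) (F : Rm m × Perturbation m r → HolDisc m α),
      IsDiscFamily Ω F →
      ∀ t : ℝ, 0 < t → t < 1 →
        ∃ N : Set (Perturbation m r), IsOpen N ∧ 0 ∈ N ∧
          closedBall (0 : Rm m) t ×ˢ N ⊆ Ω ∧
          (∀ φ ∈ N,
            IsC1Embedding (foliationMap F φ) (discTimesBall m t) ∧
            (∀ s ∈ ball (0 : Rm m) t,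
              IsAnalyticDisc (fun ξ => foliationMap F φ (ξ, s)) (perturbedSphere φ)) ∧
            foliationMap F φ '' discTimesBall m t =
              ⋃ s ∈ ball (0 : Rm m) t, (fun ξ => foliationMap F φ (ξ, s)) '' cDisc ∧
            (ball (0 : Rm m) t).PairwiseDisjoint
              fun s => (fun ξ => foliationMap F φ (ξ, s)) '' cDisc) ∧
          ∃ G : Perturbation m r → CkSpace 1 (discTimesBall m t) (Cn m),
            ContinuousOn G N ∧
              ∀ φ ∈ N, EqOn (G φ) (foliationMap F φ) (discTimesBall m t) := by
  refine ⟨exists_isDiscFamily m hα0 hα1 hr, fun Ω F h t ht0 ht1 => ?_⟩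
  obtain ⟨N, hN, h0, hsub, hemb⟩ := h.exists_foliation hα0 hα1 ht0 ht1
  refine ⟨N, hN, h0, hsub, fun φ hφ => ⟨hemb φ hφ, fun s hs => ?_, ?_, ?_⟩,
    h.exists_continuousOn_ckSpace hN hsub⟩
  · exact h.isAnalyticDisc (hsub ⟨ball_subset_closedBall hs, hφ⟩)
  · ext z
    simp only [discTimesBall, mem_image, mem_iUnion, mem_prod, Prod.exists, exists_prop]
    exact ⟨fun ⟨ξ, s, ⟨hξ, hs⟩, e⟩ => ⟨s, hs, ξ, hξ, e⟩, fun ⟨s, hs, ξ, hξ, e⟩ => ⟨ξ, s, ⟨hξ, hs⟩, e⟩⟩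
  · intro s hs s' hs' hne
    refine Set.disjoint_left.2 ?_
    rintro _ ⟨ξ, hξ, rfl⟩ ⟨ξ', hξ', he⟩
    have h1 : (⟨(ξ', s'), hξ', hs'⟩ : discTimesBall m t) = ⟨(ξ, s), hξ, hs⟩ :=
      (hemb φ hφ).isEmbedding.injective he
    exact hne (congrArg (fun p : discTimesBall m t => p.1.2) h1).symm
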